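/- **Setting (one step).** A requester assigns $M$ tasks with answers in $\{-1,+1\}$ to $N$ workers, each worker labelling every task. The true labels $\mathcal L(1),\dots,\mathcal L(M)$ are i.i.d. with $\Pr[\mathcal L(j)=-1]=\tau_{-1}$. Worker $i$ chooses $\mathsf{rpt}_i,\mathsf{eft}_i\in[0,1]$, the probabilities of reporting truthfully and of exerting high effort on a task. High effort costs $c_{i,H}>0$ per task and reveals the true label with probability $\mathbb P_{i,H}>\tfrac12$; low effort is free and reveals it with probability $\tfrac12$. Given the true labels, all labels are independent, and worker $i$'s label is correct with probability $$\mathbb P_i=\mathsf{rpt}_i\mathsf{eft}_i\mathbb P_{i,H}+(1-\mathsf{rpt}_i)\mathsf{eft}_i(1-\mathbb P_{i,H})+\tfrac12\mathsf{rpt}_i(1-\mathsf{eft}_i)+\tfrac12(1-\mathsf{rpt}_i)(1-\mathsf{eft}_i).$$ **Mechanism.** Let $\alpha_1,\alpha_2,\beta_{-1},\beta_{+1}$ be Dirichlet hyperparameters such that $2\alpha_1-1$, $2\alpha_2-1$, $2\beta_{\pm1}-1$ are positive integers and $\alpha_1>\alpha_2$. From the collected labels $L$, the mechanism runs a Gibbs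 sampler on label vectors $y\in\{-1,+1\}^M$ with target weight $$B\big(n_{-1}+2\beta_{-1}-1,\;n_{+1}+2\beta_{+1}-1\big)\prod_{i=1}^N B\big(s_i+2\alpha_1-1,\;M-s_i+2\alpha_2-1\big),\qquad B(x,y)=\frac{(x-1)!\,(y-1)!}{(x+y-1)!},$$ where $n_k=\#\{j:y(j)=k\}$ and $s_i=\#\{j:L_i(j)=y(j)\}$. It starts from the uniform distribution, and each sample is obtained from the previous one by resampling tasks $1,\dots,M$ in order. The score $\mathsf{sc}_i(j)$ is the fraction of samples number $W_0+1,\dots,W$ whose $j$-th entry equals $L_i(j)$. Worker $i$ is paid $a_t(\mathsf{sc}_i(j)-\tfrac12)+b$ for task $j$, with $b\ge 0$. The utility of worker $i$ is the expected total payment minus $M\,c_{i,H}\,\mathsf{eft}_i$. **Theorem (One Step IC).** For all such hyperparameters and every $\eta>0$ there is $M_0$ such that for every $M\ge M_0$ and every $N$ there is $W'$ such that the following holds for all $W\ge W'$ and $0\le W_0<W$. Suppose $\eta\le\tau_{-1}\le1-\eta$, $\tfrac12+\eta\le\mathbb P_{i,H}\le1-\eta$ and $c_{i,H}>0$ for all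 $i$, $b\ge0$, and $$\prod_{i=1}^N(2\mathbb P_{i,H})^2\ge M,\qquad a_t\ge(1+\eta)\max_i\frac{c_{i,H}}{\mathbb P_{i,H}-0.5}.$$ Then for every worker $i$, if all other workers report truthfully with high effort ($\mathsf{rpt}_k=\mathsf{eft}_k=1$ for $k\ne i$), the choice $\mathsf{rpt}_i=\mathsf{eft}_i=1$ gives worker $i$ a strictly larger utility than any other $(\mathsf{rpt}_i,\mathsf{eft}_i)\in[0,1]^2$. -/

import Mathlib

open Finset
open scoped Nat

namespace Crowd

noncomputable section

/-- A vector of binary labels for `M` tasks: `true` is the label `+1`, `false` the label `-1`. -/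
abbrev Labels (M : ℕ) := Fin M → Bool

/-- The beta function at positive integers, `B(x,y) = (x-1)! (y-1)! / (x+y-1)!`. -/
def betaFn (x y : ℕ) : ℝ := ((x - 1)! * (y - 1)! : ℝ) / ((x + y - 1)! : ℝ)

/-- The Dirichlet hyperparameters of the inference algorithm, recorded through the pseudo-counts
`correct = 2α₁ - 1`, `wrong = 2α₂ - 1`, `neg = 2β₋₁ - 1`, `pos = 2β₊₁ - 1`, which are positive
integers. The prior on accuracies leans towards correct labels: `α₁ > α₂`. -/
structure Prior where
  correct : ℕ
  wrong : ℕ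
  neg : ℕ
  pos : ℕ
  wrong_pos : 0 < wrong
  wrong_lt_correct : wrong < correct
  neg_pos : 0 < neg
  pos_pos : 0 < pos

/-- The unnormalised posterior weight `B(β̂) ∏ᵢ B(α̂ᵢ)` of the candidate true labels `y`, given the
collected labels `L`. -/
def posteriorWeight {N M : ℕ} (π : Prior) (L : Fin N → Labels M) (y : Labels M) : ℝ :=
  betaFn (#{j | y j = false} + π.neg) (#{j | y j = true} + π.pos) *
    ∏ i, betaFn (#{j | L i j = y j} + π.correct) (#{j | L i j ≠ y j} + π.wrong)

/-- One Gibbs update at task `j`: if the current label vector has law `μ`, and coordinate `j` is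
replaced by `k` with probability `w (y with j ↦ k) / (w (y with j ↦ -1) + w (y with j ↦ +1))`,
this is the law of the new label vector. -/
def gibbsUpdate {M : ℕ} (w : Labels M → ℝ) (μ : Labels M → ℝ) (j : Fin M) : Labels M → ℝ :=
  fun y => (μ (Function.update y j false) + μ (Function.update y j true)) *
    (w y / (w (Function.update y j false) + w (Function.update y j true)))

/-- One sweep of the Gibbs sampler: update the tasks one after the other in increasing order. -/
def gibbsSweep {M : ℕ} (w : Labels M → ℝ) (μ : Labels M → ℝ) : Labels M → ℝ :=
  (List.finRange M).foldl (gibbsUpdate w) μ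

/-- The law of the `s`-th sample of the Gibbs sampler, started from the uniform distribution. -/
def gibbsLaw {M : ℕ} (w : Labels M → ℝ) : ℕ → Labels M → ℝ
  | 0 => fun _ => 1 / 2 ^ M
  | s + 1 => gibbsSweep w (gibbsLaw w s)

/-- Expectation over the sampler, for given collected labels `L`, of worker `i`'s score on task `j`:
the score is the fraction of the samples `W₀ < s ≤ W` that agree with `L i j` at `j`. -/
def expectedScore {N M : ℕ} (π : Prior) (W₀ W : ℕ) (L : Fin N → Labels M) (i : Fin N) (j : Fin M) :
    ℝ :=
  (∑ s ∈ Ioc W₀ W, ∑ y, gibbsLaw (posteriorWeight π L) s y * (if y j = L i j then 1 else 0)) /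
    ((W : ℝ) - W₀)

/-- Probability of being correct of a worker who exerts high effort with probability `eft` and
reports truthfully with probability `rpt`, where `pH`, `pL` are the probabilities of observing the
true label under high and low effort. -/
def pobc (pH pL rpt eft : ℝ) : ℝ :=
  rpt * eft * pH + (1 - rpt) * eft * (1 - pH) +
    rpt * (1 - eft) * pL + (1 - rpt) * (1 - eft) * (1 - pL)

/-- Probability that the true labels are `y` and the collected labels are `L`: the true labels are
independent with `ℙ(-1) = τ`, and given them the labels of worker `i` are independent and correct
with probability `p i`. -/
def dataProb {N M : ℕ} (τ : ℝ) (p : Fin N → ℝ) (y : Labels M) (L : Fin N → Labels M) : ℝ :=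
  ∏ j, ((if y j = false then τ else 1 - τ) * ∏ i, (if L i j = y j then p i else 1 - p i))

/-- Expected utility of worker `i` in one step, for the strategy profile `(rpt, eft)`: the expected
total of the payments `a * (score - 1/2) + b` over all tasks, minus the expected cost of effort.
High effort costs `c i` per task, low effort is free and yields a correct observation with
probability `1/2`. -/
def expectedUtility {N M : ℕ} (π : Prior) (W₀ W : ℕ) (τ : ℝ) (pH c : Fin N → ℝ) (a b : ℝ)
    (rpt eft : Fin N → ℝ) (i : Fin N) : ℝ :=
  (∑ y : Labels M, ∑ L : Fin N → Labels M,
      dataProb τ (fun k => pobc (pH k) (1 / 2) (rpt k) (eft k)) y L *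
        ∑ j, (a * (expectedScore π W₀ W L i j - 1 / 2) + b)) -
    M * c i * eft i

end

end Crowd

/-! A strategy of worker `i` enters the data only through the accuracy `q = 1/2 + e(2r - 1)(pH i -
1/2)`. Once the Gibbs sampler is close to its stationary law, the expected total score of `i` is, up
to a small error, the average over the data of the posterior mean number of agreements with `i`
(`meanAgr`). A Russo-type formula (`hasDerivAt_sum_prob`) writes its derivative in `q` as a sum over
tasks `j` of the expected gain from turning label `j` of worker `i` from wrong to correct. If every
gain is at least `1 - δ`, the total score has slope almost `M` in `q`, and the slack `1 + η` in the
payment rate makes the incentive strict (`incentive_of_meanAgr`). The rest of the proof bounds the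
gain from below.

Labels are encoded by correctness bits `u` and candidate answers by error vectors `z` relative to
the truth. The class prior becomes one more source, which always answers `-1` and has accuracy `τ`.
The posterior weight is then a product over sources of a beta function of the number of agreements.
All sources except the class prior and `i` are informative, and `M ≤ ∏ (2 pH)² ≤ 4 ^ N` makes their
number `r` large. Two regimes remain.

If `M ≤ (r + 2) ^ 4`, the posterior concentrates on the truth. The expected posterior probability of
`z` is at most a product of Hellinger affinities, one per source (`sum_prob_mul_post_le`). Each
informative source contracts it by a fixed factor per error (`affinity_le_pow`), which beats the
polynomially many tasks. The complement of the truth explains the labels equally well up to a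
reversal of all accuracies. It is penalised only because `α₁ > α₂`, by a constant factor per
informative source.

If `M > (r + 2) ^ 4`, the posterior need not concentrate, but it is close to a weakly coupled
mean-field law. The beta weights are replaced by potentials whose increments are frozen outside the
window of typical agreements. Their second differences are `O(1/M)`, so the log-odds of an error on
one task hardly depend on the other tasks. Centred error indicators are then almost uncorrelated, a
self-bounding estimate controls the fluctuations (`meanSqDist_le`), and flipping one label moves the
agreements on all other tasks only by a small covariance (`abs_Ex_setAt_sub_le`). On the task itself
the gain is one minus the error probabilities. Candidates near the complement are folded onto those
near the truth (`foldMean`), and the intermediate ones are removed by the affinity bound. -/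

namespace Crowd

/-! ### Sums over orbits of an involution -/

section Pairing

/-- Summing a function over a finite type on which `a x, b x` enumerate the orbit of `x` under an
involution. -/
theorem sum_eq_half_sum_pair {X : Type*} [Fintype X] (σ : X → X) (hσ : Function.Involutive σ)
    (a b : X → X) (h : ∀ x, (a x = x ∧ b x = σ x) ∨ (a x = σ x ∧ b x = x)) (F : X → ℝ) :
    ∑ x, F x = (∑ x, (F (a x) + F (b x))) / 2 := by
  have h1 : ∑ x, F (σ x) = ∑ x, F x := Equiv.sum_comp (hσ.toPerm σ) F
  have h2 : ∑ x, (F (a x) + F (b x)) = ∑ x, (F x + F (σ x)) := by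
    refine sum_congr rfl fun x _ => ?_
    rcases h x with ⟨h1, h2⟩ | ⟨h1, h2⟩ <;> rw [h1, h2]
    ring
  rw [h2, sum_add_distrib, h1]
  ring

theorem sum_eq_half_sum_update {M : ℕ} (j : Fin M) (F : Labels M → ℝ) :
    ∑ y, F y = (∑ y, (F (Function.update y j false) + F (Function.update y j true))) / 2 := by
  refine sum_eq_half_sum_pair (fun y => Function.update y j (!y j)) (fun y => by simp) _ _
    (fun y => ?_) F
  cases h : y j
  · left; exact ⟨by rw [← h]; simp, by simp⟩
  · right; exact ⟨by simp, by rw [← h]; simp⟩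

end Pairing

/-! ### Convergence of the Gibbs sampler -/

section Gibbs

variable {M : ℕ} {w : Labels M → ℝ}

theorem gibbsUpdate_sub (μ ν : Labels M → ℝ) (j : Fin M) :
    gibbsUpdate w (fun y => μ y - ν y) j =
      fun y => gibbsUpdate w μ j y - gibbsUpdate w ν j y := by
  funext y
  simp only [gibbsUpdate]
  ring

theorem foldl_gibbsUpdate_sub (l : List (Fin M)) (μ ν : Labels M → ℝ) :
    l.foldl (gibbsUpdate w) (fun y => μ y - ν y) =
      fun y => l.foldl (gibbsUpdate w) μ y - l.foldl (gibbsUpdate w) ν y := by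
  induction l generalizing μ ν with
  | nil => rfl
  | cons j l ih => simp only [List.foldl_cons, gibbsUpdate_sub, ih]

theorem gibbsUpdate_nonneg (hw : ∀ y, 0 < w y) {μ : Labels M → ℝ} (hμ : ∀ y, 0 ≤ μ y)
    (j : Fin M) (y : Labels M) : 0 ≤ gibbsUpdate w μ j y :=
  mul_nonneg (add_nonneg (hμ _) (hμ _))
    (div_nonneg (hw _).le (add_nonneg (hw _).le (hw _).le))

theorem foldl_gibbsUpdate_nonneg (hw : ∀ y, 0 < w y) (l : List (Fin M)) {μ : Labels M → ℝ}
    (hμ : ∀ y, 0 ≤ μ y) (y : Labels M) : 0 ≤ l.foldl (gibbsUpdate w) μ y := by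
  induction l generalizing μ with
  | nil => exact hμ y
  | cons j l ih => exact ih (gibbsUpdate_nonneg hw hμ j)

theorem sum_gibbsUpdate (hw : ∀ y, 0 < w y) (μ : Labels M → ℝ) (j : Fin M) :
    ∑ y, gibbsUpdate w μ j y = ∑ y, μ y := by
  rw [sum_eq_half_sum_update j, sum_eq_half_sum_update j μ]
  congr 1
  refine sum_congr rfl fun y _ => ?_
  have h : 0 < w (Function.update y j false) + w (Function.update y j true) :=
    add_pos (hw _) (hw _)
  simp only [gibbsUpdate, Function.update_idem]
  field_simp

theorem sum_foldl_gibbsUpdate (hw : ∀ y, 0 < w y) (l : List (Fin M)) (μ : Labels M → ℝ) :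
    ∑ y, l.foldl (gibbsUpdate w) μ y = ∑ y, μ y := by
  induction l generalizing μ with
  | nil => rfl
  | cons j l ih => rw [List.foldl_cons, ih, sum_gibbsUpdate hw]

theorem foldl_gibbsUpdate_stationary (hw : ∀ y, 0 < w y) (l : List (Fin M)) (c : ℝ) :
    l.foldl (gibbsUpdate w) (fun y => c * w y) = fun y => c * w y := by
  induction l with
  | nil => rfl
  | cons j l ih =>
    rw [List.foldl_cons]
    convert ih using 2
    funext y
    have h : 0 < w (Function.update y j false) + w (Function.update y j true) :=
      add_pos (hw _) (hw _)
    simp only [gibbsUpdate]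
    field_simp

/-- Each update writes the wanted value into its coordinate with probability at least `κ`.
Coordinates in `l` are overwritten, so the starting point has to match the target only outside `l`.
-/
theorem le_foldl_gibbsUpdate (hw : ∀ y, 0 < w y) {κ : ℝ} (hκ : 0 ≤ κ)
    (hκw : ∀ y j, κ ≤ w y / (w (Function.update y j false) + w (Function.update y j true)))
    (l : List (Fin M)) {μ : Labels M → ℝ} (hμ : ∀ y, 0 ≤ μ y) (y y' : Labels M)
    (h : ∀ j, j ∉ l → y j = y' j) : κ ^ l.length * μ y' ≤ l.foldl (gibbsUpdate w) μ y := by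
  induction l generalizing μ y' with
  | nil =>
    have : y = y' := funext fun j => h j (by simp)
    simp [this]
  | cons j l ih =>
    rw [List.foldl_cons]
    have h1 := ih (gibbsUpdate_nonneg hw hμ j) (Function.update y' j (y j)) (fun k hk => by
      by_cases hkj : k = j
      · subst hkj; simp
      · rw [Function.update_of_ne hkj]
        exact h k (by simp [hk, hkj]))
    refine le_trans ?_ h1
    rw [List.length_cons, pow_succ, mul_assoc]
    refine mul_le_mul_of_nonneg_left ?_ (pow_nonneg hκ _)
    have h2 := hκw (Function.update y' j (y j)) j
    simp only [gibbsUpdate, Function.update_idem] at h2 ⊢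
    rw [mul_comm κ]
    refine mul_le_mul ?_ h2 hκ (add_nonneg (hμ _) (hμ _))
    cases hy : y' j
    · rw [show Function.update y' j false = y' by rw [← hy]; simp]
      linarith [hμ (Function.update y' j true)]
    · rw [show Function.update y' j true = y' by rw [← hy]; simp]
      linarith [hμ (Function.update y' j false)]

/-- Doeblin minorisation: a full sweep can reach every state from every state, so its image
dominates a multiple of the uniform law of total mass `κ ^ M` times the mass of `μ`. -/
theorem le_gibbsSweep (hw : ∀ y, 0 < w y) {κ : ℝ} (hκ : 0 ≤ κ)
    (hκw : ∀ y j, κ ≤ w y / (w (Function.update y j false) + w (Function.update y j true)))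
    {μ : Labels M → ℝ} (hμ : ∀ y, 0 ≤ μ y) (y : Labels M) :
    κ ^ M / 2 ^ M * ∑ y', μ y' ≤ gibbsSweep w μ y := by
  have h : ∑ _y' : Labels M, gibbsSweep w μ y ≥ ∑ y', κ ^ M * μ y' := by
    refine sum_le_sum fun y' _ => ?_
    have := le_foldl_gibbsUpdate hw hκ hκw (List.finRange M) hμ y y' (fun j hj => by simp at hj)
    simpa [gibbsSweep] using this
  rw [← mul_sum] at h
  simp only [sum_const, card_univ, Fintype.card_pi, Fintype.card_bool, prod_const,
    Fintype.card_fin, nsmul_eq_mul, Nat.cast_pow, Nat.cast_ofNat] at h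
  rw [div_mul_eq_mul_div, div_le_iff₀ (by positivity)]
  linarith

/-- The positive and negative parts of `d` have equal mass, so their images dominate the same
constant function, which cancels in the difference. -/
theorem sum_abs_gibbsSweep_le (hw : ∀ y, 0 < w y) {κ : ℝ} (hκ : 0 ≤ κ)
    (hκw : ∀ y j, κ ≤ w y / (w (Function.update y j false) + w (Function.update y j true)))
    (d : Labels M → ℝ) (hd : ∑ y, d y = 0) :
    ∑ y, |gibbsSweep w d y| ≤ (1 - κ ^ M) * ∑ y, |d y| := by
  set dp : Labels M → ℝ := fun y => max (d y) 0
  set dm : Labels M → ℝ := fun y => max (-d y) 0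
  have hsub : d = fun y => dp y - dm y := by
    funext y; simp only [dp, dm]
    rcases le_total (d y) 0 with h | h <;> simp [h]
  have habs : ∀ y, |d y| = dp y + dm y := by
    intro y; simp only [dp, dm]
    rcases le_total (d y) 0 with h | h <;> simp [h, abs_of_nonpos, abs_of_nonneg]
  have hp : ∀ y, 0 ≤ dp y := fun y => le_max_right _ _
  have hm : ∀ y, 0 ≤ dm y := fun y => le_max_right _ _
  have hS : ∑ y, dp y = ∑ y, dm y := by
    have : ∑ y, (dp y - dm y) = 0 := by rw [← hd]; exact sum_congr rfl fun y _ => by rw [hsub]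
    rw [sum_sub_distrib] at this
    linarith
  have h1 := le_gibbsSweep hw hκ hκw hp
  have h2 := le_gibbsSweep hw hκ hκw hm
  have h3 : ∀ y, |gibbsSweep w d y| ≤
      gibbsSweep w dp y + gibbsSweep w dm y - 2 * (κ ^ M / 2 ^ M * ∑ y', dp y') := by
    intro y
    have : gibbsSweep w d y = gibbsSweep w dp y - gibbsSweep w dm y := by
      conv_lhs => rw [hsub]
      simp only [gibbsSweep, foldl_gibbsUpdate_sub]
    have h1 := h1 y
    have h2 := h2 y
    rw [← hS] at h2
    rw [this, abs_le]
    constructor <;> linarith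
  refine (sum_le_sum fun y _ => h3 y).trans ?_
  simp only [habs, sum_sub_distrib, sum_add_distrib, gibbsSweep, sum_foldl_gibbsUpdate hw, ← hS]
  simp only [sum_const, card_univ, Fintype.card_pi, Fintype.card_bool, prod_const,
    Fintype.card_fin, nsmul_eq_mul, Nat.cast_pow, Nat.cast_ofNat]
  apply le_of_eq
  field_simp
  ring

theorem sum_gibbsLaw (hw : ∀ y, 0 < w y) (s : ℕ) : ∑ y, gibbsLaw w s y = 1 := by
  induction s with
  | zero => simp [gibbsLaw]
  | succ s ih => rw [gibbsLaw, gibbsSweep, sum_foldl_gibbsUpdate hw, ih]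

theorem gibbsLaw_nonneg (hw : ∀ y, 0 < w y) (s : ℕ) (y : Labels M) : 0 ≤ gibbsLaw w s y := by
  induction s generalizing y with
  | zero => simp [gibbsLaw]
  | succ s ih => exact foldl_gibbsUpdate_nonneg hw _ ih y

/-- The normalised weight is stationary, and each sweep contracts the distance to it in total
variation by `1 - κ ^ M`. -/
theorem tendsto_gibbsLaw (hw : ∀ y, 0 < w y) (y : Labels M) :
    Filter.Tendsto (fun s => gibbsLaw w s y) Filter.atTop (nhds (w y / ∑ y', w y')) := by
  have hZ : 0 < ∑ y', w y' := sum_pos (fun y _ => hw y) univ_nonempty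
  obtain ⟨κ, hκ0, hκw⟩ : ∃ κ : ℝ, 0 < κ ∧ ∀ (y : Labels M) (j : Fin M),
      κ ≤ w y / (w (Function.update y j false) + w (Function.update y j true)) := by
    obtain ⟨y0, -, hy0⟩ := exists_min_image univ w univ_nonempty
    refine ⟨w y0 / ∑ y', w y', div_pos (hw _) hZ, fun y j => ?_⟩
    refine div_le_div₀ (hw _).le (hy0 y (mem_univ _)) (add_pos (hw _) (hw _)) ?_
    have hne : Function.update y j false ≠ Function.update y j true := fun h => by
      simpa using congrFun h j
    rw [← sum_pair hne]
    exact sum_le_sum_of_subset_of_nonneg (subset_univ _) fun y _ _ => (hw y).le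
  -- Without tasks nothing bounds `κ`, but then `κ ^ M = 1`.
  have hκ1 : κ ≤ 1 ∨ M = 0 := by
    rcases Nat.eq_zero_or_pos M with h | h
    · right; exact h
    · left
      refine (hκw (fun _ => false) ⟨0, h⟩).trans ?_
      rw [div_le_one (add_pos (hw _) (hw _))]
      have : Function.update (fun _ => false) (⟨0, h⟩ : Fin M) false = fun _ => false := by simp
      rw [this]
      linarith [hw (Function.update (fun _ => false) (⟨0, h⟩ : Fin M) true)]
  have hr0 : 0 ≤ 1 - κ ^ M := by
    rcases hκ1 with h | h
    · linarith [pow_le_one₀ hκ0.le h (n := M)]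
    · simp [h]
  have hr1 : 1 - κ ^ M < 1 := by linarith [pow_pos hκ0 M]
  set st : Labels M → ℝ := fun y => (∑ y', w y')⁻¹ * w y
  have hst : ∑ y, st y = 1 := by
    simp only [st, ← mul_sum]
    exact inv_mul_cancel₀ hZ.ne'
  have key : ∀ s, ∑ y, |gibbsLaw w s y - st y| ≤
      (1 - κ ^ M) ^ s * ∑ y, |gibbsLaw w 0 y - st y| := by
    intro s
    induction s with
    | zero => simp
    | succ s ih =>
      have h1 : ∀ y, gibbsLaw w (s + 1) y - st y =
          gibbsSweep w (fun y => gibbsLaw w s y - st y) y := by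
        intro y
        rw [gibbsLaw, gibbsSweep, gibbsSweep, foldl_gibbsUpdate_sub]
        simp only [st, foldl_gibbsUpdate_stationary hw]
      simp only [h1]
      refine (sum_abs_gibbsSweep_le hw hκ0.le hκw _ ?_).trans ?_
      · rw [sum_sub_distrib, sum_gibbsLaw hw, hst, sub_self]
      · rw [pow_succ', mul_assoc]
        exact mul_le_mul_of_nonneg_left ih hr0
  have hlim : Filter.Tendsto (fun s => (1 - κ ^ M) ^ s * ∑ y, |gibbsLaw w 0 y - st y|)
      Filter.atTop (nhds 0) := by
    simpa using (tendsto_pow_atTop_nhds_zero_of_lt_one hr0 hr1).mul_const _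
  have h3 : w y / ∑ y', w y' = st y := by simp only [st]; field_simp
  rw [h3, tendsto_iff_dist_tendsto_zero]
  refine squeeze_zero (fun _ => dist_nonneg) (fun s => ?_) hlim
  rw [Real.dist_eq]
  exact (single_le_sum (f := fun y => |gibbsLaw w s y - st y|) (fun y _ => abs_nonneg _)
    (mem_univ y)).trans (key s)

end Gibbs


/-! ### Averages over samples, uniformly in the burn-in -/

section Cesaro

theorem exists_abs_average_sub_le {a : ℕ → ℝ} {l : ℝ}
    (ha : Filter.Tendsto a Filter.atTop (nhds l)) (hb : ∀ s, |a s - l| ≤ 1) {ξ : ℝ} (hξ : 0 < ξ) :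
    ∃ W' : ℕ, ∀ W₀ W : ℕ, W' ≤ W → W₀ < W →
      |(∑ s ∈ Ioc W₀ W, a s) / ((W : ℝ) - W₀) - l| ≤ ξ := by
  obtain ⟨s₀, hs₀⟩ := Metric.tendsto_atTop.1 ha (ξ / 2) (by positivity)
  -- Early samples are averaged in only if `W₀ < s₀`. The second summand then makes `W - W₀` at
  -- least `2 s₀ / ξ`, so these at most `s₀` samples contribute at most `ξ / 2`.
  refine ⟨s₀ + ⌈2 * s₀ / ξ⌉₊, fun W₀ W hW hW₀ => ?_⟩
  have hpos : (0 : ℝ) < (W : ℝ) - W₀ := by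
    have : (W₀ : ℝ) < W := by exact_mod_cast hW₀
    linarith
  have hcard : ((#(Ioc W₀ W) : ℕ) : ℝ) = (W : ℝ) - W₀ := by
    rw [Nat.card_Ioc, Nat.cast_sub hW₀.le]
  have h1 : (∑ s ∈ Ioc W₀ W, a s) / ((W : ℝ) - W₀) - l =
      (∑ s ∈ Ioc W₀ W, (a s - l)) / ((W : ℝ) - W₀) := by
    rw [sum_sub_distrib, sum_const, nsmul_eq_mul, hcard]
    field_simp
  have h2 : ∑ s ∈ Ioc W₀ W, |a s - l| ≤
      ∑ s ∈ Ioc W₀ W, (ξ / 2 + if s < s₀ then 1 else 0) := by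
    refine sum_le_sum fun s _ => ?_
    split_ifs with h
    · linarith [hb s]
    · have := hs₀ s (not_lt.1 h)
      rw [Real.dist_eq] at this
      linarith
  have h3 : ∑ s ∈ Ioc W₀ W, (if s < s₀ then (1 : ℝ) else 0) ≤ ξ / 2 * ((W : ℝ) - W₀) := by
    rw [sum_boole]
    rcases le_or_gt s₀ W₀ with h | h
    · have : {x ∈ Ioc W₀ W | x < s₀} = ∅ := by
        ext x; simp only [mem_filter, mem_Ioc, notMem_empty, iff_false]; omega
      rw [this]
      simp only [card_empty, Nat.cast_zero]
      positivity
    · have h4 : #{x ∈ Ioc W₀ W | x < s₀} ≤ s₀ := by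
        calc _ ≤ #(range s₀) := card_le_card fun x hx => by
                simp only [mem_filter] at hx; exact mem_range.2 hx.2
          _ = s₀ := card_range _
      have h5 : (#{x ∈ Ioc W₀ W | x < s₀} : ℝ) ≤ s₀ := by exact_mod_cast h4
      have h6 : 2 * s₀ / ξ ≤ (⌈2 * s₀ / ξ⌉₊ : ℝ) := Nat.le_ceil _
      have h7 : (s₀ : ℝ) + ⌈2 * s₀ / ξ⌉₊ ≤ W := by exact_mod_cast hW
      have h8 : (W₀ : ℝ) ≤ s₀ := by exact_mod_cast h.le
      have h9 : 2 * s₀ / ξ ≤ (W : ℝ) - W₀ := by linarith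
      rw [div_le_iff₀ hξ] at h9
      linarith
  rw [h1, abs_div, abs_of_pos hpos, div_le_iff₀ hpos]
  calc |∑ s ∈ Ioc W₀ W, (a s - l)| ≤ ∑ s ∈ Ioc W₀ W, |a s - l| := abs_sum_le_sum_abs _ _
    _ ≤ _ := h2
    _ ≤ ξ / 2 * ((W : ℝ) - W₀) + ξ / 2 * ((W : ℝ) - W₀) := by
      rw [sum_add_distrib, sum_const, nsmul_eq_mul, hcard]
      linarith
    _ = _ := by ring

end Cesaro

/-! ### Sources, correctness vectors and Russo's formula -/

section Sources

variable {ι : Type*} {M N : ℕ}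

/-- The number of tasks on which an error vector `z` makes the source with correctness vector `u`
agree with the candidate labels. -/
def agr (u z : Fin M → Bool) : ℕ := #{j | u j ≠ z j}

/-- The beta weight of a source with `s` agreements out of `M`. -/
noncomputable def betaWt (M c w s : ℕ) : ℝ := betaFn (s + c) (M - s + w)

/-- The posterior weight of the error vector `z`, given the correctness vectors of the sources. -/
noncomputable def wt [Fintype ι] (c w : ι → ℕ) (u : ι → Fin M → Bool) (z : Fin M → Bool) : ℝ :=
  ∏ k, betaWt M (c k) (w k) (agr (u k) z)

/-- The posterior mean number of agreements of source `i`. -/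
noncomputable def meanAgr [Fintype ι] (c w : ι → ℕ) (u : ι → Fin M → Bool) (i : ι) : ℝ :=
  (∑ z, wt c w u z * agr (u i) z) / ∑ z, wt c w u z

/-- The Bernoulli weight with parameter `p`. -/
noncomputable def bern (p : ℝ) (v : Bool) : ℝ := if v then p else 1 - p

/-- The probability of the correctness vectors `u` when source `k` has accuracy `p k`. -/
noncomputable def prob [Fintype ι] (p : ι → ℝ) (u : ι → Fin M → Bool) : ℝ := ∏ k, ∏ j, bern (p k) (u k j)

/-- Set the correctness of source `i` on task `j`. -/
def setAt [DecidableEq ι] (u : ι → Fin M → Bool) (i : ι) (j : Fin M) (b : Bool) :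
    ι → Fin M → Bool :=
  Function.update u i (Function.update (u i) j b)

theorem agr_le (u z : Fin M → Bool) : agr u z ≤ M :=
  (card_le_univ _).trans (by simp)

theorem card_eq_add_agr (u z : Fin M → Bool) : #{j | u j = z j} + agr u z = M := by
  unfold agr
  rw [card_filter_add_card_filter_not]
  simp

theorem betaFn_pos (x y : ℕ) : 0 < betaFn x y := by
  unfold betaFn
  positivity

theorem betaWt_pos (M c w s : ℕ) : 0 < betaWt M c w s := betaFn_pos _ _

theorem wt_pos [Fintype ι] (c w : ι → ℕ) (u : ι → Fin M → Bool) (z : Fin M → Bool) :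
    0 < wt c w u z := prod_pos fun _ _ => betaWt_pos _ _ _ _

theorem bern_nonneg {p : ℝ} (h0 : 0 ≤ p) (h1 : p ≤ 1) (v : Bool) : 0 ≤ bern p v := by
  unfold bern; split_ifs <;> linarith

theorem prob_nonneg [Fintype ι] {p : ι → ℝ} (h0 : ∀ k, 0 ≤ p k) (h1 : ∀ k, p k ≤ 1)
    (u : ι → Fin M → Bool) : 0 ≤ prob p u :=
  prod_nonneg fun k _ => prod_nonneg fun _ _ => bern_nonneg (h0 k) (h1 k) _

theorem sum_prod_pi {α β : Type*} [Fintype α] [DecidableEq α] [Fintype β] (f : α → β → ℝ) :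
    ∑ u : α → β, ∏ a, f a (u a) = ∏ a, ∑ b, f a b := by
  rw [prod_univ_sum, Fintype.piFinset_univ]

theorem sum_bern (p : ℝ) : ∑ b, bern p b = 1 := by
  simp [bern]

theorem sum_prod_bern (p : ℝ) (f : Fin M → Bool → ℝ) :
    ∑ v : Fin M → Bool, (∏ j, bern p (v j)) * ∏ j, f j (v j) =
      ∏ j, (p * f j true + (1 - p) * f j false) := by
  simp_rw [← prod_mul_distrib]
  rw [sum_prod_pi fun j b => bern p b * f j b]
  simp [bern]

theorem sum_prob [Fintype ι] [DecidableEq ι] (p : ι → ℝ) :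
    ∑ u : ι → Fin M → Bool, prob p u = 1 := by
  unfold prob
  rw [sum_prod_pi fun k (v : Fin M → Bool) => ∏ j, bern (p k) (v j)]
  refine prod_eq_one fun k _ => ?_
  rw [sum_prod_pi fun (_ : Fin M) b => bern (p k) b]
  exact prod_eq_one fun _ _ => sum_bern _

theorem setAt_apply_ne [DecidableEq ι] (u : ι → Fin M → Bool) (i : ι) (j : Fin M) (b : Bool)
    {k : ι} (hk : k ≠ i) : setAt u i j b k = u k := by
  simp [setAt, hk]

theorem setAt_self [DecidableEq ι] (u : ι → Fin M → Bool) (i : ι) (j : Fin M) (b : Bool) :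
    setAt u i j b i = Function.update (u i) j b := by
  simp [setAt]

theorem setAt_setAt [DecidableEq ι] (u : ι → Fin M → Bool) (i : ι) (j : Fin M) (b b' : Bool) :
    setAt (setAt u i j b) i j b' = setAt u i j b' := by
  simp [setAt]

theorem setAt_eq_self [DecidableEq ι] (u : ι → Fin M → Bool) (i : ι) (j : Fin M) :
    setAt u i j (u i j) = u := by
  simp [setAt]

theorem sum_eq_half_sum_setAt [Fintype ι] [DecidableEq ι] (i : ι) (j : Fin M)
    (F : (ι → Fin M → Bool) → ℝ) :
    ∑ u, F u = (∑ u, (F (setAt u i j false) + F (setAt u i j true))) / 2 := by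
  refine sum_eq_half_sum_pair (fun u => setAt u i j (!u i j)) (fun u => ?_) _ _
    (fun u => ?_) F
  · simp only [setAt_setAt]
    rw [setAt_self]
    simpa using setAt_eq_self u i j
  · have := setAt_eq_self u i j
    cases h : u i j <;> rw [h] at this
    · left; exact ⟨this, by simp⟩
    · right; exact ⟨by simp, this⟩

/-- The part of `prob` not depending on the correctness of source `i` on task `j`. -/
theorem prob_setAt [Fintype ι] [DecidableEq ι] (p : ι → ℝ) (i : ι) (j : Fin M)
    (u : ι → Fin M → Bool) (b : Bool) :
    prob p (setAt u i j b) = bern (p i) b *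
      ((∏ k ∈ univ.erase i, ∏ j, bern (p k) (u k j)) *
        ∏ j' ∈ univ.erase j, bern (p i) (u i j')) := by
  unfold prob
  rw [← mul_prod_erase _ _ (mem_univ i), setAt_self, ← mul_prod_erase _ _ (mem_univ j)]
  have h1 : ∏ x ∈ univ.erase j, bern (p i) (Function.update (u i) j b x) =
      ∏ x ∈ univ.erase j, bern (p i) (u i x) :=
    prod_congr rfl fun x hx => by rw [Function.update_of_ne (ne_of_mem_erase hx)]
  have h2 : ∏ k ∈ univ.erase i, ∏ j', bern (p k) (setAt u i j b k j') =
      ∏ k ∈ univ.erase i, ∏ j, bern (p k) (u k j) :=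
    prod_congr rfl fun x hx => by rw [setAt_apply_ne _ _ _ _ (ne_of_mem_erase hx)]
  rw [h1, h2, Function.update_self]
  ring

/-- Forcing one bit amounts to conditioning on an event of probability at least `η`, which inflates
the mean of a nonnegative function by at most `1 / η`. -/
theorem sum_prob_mul_setAt_le [Fintype ι] [DecidableEq ι] {p : ι → ℝ} (h0 : ∀ k, 0 ≤ p k)
    (h1 : ∀ k, p k ≤ 1) {η : ℝ} (hη : 0 < η) (i : ι) (hi0 : η ≤ p i) (hi1 : p i ≤ 1 - η)
    (j : Fin M) (b : Bool) {F : (ι → Fin M → Bool) → ℝ} (hF : ∀ u, 0 ≤ F u) :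
    ∑ u, prob p u * F (setAt u i j b) ≤ (∑ u, prob p u * F u) / η := by
  rw [sum_eq_half_sum_setAt i j, sum_eq_half_sum_setAt i j (fun u => prob p u * F u),
    le_div_iff₀ hη, div_mul_eq_mul_div]
  refine div_le_div_of_nonneg_right ?_ (by norm_num)
  rw [sum_mul]
  refine sum_le_sum fun u _ => ?_
  simp only [setAt_setAt, prob_setAt]
  set R := (∏ k ∈ univ.erase i, ∏ j, bern (p k) (u k j)) *
        ∏ j' ∈ univ.erase j, bern (p i) (u i j')
  have hR : 0 ≤ R := mul_nonneg
    (prod_nonneg fun k _ => prod_nonneg fun _ _ => bern_nonneg (h0 k) (h1 k) _)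
    (prod_nonneg fun _ _ => bern_nonneg (h0 i) (h1 i) _)
  have hRt := mul_nonneg hR (hF (setAt u i j true))
  have hRf := mul_nonneg hR (hF (setAt u i j false))
  cases b <;> simp only [bern, if_true, Bool.false_eq_true, if_false]
  · nlinarith
  · nlinarith

/-- Russo's formula: the Bernoulli law of one bit has derivative point mass at `true` minus point
mass at `false`. The product rule sums this over the bits of source `i`, and pairing the two values
of the bit restores its own Bernoulli weight. -/
theorem hasDerivAt_sum_prob [Fintype ι] [DecidableEq ι] (p : ι → ℝ) (i : ι)
    (g : (ι → Fin M → Bool) → ℝ) (q : ℝ) :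
    HasDerivAt (fun q => ∑ u, prob (Function.update p i q) u * g u)
      (∑ j, ∑ u, prob (Function.update p i q) u *
        (g (setAt u i j true) - g (setAt u i j false))) q := by
  set rest : (ι → Fin M → Bool) → ℝ := fun u => ∏ k ∈ univ.erase i, ∏ j, bern (p k) (u k j)
  have hprob : ∀ q u, prob (Function.update p i q) u = rest u * ∏ j, bern q (u i j) := by
    intro q u
    unfold prob
    rw [← mul_prod_erase _ _ (mem_univ i), mul_comm, Function.update_self]
    congr 1
    exact prod_congr rfl fun x hx => by rw [Function.update_of_ne (ne_of_mem_erase hx)]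
  have hb : ∀ (v : Bool) (q : ℝ), HasDerivAt (fun q => bern q v) (if v then 1 else -1) q := by
    intro v q
    cases v
    · simpa [bern] using (hasDerivAt_id q).const_sub 1
    · simpa [bern] using hasDerivAt_id' q
  have hd : ∀ u : ι → Fin M → Bool, HasDerivAt (fun q => prob (Function.update p i q) u * g u)
      (∑ j, rest u * (∏ j' ∈ univ.erase j, bern q (u i j')) * (if u i j then 1 else -1) * g u)
      q := by
    intro u
    simp only [hprob]
    have := ((HasDerivAt.fun_finsetProd (u := univ) (fun j _ => hb (u i j) q)).const_mul
      (rest u)).mul_const (g u)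
    refine this.congr_deriv ?_
    simp only [smul_eq_mul, mul_sum, sum_mul]
    exact sum_congr rfl fun j _ => by ring
  refine (HasDerivAt.fun_sum (u := univ) (fun u _ => hd u)).congr_deriv ?_
  rw [sum_comm (s := univ) (t := univ)
    (f := fun u j => rest u * (∏ j' ∈ univ.erase j, bern q (u i j')) *
      (if u i j then 1 else -1) * g u)]
  refine sum_congr rfl fun j _ => ?_
  rw [sum_eq_half_sum_setAt i j (fun u => prob _ u * _), sum_eq_half_sum_setAt i j
    (fun u => rest u * (∏ j' ∈ univ.erase j, bern q (u i j')) * (if u i j then 1 else -1) * g u)]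
  congr 1
  refine sum_congr rfl fun u _ => ?_
  have h1 : ∀ b, rest (setAt u i j b) = rest u := fun b =>
    prod_congr rfl fun x hx => by rw [setAt_apply_ne _ _ _ _ (ne_of_mem_erase hx)]
  have h2 : ∀ b, ∏ j' ∈ univ.erase j, bern q (setAt u i j b i j') =
      ∏ j' ∈ univ.erase j, bern q (u i j') := fun b =>
    prod_congr rfl fun x hx => by
      rw [setAt_self, Function.update_of_ne (ne_of_mem_erase hx)]
  have h3 : ∏ k ∈ univ.erase i, ∏ j, bern (Function.update p i q k) (u k j) = rest u :=
    prod_congr rfl fun x hx => by rw [Function.update_of_ne (ne_of_mem_erase hx)]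
  simp only [setAt_setAt, prob_setAt, h1, h2, h3]
  simp only [setAt_self, Function.update_self, bern, if_true, Bool.false_eq_true, if_false]
  ring

end Sources

/-! ### From labels and payments to correctness vectors -/

section Reduction

variable {M N : ℕ}

/-- The true labels encoded by the correctness of the class prior, which always answers `-1`. -/
def truthOf (u : Option (Fin N) → Fin M → Bool) : Labels M := fun j => !u none j

/-- The collected labels encoded by the correctness vectors. -/
def labelsOf (u : Option (Fin N) → Fin M → Bool) : Fin N → Labels M :=
  fun k j => u (some k) j == !u none j

/-- Labels are equivalent to correctness vectors. -/
def labelsEquiv : (Option (Fin N) → Fin M → Bool) ≃ Labels M × (Fin N → Labels M) where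
  toFun u := (truthOf u, labelsOf u)
  invFun q := fun o j => o.elim (!q.1 j) fun k => q.2 k j == q.1 j
  left_inv u := by
    funext o j
    cases o <;> simp [truthOf, labelsOf]
  right_inv q := by
    refine Prod.ext ?_ ?_
    · funext j; simp [truthOf]
    · funext k j; simp [labelsOf]

/-- The pseudo-counts in favour of a correct answer, over all sources. -/
def Prior.cc (π : Prior) (N : ℕ) : Option (Fin N) → ℕ := fun o => o.elim π.neg fun _ => π.correct

/-- The pseudo-counts in favour of a wrong answer, over all sources. -/
def Prior.ww (π : Prior) (N : ℕ) : Option (Fin N) → ℕ := fun o => o.elim π.pos fun _ => π.wrong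

/-- The random truth is the correctness vector of a source that always answers `-1`. It is right
with probability `τ`, independently of whether the workers are right. -/
theorem dataProb_labelsOf (τ : ℝ) (p : Fin N → ℝ) (u : Option (Fin N) → Fin M → Bool) :
    dataProb τ p (truthOf u) (labelsOf u) = prob (fun o => o.elim τ p) u := by
  unfold dataProb prob
  rw [Fintype.prod_option, prod_mul_distrib]
  congr 1
  · refine prod_congr rfl fun j _ => ?_
    simp [truthOf, bern]
  · rw [prod_comm]
    refine prod_congr rfl fun k _ => prod_congr rfl fun j _ => ?_
    have h : ∀ a b : Bool, ((a == !b) = !b) ↔ a = true := by decide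
    simp only [truthOf, labelsOf, bern, Option.elim, h]

/-- Flipping the labels by the truth, as an equivalence between error vectors and candidates. -/
def candidateEquiv (t : Labels M) : (Fin M → Bool) ≃ Labels M :=
  Function.Involutive.toPerm (fun z j => t j ^^ z j) fun z => by
    funext j; simp

theorem candidateEquiv_apply (t : Labels M) (z : Fin M → Bool) (j : Fin M) :
    candidateEquiv t z j = (t j ^^ z j) := rfl

theorem card_labelsOf_eq (u : Option (Fin N) → Fin M → Bool) (k : Fin N) (z : Fin M → Bool) :
    #{j | candidateEquiv (truthOf u) z j = labelsOf u k j} = agr (u (some k)) z := by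
  unfold agr
  congr 1
  refine filter_congr fun j _ => ?_
  simp only [candidateEquiv_apply, truthOf, labelsOf]
  have h : ∀ a b c : Bool, ((!b ^^ c) = (a == !b)) ↔ a ≠ c := by decide
  exact h _ _ _

/-- A candidate has as many labels `-1` as agreements with the constant source, so the class-prior
factor has the same form as a worker's factor, with pseudo-counts `neg` and `pos`. -/
theorem posteriorWeight_labelsOf (π : Prior) (u : Option (Fin N) → Fin M → Bool)
    (z : Fin M → Bool) :
    posteriorWeight π (labelsOf u) (candidateEquiv (truthOf u) z) =
      wt (π.cc N) (π.ww N) u z := by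
  have hsub : ∀ v : Fin M → Bool, #{j | v j = z j} = M - agr v z := fun v => by
    have := card_eq_add_agr v z
    omega
  unfold posteriorWeight wt
  rw [Fintype.prod_option]
  congr 1
  · unfold betaWt
    rw [← hsub]
    unfold agr
    simp only [Prior.cc, Prior.ww, Option.elim]
    have h1 : ∀ b c : Bool, ((!b ^^ c) = false) ↔ b ≠ c := by decide
    have h2 : ∀ b c : Bool, ((!b ^^ c) = true) ↔ b = c := by decide
    simp only [candidateEquiv_apply, truthOf, h1, h2]
  · refine prod_congr rfl fun k _ => ?_
    unfold betaWt
    rw [← hsub, ← card_labelsOf_eq]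
    have h1 : ∀ a b c : Bool, ((a == !b) = (!b ^^ c)) ↔ (!b ^^ c) = (a == !b) := by decide
    have h2 : ∀ a b c : Bool, ((a == !b) ≠ (!b ^^ c)) ↔ a = c := by decide
    simp only [Prior.cc, Prior.ww, Option.elim, candidateEquiv_apply, truthOf, labelsOf, h1, h2]
    congr!

theorem meanAgr_labelsOf (π : Prior) (u : Option (Fin N) → Fin M → Bool) (i : Fin N) :
    ∑ j, ∑ y, (posteriorWeight π (labelsOf u) y / ∑ y', posteriorWeight π (labelsOf u) y') *
      (if y j = labelsOf u i j then 1 else 0) = meanAgr (π.cc N) (π.ww N) u (some i) := by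
  unfold meanAgr
  rw [sum_comm, sum_div, ← Equiv.sum_comp (candidateEquiv (truthOf u)),
    ← Equiv.sum_comp (candidateEquiv (truthOf u)) (posteriorWeight π (labelsOf u))]
  refine sum_congr rfl fun z _ => ?_
  rw [← mul_sum, sum_boole, card_labelsOf_eq]
  simp only [posteriorWeight_labelsOf]
  ring

theorem posteriorWeight_pos (π : Prior) (L : Fin N → Labels M) (y : Labels M) :
    0 < posteriorWeight π L y :=
  mul_pos (betaFn_pos _ _) (prod_pos fun _ _ => betaFn_pos _ _)

/-- The expected score converges, uniformly in the burn-in. -/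
theorem exists_abs_expectedScore_sub_le (π : Prior) (L : Fin N → Labels M) (i : Fin N) (j : Fin M)
    {ξ : ℝ} (hξ : 0 < ξ) : ∃ W' : ℕ, ∀ W₀ W : ℕ, W' ≤ W → W₀ < W →
      |expectedScore π W₀ W L i j - ∑ y, (posteriorWeight π L y / ∑ y', posteriorWeight π L y') *
        (if y j = L i j then 1 else 0)| ≤ ξ := by
  have hw := posteriorWeight_pos π L
  have hZ : 0 < ∑ y', posteriorWeight π L y' := sum_pos (fun y _ => hw y) univ_nonempty
  refine exists_abs_average_sub_le (tendsto_finsetSum _ fun y _ =>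
    (tendsto_gibbsLaw hw y).mul_const _) (fun s => ?_) hξ
  have bound : ∀ f : Labels M → ℝ, (∀ y, 0 ≤ f y) → ∑ y, f y = 1 →
      0 ≤ ∑ y, f y * (if y j = L i j then 1 else 0) ∧
        ∑ y, f y * (if y j = L i j then 1 else 0) ≤ 1 := by
    intro f hf hf1
    refine ⟨sum_nonneg fun y _ => mul_nonneg (hf y) (by split_ifs <;> norm_num), ?_⟩
    refine (sum_le_sum fun y _ => ?_).trans_eq hf1
    split_ifs
    · exact (mul_one _).le
    · rw [mul_zero]; exact hf y
  have h1 := bound _ (gibbsLaw_nonneg hw s) (sum_gibbsLaw hw s)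
  have h2 := bound (fun y => posteriorWeight π L y / ∑ y', posteriorWeight π L y')
    (fun y => (div_pos (hw y) hZ).le) (by rw [← sum_div]; exact div_self hZ.ne')
  rw [abs_le]
  constructor <;> linarith [h1.1, h1.2, h2.1, h2.2]

theorem exists_abs_sum_expectedScore_sub_le (π : Prior) (M N : ℕ) {ξ : ℝ} (hξ : 0 < ξ) :
    ∃ W' : ℕ, ∀ W₀ W : ℕ, W' ≤ W → W₀ < W → ∀ (u : Option (Fin N) → Fin M → Bool) (i : Fin N),
      |∑ j, expectedScore π W₀ W (labelsOf u) i j - meanAgr (π.cc N) (π.ww N) u (some i)| ≤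
        M * ξ := by
  choose W' hW' using fun (q : (Fin N → Labels M) × Fin N × Fin M) =>
    exists_abs_expectedScore_sub_le π q.1 q.2.1 q.2.2 hξ
  -- There are finitely many label matrices, workers and tasks, so one `W'` serves them all. It
  -- depends on neither the strategies nor the costs.
  refine ⟨univ.sup W', fun W₀ W hW hW₀ u i => ?_⟩
  rw [← meanAgr_labelsOf, ← sum_sub_distrib]
  refine (abs_sum_le_sum_abs _ _).trans ?_
  calc _ ≤ ∑ _j : Fin M, ξ := sum_le_sum fun j _ =>
        hW' (labelsOf u, i, j) W₀ W ((le_sup (mem_univ _)).trans hW) hW₀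
    _ = M * ξ := by simp

/-- With uninformative low effort, the two strategic choices act on the data through the single
number `e * (2 * r - 1)` in `[-1, 1]`. -/
theorem pobc_half (pH r e : ℝ) : pobc pH (1 / 2) r e = 1 / 2 + e * (2 * r - 1) * (pH - 1 / 2) := by
  unfold pobc
  ring

theorem expectedUtility_eq (M : ℕ) (π : Prior) (W₀ W : ℕ) (τ : ℝ) (pH c : Fin N → ℝ) (a b : ℝ)
    (rpt eft : Fin N → ℝ) (i : Fin N) :
    expectedUtility (M := M) π W₀ W τ pH c a b rpt eft i =
      a * ∑ u : Option (Fin N) → Fin M → Bool, prob (fun o : Option (Fin N) =>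
          o.elim τ fun k => pobc (pH k) (1 / 2) (rpt k) (eft k)) u *
        (∑ j, expectedScore π W₀ W (labelsOf u) i j) + M * (b - a / 2) - M * c i * eft i := by
  unfold expectedUtility
  rw [← Fintype.sum_prod_type', ← Equiv.sum_comp labelsEquiv]
  congr 1
  simp only [labelsEquiv, Equiv.coe_fn_mk, dataProb_labelsOf]
  have h1 : ∀ u : Option (Fin N) → Fin M → Bool,
      ∑ j, (a * (expectedScore π W₀ W (labelsOf u) i j - 1 / 2) + b) =
        a * (∑ j, expectedScore π W₀ W (labelsOf u) i j) + M * (b - a / 2) := by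
    intro u
    rw [mul_sum, sum_add_distrib, sum_const, card_univ, Fintype.card_fin, nsmul_eq_mul]
    simp only [mul_sub, sum_sub_distrib, sum_const, card_univ, Fintype.card_fin, nsmul_eq_mul]
    ring
  simp only [h1, mul_add, sum_add_distrib, ← sum_mul, sum_prob, one_mul]
  congr 1
  rw [mul_sum]
  exact sum_congr rfl fun u _ => by ring

end Reduction

/-! ### From marginal gains to a strict incentive -/

/-- One-step incentive compatibility, from a lower bound on the marginal effect of a single
correct label on the posterior mean agreement. -/
theorem incentive_of_meanAgr (π : Prior) {η : ℝ} (hη : 0 < η)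
    (core : ∀ δ : ℝ, 0 < δ → ∃ M₀ : ℕ, ∀ M : ℕ, M₀ ≤ M → ∀ (N : ℕ) (p : Option (Fin N) → ℝ)
      (i : Fin N), (∀ k, η ≤ p k ∧ p k ≤ 1 - η) → (∀ k, k ≠ i → 1 / 2 + η ≤ p (some k)) →
      M ≤ 4 ^ N → ∀ j : Fin M, 1 - δ ≤ ∑ u, prob p u *
        (meanAgr (π.cc N) (π.ww N) (setAt u (some i) j true) (some i) -
          meanAgr (π.cc N) (π.ww N) (setAt u (some i) j false) (some i))) :
    ∃ M₀ : ℕ, ∀ M : ℕ, M₀ ≤ M → ∀ N : ℕ, ∃ W' : ℕ, ∀ W₀ W : ℕ, W' ≤ W → W₀ < W →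
      ∀ (τ : ℝ) (pH c : Fin N → ℝ) (a b : ℝ),
        η ≤ τ → τ ≤ 1 - η →
        (∀ i, 1 / 2 + η ≤ pH i ∧ pH i ≤ 1 - η) →
        (∀ i, 0 < c i) →
        0 ≤ b →
        (M : ℝ) ≤ ∏ i, (2 * pH i) ^ 2 →
        (∀ i, (1 + η) * (c i / (pH i - 1 / 2)) ≤ a) →
        ∀ (i : Fin N) (r e : ℝ), r ∈ Set.Icc (0 : ℝ) 1 → e ∈ Set.Icc (0 : ℝ) 1 →
          (r, e) ≠ (1, 1) →
          expectedUtility (M := M) π W₀ W τ pH c a b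
              (Function.update (fun _ => 1) i r) (Function.update (fun _ => 1) i e) i <
            expectedUtility (M := M) π W₀ W τ pH c a b (fun _ => 1) (fun _ => 1) i := by
  -- One `θ` pays for the estimate `core` and one for the sampler. This uses half of the slack,
  -- since `(1 - 2θ)(1 + η) = 1 + η / 2`.
  set θ : ℝ := η / (4 * (1 + η))
  have hθ : 0 < θ := by positivity
  have hθ1 : 1 < (1 - 2 * θ) * (1 + η) := by
    have : θ * (1 + η) = η / 4 := by simp only [θ]; field_simp
    nlinarith
  obtain ⟨M₀, hM₀⟩ := core θ hθ
  refine ⟨max M₀ 1, fun M hM N => ?_⟩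
  have hM1 : 1 ≤ M := (le_max_right _ _).trans hM
  have hMpos : (0 : ℝ) < M := by exact_mod_cast hM1
  -- Summed over `M` tasks the sampler error is `θ / 2`, and a difference of two total scores incurs
  -- it twice.
  obtain ⟨W', hW'⟩ := exists_abs_sum_expectedScore_sub_le π M N (ξ := θ / (2 * M)) (by positivity)
  refine ⟨W', fun W₀ W hW hW₀ τ pH c a b hτ0 hτ1 hpH hc hb hprod ha i r e hr he hre => ?_⟩
  have happ := hW' W₀ W hW hW₀
  have hξ : M * (θ / (2 * M)) = θ / 2 := by field_simp
  rw [hξ] at happ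
  have hMN : M ≤ 4 ^ N := by
    have : ∏ i, (2 * pH i) ^ 2 ≤ ∏ _i : Fin N, (4 : ℝ) :=
      prod_le_prod (fun _ _ => by positivity) fun k _ => by
        have := hpH k
        nlinarith
    simp only [prod_const, card_univ, Fintype.card_fin] at this
    exact_mod_cast hprod.trans this
  set P : Option (Fin N) → ℝ := fun o => o.elim τ pH
  set g : (Option (Fin N) → Fin M → Bool) → ℝ :=
    fun u => ∑ j, expectedScore π W₀ W (labelsOf u) i j
  set Φ : ℝ → ℝ := fun q => ∑ u, prob (Function.update P (some i) q) u * g u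
  have hU : ∀ r e : ℝ, expectedUtility (M := M) π W₀ W τ pH c a b
      (Function.update (fun _ => 1) i r) (Function.update (fun _ => 1) i e) i =
      a * Φ (1 / 2 + e * (2 * r - 1) * (pH i - 1 / 2)) + M * (b - a / 2) - M * c i * e := by
    intro r e
    rw [expectedUtility_eq]
    simp only [Function.update_self]
    have h : (fun o : Option (Fin N) => o.elim τ fun k => pobc (pH k) (1 / 2)
        (Function.update (fun _ => (1 : ℝ)) i r k) (Function.update (fun _ => (1 : ℝ)) i e k)) =
        Function.update P (some i) (1 / 2 + e * (2 * r - 1) * (pH i - 1 / 2)) := by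
      funext o
      rcases o with _ | k
      · simp [P]
      · by_cases hk : k = i
        · subst hk
          simp only [Option.elim, Function.update_self, pobc_half]
        · have hk' : (some k : Option (Fin N)) ≠ some i := by simpa using hk
          simp only [Option.elim, Function.update_of_ne hk, Function.update_of_ne hk', pobc_half, P]
          ring
    rw [h]
  have hU1 := hU 1 1
  rw [show Function.update (fun _ : Fin N => (1 : ℝ)) i 1 = fun _ => 1 from
    Function.update_eq_self i _] at hU1
  rw [hU1, hU]
  have hpi := hpH i
  have hci := hc i
  have hd : 0 < pH i - 1 / 2 := by linarith
  have hai := ha i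
  have ha0 : 0 < a := lt_of_lt_of_le (by positivity) hai
  obtain ⟨hr0, hr1⟩ := hr
  obtain ⟨he0, he1⟩ := he
  have hlt : e * (2 * r - 1) < 1 := by
    rcases eq_or_lt_of_le he1 with h | h
    · subst h
      rcases eq_or_lt_of_le hr1 with h' | h'
      · subst h'; exact absurd rfl hre
      · linarith
    · nlinarith
  have hge : -1 ≤ e * (2 * r - 1) := by nlinarith
  have hle : e * (2 * r - 1) ≤ e := by nlinarith
  set q := 1 / 2 + e * (2 * r - 1) * (pH i - 1 / 2) with hq
  have hq0 : 1 - pH i ≤ q := by nlinarith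
  have hq1 : q ≤ pH i := by nlinarith
  -- The mean value inequality on `[q, pH i]`, which lies in `[η, 1 - η]` because `1 - pH i ≤ q`.
  -- The accuracy of `i` may fall below `1/2` there, which is why `core` asks informativeness only
  -- of the other workers.
  have hslope : M * (1 - 2 * θ) * (pH i - q) ≤ Φ (pH i) - Φ q := by
    refine Convex.mul_sub_le_image_sub_of_le_deriv (convex_Icc q (pH i))
      (fun x _ => (hasDerivAt_sum_prob P (some i) g x).continuousAt.continuousWithinAt)
      (fun x _ => (hasDerivAt_sum_prob P (some i) g x).differentiableAt.differentiableWithinAt)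
      (fun x hx => ?_) _ ⟨le_refl _, hq1⟩ _ ⟨hq1, le_refl _⟩ hq1
    rw [interior_Icc] at hx
    rw [(hasDerivAt_sum_prob P (some i) g x).deriv]
    have hP : ∀ k, η ≤ Function.update P (some i) x k ∧ Function.update P (some i) x k ≤ 1 - η := by
      intro k
      by_cases hk : k = some i
      · subst hk
        rw [Function.update_self]
        constructor <;> linarith [hx.1, hx.2]
      · rw [Function.update_of_ne hk]
        rcases k with _ | k
        · exact ⟨hτ0, hτ1⟩
        · exact ⟨by simp only [P, Option.elim]; linarith [(hpH k).1], (hpH k).2⟩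
    have hone : ∀ j : Fin M, 1 - 2 * θ ≤ ∑ u, prob (Function.update P (some i) x) u *
        (g (setAt u (some i) j true) - g (setAt u (some i) j false)) := by
      intro j
      have h1 := hM₀ M ((le_max_left _ _).trans hM) N (Function.update P (some i) x) i hP
        (fun k hk => by
          rw [Function.update_of_ne (by simpa using hk)]
          exact (hpH k).1) hMN j
      have h2 : ∑ u, prob (Function.update P (some i) x) u *
          (meanAgr (π.cc N) (π.ww N) (setAt u (some i) j true) (some i) -
          meanAgr (π.cc N) (π.ww N) (setAt u (some i) j false) (some i)) ≤
          ∑ u, prob (Function.update P (some i) x) u *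
          (g (setAt u (some i) j true) - g (setAt u (some i) j false) + θ) := by
        refine sum_le_sum fun u _ => mul_le_mul_of_nonneg_left ?_
          (prob_nonneg (fun k => hη.le.trans (hP k).1) (fun k => by linarith [(hP k).2]) u)
        have e1 := abs_le.1 (happ (setAt u (some i) j true) i)
        have e2 := abs_le.1 (happ (setAt u (some i) j false) i)
        simp only [g]
        linarith [e1.1, e1.2, e2.1, e2.2]
      simp only [mul_add, sum_add_distrib, ← sum_mul, sum_prob] at h2
      linarith
    have hcard : (M : ℝ) * (1 - 2 * θ) = ∑ _j : Fin M, (1 - 2 * θ) := by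
      rw [sum_const, card_univ, Fintype.card_fin, nsmul_eq_mul]
    rw [hcard]
    exact sum_le_sum fun j _ => hone j
  have hΦ : Φ (1 / 2 + 1 * (2 * 1 - 1) * (pH i - 1 / 2)) = Φ (pH i) := by congr 1; ring
  rw [hΦ]
  have hac : (1 + η) * c i ≤ a * (pH i - 1 / 2) := by
    have : (1 + η) * (c i / (pH i - 1 / 2)) * (pH i - 1 / 2) = (1 + η) * c i := by
      rw [mul_assoc, div_mul_cancel₀ _ hd.ne']
    rw [← this]
    exact mul_le_mul_of_nonneg_right hai hd.le
  have hpq : pH i - q = (pH i - 1 / 2) * (1 - e * (2 * r - 1)) := by rw [hq]; ring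
  have hx : 0 < 1 - e * (2 * r - 1) := by linarith
  have hθ2 : 0 < 1 - 2 * θ := by
    by_contra h
    nlinarith
  have k1 : a * (M * (1 - 2 * θ) * (pH i - q)) ≤ a * (Φ (pH i) - Φ q) :=
    mul_le_mul_of_nonneg_left hslope ha0.le
  have k2 : M * (1 - 2 * θ) * (1 - e * (2 * r - 1)) * ((1 + η) * c i) ≤
      a * (M * (1 - 2 * θ) * (pH i - q)) := by
    rw [hpq]
    calc _ ≤ M * (1 - 2 * θ) * (1 - e * (2 * r - 1)) * (a * (pH i - 1 / 2)) :=
          mul_le_mul_of_nonneg_left hac (by positivity)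
      _ = _ := by ring
  have k3 : M * c i * (1 - e * (2 * r - 1)) <
      M * (1 - 2 * θ) * (1 - e * (2 * r - 1)) * ((1 + η) * c i) := by
    have : 0 < M * c i * (1 - e * (2 * r - 1)) := by positivity
    calc _ = M * c i * (1 - e * (2 * r - 1)) * 1 := by ring
      _ < M * c i * (1 - e * (2 * r - 1)) * ((1 - 2 * θ) * (1 + η)) :=
          mul_lt_mul_of_pos_left hθ1 this
      _ = _ := by ring
  -- The effort saved is at most the accuracy lost, measured in units of `pH i - 1/2`.
  have k4 : M * c i * (1 - e) ≤ M * c i * (1 - e * (2 * r - 1)) :=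
    mul_le_mul_of_nonneg_left (by linarith) (by positivity)
  linarith


/-! ### Agreements and errors, one task at a time -/

section Agreement

variable {M : ℕ}

/-- The number of agreements on the tasks other than `j`. -/
def agrOff (j : Fin M) (u z : Fin M → Bool) : ℕ := #{l | l ≠ j ∧ u l ≠ z l}

theorem agr_eq (j : Fin M) (u z : Fin M → Bool) :
    agr u z = agrOff j u z + if u j ≠ z j then 1 else 0 := by
  unfold agr agrOff
  rw [← card_filter_add_card_filter_not (s := univ.filter fun l => u l ≠ z l) (fun l => l ≠ j)]
  congr 1
  · congr 1
    ext l
    simp [and_comm]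
  · split_ifs with h
    · rw [card_eq_one]
      refine ⟨j, ?_⟩
      ext l
      simp only [mem_filter, mem_univ, true_and, not_not, mem_singleton]
      constructor
      · exact fun h => h.2
      · rintro rfl; exact ⟨h, rfl⟩
    · rw [card_eq_zero]
      ext l
      simp only [mem_filter, mem_univ, true_and, not_not, notMem_empty, iff_false]
      rintro ⟨h1, rfl⟩
      exact h h1

theorem agrOff_update_right (j : Fin M) (u z : Fin M → Bool) (b : Bool) :
    agrOff j u (Function.update z j b) = agrOff j u z := by
  unfold agrOff
  congr 1
  ext l
  simp only [mem_filter, mem_univ, true_and]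
  refine and_congr_right fun h => ?_
  rw [Function.update_of_ne h]

theorem agrOff_update_left (j : Fin M) (u z : Fin M → Bool) (b : Bool) :
    agrOff j (Function.update u j b) z = agrOff j u z := by
  unfold agrOff
  congr 1
  ext l
  simp only [mem_filter, mem_univ, true_and]
  refine and_congr_right fun h => ?_
  rw [Function.update_of_ne h]

theorem agr_update_right (j : Fin M) (u z : Fin M → Bool) (b : Bool) :
    agr u (Function.update z j b) = agrOff j u z + if u j ≠ b then 1 else 0 := by
  rw [agr_eq j, agrOff_update_right, Function.update_self]

theorem agrOff_le_agr (j : Fin M) (u z : Fin M → Bool) : agrOff j u z ≤ agr u z := by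
  rw [agr_eq j]; omega

theorem agr_le_agrOff (j : Fin M) (u z : Fin M → Bool) : agr u z ≤ agrOff j u z + 1 := by
  rw [agr_eq j]; split_ifs <;> omega

/-- The loss of one incurred by removing a task is the reason for the `+ 1` per source in `agrDist`.
-/
theorem abs_agrOff_sub_le (j : Fin M) (u z₁ z₂ : Fin M → Bool) :
    |(agrOff j u z₁ : ℝ) - agrOff j u z₂| ≤ |(agr u z₁ : ℝ) - agr u z₂| + 1 := by
  have h1 : (agrOff j u z₁ : ℝ) ≤ agr u z₁ := by exact_mod_cast agrOff_le_agr j u z₁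
  have h2 : (agrOff j u z₂ : ℝ) ≤ agr u z₂ := by exact_mod_cast agrOff_le_agr j u z₂
  have h3 : (agr u z₁ : ℝ) ≤ agrOff j u z₁ + 1 := by exact_mod_cast agr_le_agrOff j u z₁
  have h4 : (agr u z₂ : ℝ) ≤ agrOff j u z₂ + 1 := by exact_mod_cast agr_le_agrOff j u z₂
  have h5 := le_abs_self ((agr u z₁ : ℝ) - agr u z₂)
  have h6 := neg_abs_le ((agr u z₁ : ℝ) - agr u z₂)
  rw [abs_le]
  constructor <;> linarith

/-- The indicator of an error. -/
def ind (v : Bool) : ℝ := if v then 1 else 0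

/-- The sign of a label. -/
def sgn (v : Bool) : ℝ := if v then 1 else -1

/-- An error loses one agreement on a correctly labelled task and gains one on a wrongly labelled
task. Fluctuations of agreements are therefore those of a signed sum of error indicators. -/
theorem agr_eq_sub_sum (u z : Fin M → Bool) :
    (agr u z : ℝ) = agr u (fun _ => false) - ∑ j, sgn (u j) * ind (z j) := by
  unfold agr
  rw [card_filter, card_filter]
  push_cast
  rw [← sum_sub_distrib]
  refine sum_congr rfl fun j _ => ?_
  cases u j <;> cases z j <;> simp [sgn, ind]

end Agreement

/-! ### Weakly dependent error vectors -/

section MeanField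

variable {M : ℕ} {ι : Type*} [Fintype ι]

/-- A distance between error vectors, measured through the agreements with the sources. -/
def agrDist (u : ι → Fin M → Bool) (z₁ z₂ : Fin M → Bool) : ℝ :=
  ∑ k, (|(agr (u k) z₁ : ℝ) - agr (u k) z₂| + 1)

/-- Expectation with respect to the weights `μ`. -/
def Ex (μ F : (Fin M → Bool) → ℝ) : ℝ := ∑ z, μ z * F z

/-- The expected square of the distance of two independent error vectors. -/
def meanSqDist (u : ι → Fin M → Bool) (μ : (Fin M → Bool) → ℝ) : ℝ :=
  ∑ z₁, ∑ z₂, μ z₁ * μ z₂ * agrDist u z₁ z₂ ^ 2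

/-- The conditional probability of an error on task `j`, given the other tasks. -/
noncomputable def condErr (μ : (Fin M → Bool) → ℝ) (j : Fin M) (z : Fin M → Bool) : ℝ :=
  μ (Function.update z j true) /
    (μ (Function.update z j false) + μ (Function.update z j true))

theorem agrDist_nonneg (u : ι → Fin M → Bool) (z₁ z₂ : Fin M → Bool) : 0 ≤ agrDist u z₁ z₂ :=
  sum_nonneg fun _ _ => by positivity

theorem abs_agr_sub_le_agrDist (u : ι → Fin M → Bool) (k : ι) (z₁ z₂ : Fin M → Bool) :
    |(agr (u k) z₁ : ℝ) - agr (u k) z₂| + 1 ≤ agrDist u z₁ z₂ :=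
  single_le_sum (f := fun k => |(agr (u k) z₁ : ℝ) - agr (u k) z₂| + 1)
    (fun _ _ => by positivity) (mem_univ k)

theorem agrDist_update_le (u : ι → Fin M → Bool) (j : Fin M) (z : Fin M → Bool) (b : Bool) :
    agrDist u (Function.update z j b) z ≤ 2 * Fintype.card ι := by
  calc agrDist u (Function.update z j b) z ≤ ∑ _k : ι, (2 : ℝ) := by
        refine sum_le_sum fun k _ => ?_
        rw [agr_update_right, agr_eq j (u k) z]
        push_cast
        split_ifs <;> norm_num
    _ = 2 * Fintype.card ι := by simp [mul_comm]

theorem Ex_add (μ F G : (Fin M → Bool) → ℝ) : Ex μ (fun z => F z + G z) = Ex μ F + Ex μ G := by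
  simp only [Ex, mul_add, sum_add_distrib]

theorem Ex_sub (μ F G : (Fin M → Bool) → ℝ) : Ex μ (fun z => F z - G z) = Ex μ F - Ex μ G := by
  simp only [Ex, mul_sub, sum_sub_distrib]

theorem Ex_const_mul (μ F : (Fin M → Bool) → ℝ) (c : ℝ) :
    Ex μ (fun z => c * F z) = c * Ex μ F := by
  simp only [Ex, mul_sum]
  exact sum_congr rfl fun z _ => by ring

theorem Ex_const {μ : (Fin M → Bool) → ℝ} (h : ∑ z, μ z = 1) (c : ℝ) : Ex μ (fun _ => c) = c := by
  simp only [Ex, ← sum_mul, h, one_mul]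

theorem Ex_sum {α : Type*} (s : Finset α) (μ : (Fin M → Bool) → ℝ)
    (F : α → (Fin M → Bool) → ℝ) : Ex μ (fun z => ∑ a ∈ s, F a z) = ∑ a ∈ s, Ex μ (F a) := by
  simp only [Ex, mul_sum]
  exact sum_comm

theorem Ex_mono {μ F G : (Fin M → Bool) → ℝ} (hμ : ∀ z, 0 ≤ μ z) (h : ∀ z, F z ≤ G z) :
    Ex μ F ≤ Ex μ G :=
  sum_le_sum fun z _ => mul_le_mul_of_nonneg_left (h z) (hμ z)

theorem abs_Ex_le {μ : (Fin M → Bool) → ℝ} (hμ : ∀ z, 0 ≤ μ z) (F : (Fin M → Bool) → ℝ) :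
    |Ex μ F| ≤ Ex μ fun z => |F z| := by
  refine (abs_sum_le_sum_abs _ _).trans (sum_le_sum fun z _ => ?_)
  rw [abs_mul, abs_of_nonneg (hμ z)]

/-- Twice the covariance is the mean, over two independent copies, of the product of the increments
of `Φ` and `Ψ`. -/
theorem abs_Ex_mul_sub_le {u : ι → Fin M → Bool} {μ : (Fin M → Bool) → ℝ} (hμ : ∀ z, 0 ≤ μ z)
    (h1 : ∑ z, μ z = 1) {Φ Ψ : (Fin M → Bool) → ℝ} {a b : ℝ}
    (hΦ : ∀ z₁ z₂, |Φ z₁ - Φ z₂| ≤ a * agrDist u z₁ z₂)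
    (hΨ : ∀ z₁ z₂, |Ψ z₁ - Ψ z₂| ≤ b * agrDist u z₁ z₂) :
    |Ex μ (fun z => Φ z * Ψ z) - Ex μ Φ * Ex μ Ψ| ≤ a * b * meanSqDist u μ / 2 := by
  have key : ∑ z₁, ∑ z₂, μ z₁ * μ z₂ * ((Φ z₁ - Φ z₂) * (Ψ z₁ - Ψ z₂)) =
      2 * (Ex μ (fun z => Φ z * Ψ z) - Ex μ Φ * Ex μ Ψ) := by
    have e : ∀ z₁ z₂, μ z₁ * μ z₂ * ((Φ z₁ - Φ z₂) * (Ψ z₁ - Ψ z₂)) =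
        (μ z₁ * (Φ z₁ * Ψ z₁)) * μ z₂ - (μ z₁ * Φ z₁) * (μ z₂ * Ψ z₂)
          - (μ z₁ * Ψ z₁) * (μ z₂ * Φ z₂) + μ z₁ * (μ z₂ * (Φ z₂ * Ψ z₂)) := by
      intros; ring
    simp only [e, sum_add_distrib, sum_sub_distrib, ← mul_sum, ← sum_mul, h1]
    simp only [Ex]
    ring
  have h2 : |∑ z₁, ∑ z₂, μ z₁ * μ z₂ * ((Φ z₁ - Φ z₂) * (Ψ z₁ - Ψ z₂))| ≤
      a * b * meanSqDist u μ := by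
    unfold meanSqDist
    rw [mul_sum]
    refine (abs_sum_le_sum_abs _ _).trans (sum_le_sum fun z₁ _ => ?_)
    rw [mul_sum]
    refine (abs_sum_le_sum_abs _ _).trans (sum_le_sum fun z₂ _ => ?_)
    rw [abs_mul, abs_of_nonneg (mul_nonneg (hμ _) (hμ _)), abs_mul]
    have := mul_le_mul (hΦ z₁ z₂) (hΨ z₁ z₂) (abs_nonneg _) ((abs_nonneg _).trans (hΦ z₁ z₂))
    calc _ ≤ μ z₁ * μ z₂ * (a * agrDist u z₁ z₂ * (b * agrDist u z₁ z₂)) :=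
          mul_le_mul_of_nonneg_left this (mul_nonneg (hμ _) (hμ _))
      _ = _ := by ring
  rw [key, abs_mul, abs_of_pos (by norm_num : (0 : ℝ) < 2)] at h2
  linarith

/-- Weights on error vectors whose log-odds at each task are Lipschitz, and whose conditional error
probabilities are bounded. -/
structure IsMeanField (u : ι → Fin M → Bool) (μ : (Fin M → Bool) → ℝ) (κ : ℝ)
    (qb : Fin M → ℝ) : Prop where
  pos : ∀ z, 0 < μ z
  sum_eq : ∑ z, μ z = 1
  lip_nonneg : 0 ≤ κ
  lip : ∀ j z₁ z₂, μ (Function.update z₁ j true) * μ (Function.update z₂ j false) ≤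
    Real.exp (κ * agrDist u z₁ z₂) *
      (μ (Function.update z₁ j false) * μ (Function.update z₂ j true))
  cond : ∀ j z, condErr μ j z ≤ qb j

namespace IsMeanField

variable {u : ι → Fin M → Bool} {μ : (Fin M → Bool) → ℝ} {κ : ℝ} {qb : Fin M → ℝ}

theorem condErr_nonneg (h : IsMeanField u μ κ qb) (j : Fin M) (z : Fin M → Bool) :
    0 ≤ condErr μ j z :=
  div_nonneg (h.pos _).le (add_pos (h.pos _) (h.pos _)).le

theorem condErr_le_one (h : IsMeanField u μ κ qb) (j : Fin M) (z : Fin M → Bool) :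
    condErr μ j z ≤ 1 := by
  unfold condErr
  rw [div_le_one (add_pos (h.pos _) (h.pos _))]
  linarith [h.pos (Function.update z j false)]

theorem bound_nonneg (h : IsMeanField u μ κ qb) (j : Fin M) : 0 ≤ qb j :=
  (h.condErr_nonneg j fun _ => false).trans (h.cond j _)

/-- Lipschitz log-odds control probabilities multiplicatively, so the bound carries the factor `qb
j`. Summed over tasks this gives `κ * ∑ qb` in place of `κ * M`. -/
theorem condErr_sub_le (h : IsMeanField u μ κ qb) (j : Fin M) (z₁ z₂ : Fin M → Bool) :
    condErr μ j z₁ - condErr μ j z₂ ≤ qb j * (κ * agrDist u z₁ z₂) := by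
  set x := κ * agrDist u z₁ z₂ with hx
  have hx0 : 0 ≤ x := mul_nonneg h.lip_nonneg (agrDist_nonneg _ _ _)
  have hl := h.lip j z₁ z₂
  rw [← hx] at hl
  have hc := h.cond j z₁
  unfold condErr at hc ⊢
  have a1 := h.pos (Function.update z₁ j true)
  have a0 := h.pos (Function.update z₁ j false)
  have b1 := h.pos (Function.update z₂ j true)
  have b0 := h.pos (Function.update z₂ j false)
  set A1 := μ (Function.update z₁ j true)
  set A0 := μ (Function.update z₁ j false)
  set B1 := μ (Function.update z₂ j true)
  set B0 := μ (Function.update z₂ j false)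
  have h1 : Real.exp (-x) * (A1 / (A0 + A1)) ≤ B1 / (B0 + B1) := by
    rw [Real.exp_neg, ← div_eq_inv_mul, div_div, div_le_div_iff₀ (by positivity) (by positivity)]
    have : A1 * B1 ≤ Real.exp x * (A1 * B1) :=
      le_mul_of_one_le_left (by positivity) (Real.one_le_exp hx0)
    nlinarith
  have h2 : 1 - x ≤ Real.exp (-x) := by linarith [Real.add_one_le_exp (-x)]
  have hq0 : 0 ≤ A1 / (A0 + A1) := by positivity
  have h3 := mul_le_mul_of_nonneg_right h2 hq0
  have h4 := mul_le_mul_of_nonneg_right hc hx0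
  linarith

theorem agrDist_comm (u : ι → Fin M → Bool) (z₁ z₂ : Fin M → Bool) :
    agrDist u z₁ z₂ = agrDist u z₂ z₁ := by
  unfold agrDist
  exact sum_congr rfl fun k _ => by rw [abs_sub_comm]

theorem abs_condErr_sub_le (h : IsMeanField u μ κ qb) (j : Fin M) (z₁ z₂ : Fin M → Bool) :
    |condErr μ j z₁ - condErr μ j z₂| ≤ qb j * κ * agrDist u z₁ z₂ := by
  rw [abs_le]
  have h1 := h.condErr_sub_le j z₁ z₂
  have h2 := h.condErr_sub_le j z₂ z₁
  rw [agrDist_comm u z₂ z₁] at h2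
  constructor <;> linarith

theorem condErr_update (μ : (Fin M → Bool) → ℝ) (j : Fin M) (z : Fin M → Bool) (b : Bool) :
    condErr μ j (Function.update z j b) = condErr μ j z := by
  simp [condErr]

/-- The tower property: `condErr μ j` is the conditional expectation of the error indicator given
the other tasks. -/
theorem Ex_ind_mul (h : IsMeanField u μ κ qb) (j : Fin M) {Φ : (Fin M → Bool) → ℝ}
    (hΦ : ∀ z b, Φ (Function.update z j b) = Φ z) :
    Ex μ (fun z => ind (z j) * Φ z) = Ex μ (fun z => condErr μ j z * Φ z) := by
  unfold Ex
  rw [sum_eq_half_sum_update j, sum_eq_half_sum_update j fun z => μ z * (condErr μ j z * Φ z)]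
  congr 1
  refine sum_congr rfl fun z _ => ?_
  simp only [hΦ, condErr_update, Function.update_self, ind, Bool.false_eq_true, if_false, if_true]
  unfold condErr
  have := (add_pos (h.pos (Function.update z j false)) (h.pos (Function.update z j true))).ne'
  field_simp
  ring

theorem Ex_sub_mul (h : IsMeanField u μ κ qb) (j : Fin M) {Φ : (Fin M → Bool) → ℝ}
    (hΦ : ∀ z b, Φ (Function.update z j b) = Φ z) :
    Ex μ (fun z => (ind (z j) - condErr μ j z) * Φ z) = 0 := by
  simp only [sub_mul]
  rw [Ex_sub, h.Ex_ind_mul j hΦ, sub_self]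

theorem Ex_condErr_le (h : IsMeanField u μ κ qb) (j : Fin M) : Ex μ (condErr μ j) ≤ qb j :=
  (Ex_mono (fun z => (h.pos z).le) (h.cond j)).trans_eq (Ex_const h.sum_eq _)

theorem Ex_ind_le (h : IsMeanField u μ κ qb) (j : Fin M) : Ex μ (fun z => ind (z j)) ≤ qb j := by
  have := h.Ex_ind_mul j (Φ := fun _ => 1) (fun _ _ => rfl)
  simp only [mul_one] at this
  rw [this]
  exact h.Ex_condErr_le j

theorem ind_nonneg (v : Bool) : 0 ≤ ind v := by unfold ind; split_ifs <;> norm_num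

theorem ind_le_one (v : Bool) : ind v ≤ 1 := by unfold ind; split_ifs <;> norm_num

theorem Ex_abs_le (h : IsMeanField u μ κ qb) (j : Fin M) :
    Ex μ (fun z => |ind (z j) - condErr μ j z|) ≤ 2 * qb j := by
  have h1 : Ex μ (fun z => |ind (z j) - condErr μ j z|) ≤
      Ex μ (fun z => ind (z j) + condErr μ j z) := by
    refine Ex_mono (fun z => (h.pos z).le) fun z => ?_
    rw [abs_le]
    constructor <;> linarith [ind_nonneg (z j), h.condErr_nonneg j z]
  rw [Ex_add] at h1
  linarith [h.Ex_ind_le j, h.Ex_condErr_le j]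

theorem abs_sub_le_one (h : IsMeanField u μ κ qb) (j : Fin M) (z : Fin M → Bool) :
    |ind (z j) - condErr μ j z| ≤ 1 := by
  rw [abs_le]
  constructor <;> linarith [ind_nonneg (z j), ind_le_one (z j), h.condErr_nonneg j z,
    h.condErr_le_one j z]

/-- For distinct tasks, a centred indicator at `j` is orthogonal to everything that ignores `z j`.
The indicator at `l`, centred at its conditional mean with `z j` reset, is such a function. Only the
influence of `z j` on `condErr μ l` remains, and it is at most `qb l * κ` times twice the number of
sources. -/
theorem abs_Ex_sub_mul_sub_le (h : IsMeanField u μ κ qb) (j l : Fin M) :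
    |Ex μ (fun z => (ind (z j) - condErr μ j z) * (ind (z l) - condErr μ l z))| ≤
      (if j = l then 2 * qb j else 0) + 4 * Fintype.card ι * κ * (qb j * qb l) := by
  have hκ := h.lip_nonneg
  have hj := h.bound_nonneg j
  have hl := h.bound_nonneg l
  have hμ := fun z => (h.pos z).le
  split_ifs with hjl
  · subst hjl
    refine (abs_Ex_le hμ _).trans ?_
    have : Ex μ (fun z => |(ind (z j) - condErr μ j z) * (ind (z j) - condErr μ j z)|) ≤
        Ex μ (fun z => |ind (z j) - condErr μ j z|) := by
      refine Ex_mono hμ fun z => ?_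
      rw [abs_mul]
      exact mul_le_of_le_one_right (abs_nonneg _) (h.abs_sub_le_one j z)
    have := h.Ex_abs_le j
    have : 0 ≤ 4 * Fintype.card ι * κ * (qb j * qb j) := by positivity
    linarith
  · have hsplit : Ex μ (fun z => (ind (z j) - condErr μ j z) * (ind (z l) - condErr μ l z)) =
        Ex μ (fun z => (ind (z j) - condErr μ j z) *
          (condErr μ l (Function.update z j false) - condErr μ l z)) := by
      have h0 := h.Ex_sub_mul j
        (Φ := fun z => ind (z l) - condErr μ l (Function.update z j false)) (fun z b => by
          simp [Function.update_of_ne (Ne.symm hjl)])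
      rw [← sub_zero (Ex μ fun z => (ind (z j) - condErr μ j z) * (ind (z l) - condErr μ l z)),
        ← h0, ← Ex_sub]
      congr 1
      funext z
      ring
    rw [hsplit]
    refine (abs_Ex_le hμ _).trans ?_
    have h1 : Ex μ (fun z => |(ind (z j) - condErr μ j z) *
        (condErr μ l (Function.update z j false) - condErr μ l z)|) ≤
        Ex μ (fun z => (qb l * κ * (2 * Fintype.card ι)) * |ind (z j) - condErr μ j z|) := by
      refine Ex_mono hμ fun z => ?_
      rw [abs_mul, mul_comm]
      refine mul_le_mul_of_nonneg_right ?_ (abs_nonneg _)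
      exact (h.abs_condErr_sub_le l _ _).trans
        (mul_le_mul_of_nonneg_left (agrDist_update_le u j z false) (by positivity))
    rw [Ex_const_mul] at h1
    have h2 := mul_le_mul_of_nonneg_left (h.Ex_abs_le j)
      (by positivity : 0 ≤ qb l * κ * (2 * Fintype.card ι))
    linarith

theorem Ex_sq_sum_le (h : IsMeanField u μ κ qb) {σ : Fin M → ℝ} (hσ : ∀ j, |σ j| ≤ 1) :
    Ex μ (fun z => (∑ j, σ j * (ind (z j) - condErr μ j z)) ^ 2) ≤
      2 * (∑ j, qb j) + 4 * Fintype.card ι * κ * (∑ j, qb j) ^ 2 := by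
  have e : ∀ z : Fin M → Bool, (∑ j, σ j * (ind (z j) - condErr μ j z)) ^ 2 =
      ∑ j, ∑ l, σ j * σ l * ((ind (z j) - condErr μ j z) * (ind (z l) - condErr μ l z)) := by
    intro z
    rw [sq, sum_mul_sum]
    exact sum_congr rfl fun j _ => sum_congr rfl fun l _ => by ring
  simp only [e, Ex_sum, Ex_const_mul]
  calc _ ≤ ∑ j, ∑ l, ((if j = l then 2 * qb j else 0) +
        4 * Fintype.card ι * κ * (qb j * qb l)) := by
        refine sum_le_sum fun j _ => sum_le_sum fun l _ => ?_
        refine le_trans ?_ (h.abs_Ex_sub_mul_sub_le j l)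
        refine (le_abs_self _).trans ?_
        rw [abs_mul, abs_mul]
        exact mul_le_of_le_one_left (abs_nonneg _)
          (mul_le_one₀ (hσ j) (abs_nonneg _) (hσ l))
    _ = _ := by
        simp only [sum_add_distrib, sum_ite_eq, mem_univ, if_true, ← mul_sum, sq, sum_mul_sum]

theorem abs_sgn (v : Bool) : |sgn v| ≤ 1 := by unfold sgn; split_ifs <;> norm_num

/-- The difference of agreements splits into centred indicators, handled by the variance bound, and
a difference of conditional means. The latter is Lipschitz in `agrDist`, so `meanSqDist` reappears
on the right. -/
theorem sum_sq_agr_sub_le (h : IsMeanField u μ κ qb) (k : ι) :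
    ∑ z₁, ∑ z₂, μ z₁ * μ z₂ * ((agr (u k) z₁ : ℝ) - agr (u k) z₂) ^ 2 ≤
      8 * (2 * (∑ j, qb j) + 4 * Fintype.card ι * κ * (∑ j, qb j) ^ 2) +
        2 * (κ * ∑ j, qb j) ^ 2 * meanSqDist u μ := by
  set A : (Fin M → Bool) → ℝ := fun z => ∑ j, sgn (u k j) * (ind (z j) - condErr μ j z)
  have hA := h.Ex_sq_sum_le (σ := fun j => sgn (u k j)) (fun j => abs_sgn _)
  have hκ := h.lip_nonneg
  have hpt : ∀ z₁ z₂, ((agr (u k) z₁ : ℝ) - agr (u k) z₂) ^ 2 ≤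
      4 * A z₁ ^ 2 + 4 * A z₂ ^ 2 + 2 * (κ * ∑ j, qb j) ^ 2 * agrDist u z₁ z₂ ^ 2 := by
    intro z₁ z₂
    have e : (agr (u k) z₁ : ℝ) - agr (u k) z₂ =
        -(A z₁ - A z₂) - ∑ j, sgn (u k j) * (condErr μ j z₁ - condErr μ j z₂) := by
      rw [agr_eq_sub_sum, agr_eq_sub_sum (u k) z₂]
      simp only [A, mul_sub, sum_sub_distrib]
      ring
    have hB : |∑ j, sgn (u k j) * (condErr μ j z₁ - condErr μ j z₂)| ≤
        κ * (∑ j, qb j) * agrDist u z₁ z₂ := by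
      rw [mul_comm κ, mul_assoc, sum_mul]
      refine (abs_sum_le_sum_abs _ _).trans (sum_le_sum fun j _ => ?_)
      rw [abs_mul]
      refine (mul_le_of_le_one_left (abs_nonneg _) (abs_sgn _)).trans ?_
      rw [← mul_assoc]
      exact h.abs_condErr_sub_le j z₁ z₂
    have hB2 := sq_le_sq' (by linarith [abs_le.1 hB]) (abs_le.1 hB).2
    rw [e]
    set B := ∑ j, sgn (u k j) * (condErr μ j z₁ - condErr μ j z₂)
    rw [mul_pow] at hB2
    nlinarith [sq_nonneg (A z₁ + A z₂), sq_nonneg (A z₁ - A z₂ - B)]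
  calc _ ≤ ∑ z₁, ∑ z₂, μ z₁ * μ z₂ *
        (4 * A z₁ ^ 2 + 4 * A z₂ ^ 2 + 2 * (κ * ∑ j, qb j) ^ 2 * agrDist u z₁ z₂ ^ 2) :=
        sum_le_sum fun z₁ _ => sum_le_sum fun z₂ _ =>
          mul_le_mul_of_nonneg_left (hpt z₁ z₂) (mul_nonneg (h.pos _).le (h.pos _).le)
    _ = 8 * Ex μ (fun z => A z ^ 2) + 2 * (κ * ∑ j, qb j) ^ 2 * meanSqDist u μ := by
        have e : ∀ z₁ z₂, μ z₁ * μ z₂ *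
            (4 * A z₁ ^ 2 + 4 * A z₂ ^ 2 + 2 * (κ * ∑ j, qb j) ^ 2 * agrDist u z₁ z₂ ^ 2) =
            4 * (μ z₁ * A z₁ ^ 2) * μ z₂ + 4 * μ z₁ * (μ z₂ * A z₂ ^ 2) +
            2 * (κ * ∑ j, qb j) ^ 2 * (μ z₁ * μ z₂ * agrDist u z₁ z₂ ^ 2) := by
          intros; ring
        simp only [e, sum_add_distrib, ← mul_sum, ← sum_mul, h.sum_eq]
        simp only [Ex, meanSqDist]
        ring
    _ ≤ _ := by
        linarith

theorem meanSqDist_nonneg (h : IsMeanField u μ κ qb) : 0 ≤ meanSqDist u μ :=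
  sum_nonneg fun _ _ => sum_nonneg fun _ _ =>
    mul_nonneg (mul_nonneg (h.pos _).le (h.pos _).le) (sq_nonneg _)

/-- Self-bounding: summing the bound of `sum_sq_agr_sub_le` over sources bounds `D` by a quantity
that contains `D` itself. The weak coupling `hs` makes its coefficient at most `1/4`, so it can be
absorbed. -/
theorem meanSqDist_le [Nonempty ι] (h : IsMeanField u μ κ qb)
    (hs : Fintype.card ι * κ * ∑ j, qb j ≤ 1 / 4) :
    meanSqDist u μ ≤ 64 * (Fintype.card ι : ℝ) ^ 2 * (∑ j, qb j + 1) := by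
  set n : ℝ := (Fintype.card ι : ℝ) with hn
  have hn1 : 1 ≤ n := by
    rw [hn]; exact_mod_cast Fintype.card_pos
  set Q := ∑ j, qb j
  set D := meanSqDist u μ with hD
  have hQ : 0 ≤ Q := sum_nonneg fun j _ => h.bound_nonneg j
  have hκ := h.lip_nonneg
  have hD0 : 0 ≤ D := h.meanSqDist_nonneg
  have h1 : D ≤ ∑ k, n * (2 * (∑ z₁, ∑ z₂, μ z₁ * μ z₂ *
      ((agr (u k) z₁ : ℝ) - agr (u k) z₂) ^ 2) + 2) := by
    have hpt : ∀ z₁ z₂, agrDist u z₁ z₂ ^ 2 ≤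
        ∑ k, n * (2 * ((agr (u k) z₁ : ℝ) - agr (u k) z₂) ^ 2 + 2) := by
      intro z₁ z₂
      refine (sq_sum_le_card_mul_sum_sq).trans ?_
      rw [card_univ, ← hn, mul_sum]
      refine sum_le_sum fun k _ => mul_le_mul_of_nonneg_left ?_ (by linarith)
      have := sq_abs ((agr (u k) z₁ : ℝ) - agr (u k) z₂)
      nlinarith [sq_nonneg (|(agr (u k) z₁ : ℝ) - agr (u k) z₂| - 1)]
    calc D ≤ ∑ z₁, ∑ z₂, μ z₁ * μ z₂ *
          ∑ k, n * (2 * ((agr (u k) z₁ : ℝ) - agr (u k) z₂) ^ 2 + 2) :=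
          sum_le_sum fun z₁ _ => sum_le_sum fun z₂ _ =>
            mul_le_mul_of_nonneg_left (hpt z₁ z₂) (mul_nonneg (h.pos _).le (h.pos _).le)
      _ = ∑ k, ∑ z₁, ∑ z₂, μ z₁ * μ z₂ *
          (n * (2 * ((agr (u k) z₁ : ℝ) - agr (u k) z₂) ^ 2 + 2)) := by
          simp only [mul_sum]
          symm
          rw [sum_comm]
          refine sum_congr rfl fun z₁ _ => ?_
          rw [sum_comm]
      _ = _ := by
          refine sum_congr rfl fun k _ => ?_
          have e : ∀ z₁ z₂, μ z₁ * μ z₂ *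
              (n * (2 * ((agr (u k) z₁ : ℝ) - agr (u k) z₂) ^ 2 + 2)) =
              2 * n * (μ z₁ * μ z₂ * ((agr (u k) z₁ : ℝ) - agr (u k) z₂) ^ 2) +
              2 * n * (μ z₁ * μ z₂) := by
            intros; ring
          simp only [e, sum_add_distrib, ← mul_sum, h.sum_eq, mul_one]
          ring
  have h2 : ∀ k, ∑ z₁, ∑ z₂, μ z₁ * μ z₂ * ((agr (u k) z₁ : ℝ) - agr (u k) z₂) ^ 2 ≤
      24 * Q + D / (8 * n ^ 2) := by
    intro k
    refine (h.sum_sq_agr_sub_le k).trans ?_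
    have a1 : n * κ * Q ^ 2 ≤ Q / 4 := by nlinarith
    have a2 : (κ * Q) ^ 2 ≤ 1 / (16 * n ^ 2) := by
      rw [le_div_iff₀ (by positivity)]
      have : (n * κ * Q) ^ 2 ≤ (1 / 4) ^ 2 := pow_le_pow_left₀ (by positivity) hs 2
      nlinarith
    have a3 := mul_le_mul_of_nonneg_right a2 hD0
    have a4 : 1 / (16 * n ^ 2) * D = D / (8 * n ^ 2) / 2 := by ring
    rw [a4] at a3
    linarith
  have h3 : D ≤ ∑ _k : ι, n * (2 * (24 * Q + D / (8 * n ^ 2)) + 2) :=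
    h1.trans (sum_le_sum fun k _ => mul_le_mul_of_nonneg_left (by linarith [h2 k]) (by linarith))
  rw [sum_const, card_univ, nsmul_eq_mul, ← hn] at h3
  have h4 : n * (n * (2 * (24 * Q + D / (8 * n ^ 2)) + 2)) = 48 * n ^ 2 * Q + D / 4 + 2 * n ^ 2 := by
    field_simp
    ring
  rw [h4] at h3
  nlinarith [mul_nonneg (sq_nonneg n) hQ]

end IsMeanField
end MeanField

/-! ### Density produced by flipping one label -/

section Flip

/-- The density between the two laws obtained by flipping a label with log-odds `a`, after
integrating out the error indicator with log-odds `b`. -/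
noncomputable def flipDensity (a b : ℝ) : ℝ :=
  (Real.exp a + Real.exp b) / (1 + Real.exp (a + b))

/-- Only the log-odds `a` of the flipped source enter. The log-odds `b` of all other sources grow
with their number, and no bound on them is available. -/
theorem flipDensity_le {a B : ℝ} (h : |a| ≤ B) (b : ℝ) : flipDensity a b ≤ Real.exp B := by
  obtain ⟨h1, h2⟩ := abs_le.1 h
  unfold flipDensity
  rw [div_le_iff₀ (by positivity), mul_add, mul_one, ← Real.exp_add]
  exact add_le_add (Real.exp_le_exp.2 h2) (Real.exp_le_exp.2 (by linarith))

theorem le_flipDensity {a B : ℝ} (h : |a| ≤ B) (b : ℝ) : Real.exp (-B) ≤ flipDensity a b := by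
  obtain ⟨h1, h2⟩ := abs_le.1 h
  unfold flipDensity
  rw [le_div_iff₀ (by positivity), mul_add, mul_one, ← Real.exp_add]
  exact add_le_add (Real.exp_le_exp.2 (by linarith)) (Real.exp_le_exp.2 (by linarith))

theorem flipDensity_sub_le {a₁ B : ℝ} (h : |a₁| ≤ B) (a₂ b₁ b₂ : ℝ) :
    flipDensity a₁ b₁ - flipDensity a₂ b₂ ≤ Real.exp B * (|a₁ - a₂| + |b₁ - b₂|) := by
  set x := |a₁ - a₂| + |b₁ - b₂|
  have hx : 0 ≤ x := by positivity
  have ha : a₁ - a₂ ≤ x := by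
    have := le_abs_self (a₁ - a₂); have := abs_nonneg (b₁ - b₂); simp only [x]; linarith
  have ha' : a₂ - a₁ ≤ x := by
    have := neg_abs_le (a₁ - a₂); have := abs_nonneg (b₁ - b₂); simp only [x]; linarith
  have hb : b₁ - b₂ ≤ x := by
    have := le_abs_self (b₁ - b₂); have := abs_nonneg (a₁ - a₂); simp only [x]; linarith
  have hb' : b₂ - b₁ ≤ x := by
    have := neg_abs_le (b₁ - b₂); have := abs_nonneg (a₁ - a₂); simp only [x]; linarith
  have key : Real.exp (-x) * flipDensity a₁ b₁ ≤ flipDensity a₂ b₂ := by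
    unfold flipDensity
    rw [← mul_div_assoc, div_le_div_iff₀ (by positivity) (by positivity)]
    simp only [mul_add, add_mul, mul_one, ← Real.exp_add]
    have e1 := Real.exp_le_exp.2 (show -x + a₁ ≤ a₂ by linarith)
    have e2 := Real.exp_le_exp.2 (show -x + b₁ ≤ b₂ by linarith)
    have e3 := Real.exp_le_exp.2 (show -x + a₁ + (a₂ + b₂) ≤ a₂ + (a₁ + b₁) by linarith)
    have e4 := Real.exp_le_exp.2 (show -x + b₁ + (a₂ + b₂) ≤ b₂ + (a₁ + b₁) by linarith)
    linarith
  have h1 : 1 - x ≤ Real.exp (-x) := by linarith [Real.add_one_le_exp (-x)]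
  have h2 : 0 ≤ flipDensity a₁ b₁ := by unfold flipDensity; positivity
  have h3 := mul_le_mul_of_nonneg_right h1 h2
  have h4 := mul_le_mul_of_nonneg_right (flipDensity_le h b₁) hx
  linarith

theorem abs_flipDensity_sub_le {a₁ a₂ B : ℝ} (h₁ : |a₁| ≤ B) (h₂ : |a₂| ≤ B) (b₁ b₂ : ℝ) :
    |flipDensity a₁ b₁ - flipDensity a₂ b₂| ≤ Real.exp B * (|a₁ - a₂| + |b₁ - b₂|) := by
  rw [abs_le]
  have e1 := flipDensity_sub_le h₁ a₂ b₁ b₂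
  have e2 := flipDensity_sub_le h₂ a₁ b₂ b₁
  rw [abs_sub_comm a₂, abs_sub_comm b₂] at e2
  constructor <;> linarith

end Flip

/-! ### Gibbs laws of potentials and their response to a flipped label -/

section Potential

variable {M : ℕ} {ι : Type*} [Fintype ι]

/-- The Gibbs weight of `z` for potentials of the agreements with the sources. -/
noncomputable def potWt (g : ι → ℕ → ℝ) (u : ι → Fin M → Bool) (z : Fin M → Bool) : ℝ :=
  Real.exp (∑ k, g k (agr (u k) z))

/-- The Gibbs law for potentials of the agreements with the sources. -/
noncomputable def potLaw (g : ι → ℕ → ℝ) (u : ι → Fin M → Bool) (z : Fin M → Bool) : ℝ :=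
  potWt g u z / ∑ z', potWt g u z'

/-- The log-odds of an error on task `j`. -/
noncomputable def logOdds (g : ι → ℕ → ℝ) (u : ι → Fin M → Bool) (j : Fin M) (z : Fin M → Bool) :
    ℝ :=
  ∑ k, -(sgn (u k j) * (g k (agrOff j (u k) z + 1) - g k (agrOff j (u k) z)))

variable {g : ι → ℕ → ℝ} {u : ι → Fin M → Bool}

theorem potWt_pos (g : ι → ℕ → ℝ) (u : ι → Fin M → Bool) (z : Fin M → Bool) : 0 < potWt g u z :=
  Real.exp_pos _

theorem sum_potWt_pos (g : ι → ℕ → ℝ) (u : ι → Fin M → Bool) : 0 < ∑ z, potWt g u z :=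
  sum_pos (fun z _ => potWt_pos g u z) univ_nonempty

theorem potLaw_pos (g : ι → ℕ → ℝ) (u : ι → Fin M → Bool) (z : Fin M → Bool) : 0 < potLaw g u z :=
  div_pos (potWt_pos _ _ _) (sum_potWt_pos _ _)

theorem sum_potLaw (g : ι → ℕ → ℝ) (u : ι → Fin M → Bool) : ∑ z, potLaw g u z = 1 := by
  unfold potLaw
  rw [← sum_div]
  exact div_self (sum_potWt_pos g u).ne'

theorem potWt_update_true (g : ι → ℕ → ℝ) (u : ι → Fin M → Bool) (j : Fin M) (z : Fin M → Bool) :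
    potWt g u (Function.update z j true) =
      Real.exp (logOdds g u j z) * potWt g u (Function.update z j false) := by
  unfold potWt logOdds
  rw [← Real.exp_add, ← sum_add_distrib]
  congr 1
  refine sum_congr rfl fun k _ => ?_
  simp only [agr_update_right]
  cases u k j <;> simp [sgn]

theorem logOdds_sub_le {κ : ℝ}
    (hg : ∀ k l l', |(g k (l + 1) - g k l) - (g k (l' + 1) - g k l')| ≤ κ * |(l : ℝ) - l'|)
    (hκ : 0 ≤ κ) (j : Fin M) (z₁ z₂ : Fin M → Bool) :
    logOdds g u j z₁ - logOdds g u j z₂ ≤ κ * agrDist u z₁ z₂ := by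
  unfold logOdds agrDist
  rw [← sum_sub_distrib, mul_sum]
  refine sum_le_sum fun k _ => ?_
  have h1 := (hg k (agrOff j (u k) z₁) (agrOff j (u k) z₂)).trans
    (mul_le_mul_of_nonneg_left (abs_agrOff_sub_le j (u k) z₁ z₂) hκ)
  have h2 := abs_le.1 h1
  unfold sgn
  split_ifs <;> linarith [h2.1, h2.2]

theorem potLaw_isMeanField {κ : ℝ} {qb : Fin M → ℝ}
    (hg : ∀ k l l', |(g k (l + 1) - g k l) - (g k (l' + 1) - g k l')| ≤ κ * |(l : ℝ) - l'|)
    (hκ : 0 ≤ κ) (hq : ∀ j z, condErr (potLaw g u) j z ≤ qb j) :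
    IsMeanField u (potLaw g u) κ qb where
  pos := potLaw_pos g u
  sum_eq := sum_potLaw g u
  lip_nonneg := hκ
  cond := hq
  lip j z₁ z₂ := by
    have hZ := sum_potWt_pos g u
    have h1 := Real.exp_le_exp.2 (logOdds_sub_le (u := u) hg hκ j z₁ z₂)
    rw [Real.exp_sub, div_le_iff₀ (Real.exp_pos _)] at h1
    unfold potLaw
    rw [potWt_update_true, potWt_update_true g u j z₂]
    set Z := ∑ z', potWt g u z'
    have a1 := potWt_pos g u (Function.update z₁ j false)
    have a2 := potWt_pos g u (Function.update z₂ j false)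
    set A1 := potWt g u (Function.update z₁ j false)
    set A2 := potWt g u (Function.update z₂ j false)
    have h2 := mul_le_mul_of_nonneg_right h1 (by positivity : 0 ≤ A1 / Z * (A2 / Z))
    calc _ = Real.exp (logOdds g u j z₁) * (A1 / Z * (A2 / Z)) := by ring
      _ ≤ _ := h2
      _ = _ := by ring

theorem condErr_potLaw_le (j : Fin M) (z : Fin M → Bool) :
    condErr (potLaw g u) j z ≤ min 1 (Real.exp (logOdds g u j z)) := by
  unfold condErr potLaw
  rw [potWt_update_true]
  have hZ := sum_potWt_pos g u
  have a := potWt_pos g u (Function.update z j false)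
  set A := potWt g u (Function.update z j false)
  set Z := ∑ z', potWt g u z'
  set E := Real.exp (logOdds g u j z)
  have hE : 0 < E := Real.exp_pos _
  have h : E * A / Z / (A / Z + E * A / Z) = E / (1 + E) := by
    field_simp
  rw [h]
  refine le_min ?_ ?_
  · rw [div_le_one (by positivity)]; linarith
  · exact div_le_self hE.le (by linarith)

variable [DecidableEq ι]

/-- The log-odds of an error on task `j`, without the contribution of source `i`. -/
noncomputable def logOddsErase (g : ι → ℕ → ℝ) (u : ι → Fin M → Bool) (i : ι) (j : Fin M)
    (z : Fin M → Bool) : ℝ :=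
  ∑ k ∈ univ.erase i, -(sgn (u k j) * (g k (agrOff j (u k) z + 1) - g k (agrOff j (u k) z)))

/-- For fixed `z`, the flip multiplies the weight by `exp a` or `exp (-a)` according to `z j`. Once
`z j` is summed out, the factor depends only on agreements off `j`, through which it varies slowly.
-/
theorem potWt_setAt_add (g : ι → ℕ → ℝ) (u : ι → Fin M → Bool) (i : ι) (j : Fin M)
    (z : Fin M → Bool) :
    potWt g (setAt u i j true) (Function.update z j false) +
        potWt g (setAt u i j true) (Function.update z j true) =
      flipDensity (g i (agrOff j (u i) z + 1) - g i (agrOff j (u i) z)) (logOddsErase g u i j z) *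
      (potWt g (setAt u i j false) (Function.update z j false) +
        potWt g (setAt u i j false) (Function.update z j true)) := by
  set a := g i (agrOff j (u i) z + 1) - g i (agrOff j (u i) z) with ha
  set b := logOddsErase g u i j z with hb
  have hlo : ∀ v, logOdds g (setAt u i j v) j z = -(sgn v * a) + b := by
    intro v
    unfold logOdds
    rw [← add_sum_erase _ _ (mem_univ i), setAt_self, Function.update_self, agrOff_update_left,
      ← ha, hb]
    congr 1
    exact sum_congr rfl fun k hk => by rw [setAt_apply_ne _ _ _ _ (ne_of_mem_erase hk)]
  have hbase : potWt g (setAt u i j true) (Function.update z j false) =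
      Real.exp a * potWt g (setAt u i j false) (Function.update z j false) := by
    unfold potWt
    rw [← Real.exp_add, ← add_sum_erase _ _ (mem_univ i),
      ← add_sum_erase (a := i) univ _ (mem_univ i), ← add_assoc]
    have h2 : ∀ v, ∑ k ∈ univ.erase i, g k (agr (setAt u i j v k) (Function.update z j false)) =
        ∑ k ∈ univ.erase i, g k (agr (u k) (Function.update z j false)) := fun v =>
      sum_congr rfl fun k hk => by rw [setAt_apply_ne _ _ _ _ (ne_of_mem_erase hk)]
    rw [h2, h2]
    congr 2
    simp only [setAt_self, agr_update_right, agrOff_update_left, Function.update_self]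
    simp [ha]
  rw [potWt_update_true, potWt_update_true, hlo, hlo, hbase]
  unfold flipDensity sgn
  set c := potWt g (setAt u i j false) (Function.update z j false)
  simp only [Bool.false_eq_true, if_false, if_true, one_mul, neg_mul, neg_neg]
  have : (1 + Real.exp (a + b)) ≠ 0 := by positivity
  have e : Real.exp (-a + b) * Real.exp a = Real.exp b := by
    rw [← Real.exp_add]; congr 1; ring
  rw [← mul_assoc, e, ← add_mul, div_mul_eq_mul_div, eq_div_iff this]
  ring

/-- On functions that ignore task `j`, the flip is a change of measure with density proportional to
`flipDensity`. The change of mean is thus `Cov(H, Ψ) / E H`. One factor `exp B` comes from the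
Lipschitz constant of `H`, the other from `E H ≥ exp (-B)`. -/
theorem abs_Ex_setAt_sub_le {κ B b D : ℝ} {qb : Fin M → ℝ}
    (hg : ∀ k l l', |(g k (l + 1) - g k l) - (g k (l' + 1) - g k l')| ≤ κ * |(l : ℝ) - l'|)
    {i : ι} (hB : ∀ l, |g i (l + 1) - g i l| ≤ B) {j : Fin M}
    (h : IsMeanField (setAt u i j false) (potLaw g (setAt u i j false)) κ qb)
    (hD : meanSqDist (setAt u i j false) (potLaw g (setAt u i j false)) ≤ D) (hb : 0 ≤ b)
    {Ψ : (Fin M → Bool) → ℝ} (hΨ : ∀ z v, Ψ (Function.update z j v) = Ψ z)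
    (hΨl : ∀ z₁ z₂, |Ψ z₁ - Ψ z₂| ≤ b * agrDist (setAt u i j false) z₁ z₂) :
    |Ex (potLaw g (setAt u i j true)) Ψ - Ex (potLaw g (setAt u i j false)) Ψ| ≤
      Real.exp (2 * B) * κ * b * D / 2 := by
  have hκ := h.lip_nonneg
  set v := setAt u i j false with hv
  set H : (Fin M → Bool) → ℝ := fun z =>
    flipDensity (g i (agrOff j (u i) z + 1) - g i (agrOff j (u i) z)) (logOddsErase g u i j z)
    with hH
  have hHinv : ∀ z w, H (Function.update z j w) = H z := by
    intro z w
    simp only [hH, logOddsErase, agrOff_update_right]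
  have hsum : ∀ F : (Fin M → Bool) → ℝ, (∀ z w, F (Function.update z j w) = F z) →
      ∑ z, potWt g (setAt u i j true) z * F z = ∑ z, potWt g v z * (H z * F z) := by
    intro F hF
    rw [sum_eq_half_sum_update j, sum_eq_half_sum_update j fun z => potWt g v z * (H z * F z)]
    congr 1
    refine sum_congr rfl fun z _ => ?_
    simp only [hHinv, hF, ← add_mul]
    rw [potWt_setAt_add, ← mul_assoc]
    simp only [hH, hv]
    ring
  have hHl : ∀ z₁ z₂, |H z₁ - H z₂| ≤ (Real.exp B * κ) * agrDist v z₁ z₂ := by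
    intro z₁ z₂
    refine (abs_flipDensity_sub_le (hB _) (hB _) _ _).trans ?_
    rw [mul_assoc]
    refine mul_le_mul_of_nonneg_left ?_ (Real.exp_pos _).le
    have hoff : ∀ k, agrOff j (v k) = agrOff j (u k) := by
      intro k
      by_cases hk : k = i
      · subst hk; rw [hv, setAt_self]; funext z; exact agrOff_update_left _ _ _ _
      · rw [hv, setAt_apply_ne _ _ _ _ hk]
    have hterm : ∀ k, |(g k (agrOff j (u k) z₁ + 1) - g k (agrOff j (u k) z₁)) -
        (g k (agrOff j (u k) z₂ + 1) - g k (agrOff j (u k) z₂))| ≤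
        κ * (|(agr (v k) z₁ : ℝ) - agr (v k) z₂| + 1) := by
      intro k
      rw [← hoff]
      exact (hg _ _ _).trans (mul_le_mul_of_nonneg_left (abs_agrOff_sub_le _ _ _ _) hκ)
    unfold agrDist
    rw [mul_sum, ← add_sum_erase _ _ (mem_univ i)]
    refine add_le_add (hterm i) ?_
    unfold logOddsErase
    rw [← sum_sub_distrib]
    refine (abs_sum_le_sum_abs _ _).trans (sum_le_sum fun k _ => le_trans (le_of_eq ?_) (hterm k))
    unfold sgn
    split_ifs
    · rw [abs_sub_comm]; congr 1; ring
    · congr 1; ring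
  have hcov := abs_Ex_mul_sub_le (fun z => (h.pos z).le) h.sum_eq hHl hΨl
  have hZ := sum_potWt_pos g v
  have hEx : ∀ F : (Fin M → Bool) → ℝ, Ex (potLaw g v) F =
      (∑ z, potWt g v z * F z) / ∑ z, potWt g v z := by
    intro F
    simp only [Ex, potLaw, sum_div]
    exact sum_congr rfl fun z _ => by ring
  have hEx' : ∀ F : (Fin M → Bool) → ℝ, Ex (potLaw g (setAt u i j true)) F =
      (∑ z, potWt g (setAt u i j true) z * F z) / ∑ z, potWt g (setAt u i j true) z := by
    intro F
    simp only [Ex, potLaw, sum_div]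
    exact sum_congr rfl fun z _ => by ring
  have hH0 : Real.exp (-B) ≤ Ex (potLaw g v) H := by
    refine (Ex_const h.sum_eq _).symm.trans_le (Ex_mono (fun z => (h.pos z).le) fun z => ?_)
    exact le_flipDensity (hB _) _
  have hHpos : 0 < Ex (potLaw g v) H := (Real.exp_pos _).trans_le hH0
  have hfrac : Ex (potLaw g (setAt u i j true)) Ψ =
      Ex (potLaw g v) (fun z => H z * Ψ z) / Ex (potLaw g v) H := by
    rw [hEx', hsum Ψ hΨ, hEx, hEx]
    have h1 := hsum (fun _ => 1) fun _ _ => rfl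
    simp only [mul_one] at h1
    rw [h1, div_div_div_cancel_right₀ hZ.ne']
  have hdiff : Ex (potLaw g (setAt u i j true)) Ψ - Ex (potLaw g v) Ψ =
      (Ex (potLaw g v) (fun z => H z * Ψ z) - Ex (potLaw g v) H * Ex (potLaw g v) Ψ) /
        Ex (potLaw g v) H := by
    rw [hfrac]; field_simp
  rw [hdiff, abs_div, abs_of_pos hHpos, div_le_iff₀ hHpos]
  have hD0 := h.meanSqDist_nonneg
  calc _ ≤ _ := hcov
    _ ≤ Real.exp B * κ * b * D / 2 := by
        have := mul_le_mul_of_nonneg_left hD (by positivity : 0 ≤ Real.exp B * κ * b)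
        linarith
    _ = Real.exp (2 * B) * κ * b * D / 2 * Real.exp (-B) := by
        have : Real.exp B = Real.exp (2 * B) * Real.exp (-B) := by
          rw [← Real.exp_add]; congr 1; ring
        rw [this]; ring
    _ ≤ _ := by
        have hD' : 0 ≤ D := hD0.trans hD
        exact mul_le_mul_of_nonneg_left hH0 (by positivity)

end Potential


/-! ### Folding the complement onto the truth -/

section Fold

variable {M : ℕ} {ι : Type*} [Fintype ι] {g h : ι → ℕ → ℝ} {u : ι → Fin M → Bool}

/-- The mean agreement with source `i` under the law that mixes the Gibbs law with its image under
complementation, where `potWt h` is the density of the complemented part. -/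
noncomputable def foldMean (g h : ι → ℕ → ℝ) (u : ι → Fin M → Bool) (i : ι) : ℝ :=
  Ex (potLaw g u) (fun z => agr (u i) z + potWt h u z * (M - agr (u i) z)) /
    Ex (potLaw g u) (fun z => 1 + potWt h u z)

theorem potWt_sub_le {κ Rm : ℝ} (hh : ∀ k (l l' : ℕ), |h k l - h k l'| ≤ κ * |(l : ℝ) - l'|)
    (hR : ∀ (u : ι → Fin M → Bool) z, potWt h u z ≤ Rm) (u₁ u₂ : ι → Fin M → Bool)
    (z₁ z₂ : Fin M → Bool) :
    potWt h u₁ z₁ - potWt h u₂ z₂ ≤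
      Rm * (κ * ∑ k, |(agr (u₁ k) z₁ : ℝ) - agr (u₂ k) z₂|) := by
  set x := ∑ k, h k (agr (u₁ k) z₁) with hx
  set y := ∑ k, h k (agr (u₂ k) z₂) with hy
  have hxy : x - y ≤ κ * ∑ k, |(agr (u₁ k) z₁ : ℝ) - agr (u₂ k) z₂| := by
    rw [hx, hy, ← sum_sub_distrib, mul_sum]
    exact sum_le_sum fun k _ => (le_abs_self _).trans (hh _ _ _)
  have hxy0 : 0 ≤ κ * ∑ k, |(agr (u₁ k) z₁ : ℝ) - agr (u₂ k) z₂| := by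
    rw [mul_sum]
    exact sum_nonneg fun k _ => (abs_nonneg _).trans (hh k _ _)
  have h1 : potWt h u₁ z₁ - potWt h u₂ z₂ ≤ potWt h u₁ z₁ * (x - y) := by
    have e1 : potWt h u₂ z₂ = potWt h u₁ z₁ * Real.exp (y - x) := by
      unfold potWt
      rw [← Real.exp_add, ← hx, ← hy]
      congr 1
      ring
    have e2 : y - x + 1 ≤ Real.exp (y - x) := Real.add_one_le_exp _
    have e3 := mul_le_mul_of_nonneg_left e2 (potWt_pos h u₁ z₁).le
    rw [e1]
    linarith
  refine h1.trans ?_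
  exact (mul_le_mul_of_nonneg_left hxy (potWt_pos _ _ _).le).trans
    (mul_le_mul_of_nonneg_right (hR _ _) hxy0)

theorem abs_potWt_sub_le {κ Rm : ℝ} (hh : ∀ k (l l' : ℕ), |h k l - h k l'| ≤ κ * |(l : ℝ) - l'|)
    (hR : ∀ (u : ι → Fin M → Bool) z, potWt h u z ≤ Rm) (u₁ u₂ : ι → Fin M → Bool)
    (z₁ z₂ : Fin M → Bool) :
    |potWt h u₁ z₁ - potWt h u₂ z₂| ≤
      Rm * (κ * ∑ k, |(agr (u₁ k) z₁ : ℝ) - agr (u₂ k) z₂|) := by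
  rw [abs_le]
  have e1 := potWt_sub_le hh hR u₁ u₂ z₁ z₂
  have e2 := potWt_sub_le hh hR u₂ u₁ z₂ z₁
  simp only [abs_sub_comm (agr (u₂ _) z₂ : ℝ)] at e2
  constructor <;> linarith

/-- With `x` the mean agreement and `y` the mean relative weight of the complement, the complement
holds the share `y / (1 + y)` and replaces `x` by `M - x`. The last term corrects for the covariance
of that weight with the agreement. -/
theorem foldMean_eq (g h : ι → ℕ → ℝ) (u : ι → Fin M → Bool) (i : ι) :
    foldMean g h u i = Ex (potLaw g u) (fun z => agr (u i) z) +
      Ex (potLaw g u) (potWt h u) / (1 + Ex (potLaw g u) (potWt h u)) *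
        (M - 2 * Ex (potLaw g u) (fun z => agr (u i) z)) -
      (Ex (potLaw g u) (fun z => potWt h u z * agr (u i) z) -
        Ex (potLaw g u) (potWt h u) * Ex (potLaw g u) (fun z => agr (u i) z)) /
        (1 + Ex (potLaw g u) (potWt h u)) := by
  have hy : 0 < Ex (potLaw g u) (potWt h u) :=
    sum_pos (fun z _ => mul_pos (potLaw_pos _ _ _) (potWt_pos _ _ _)) univ_nonempty
  unfold foldMean
  have e1 : Ex (potLaw g u) (fun z => 1 + potWt h u z) = 1 + Ex (potLaw g u) (potWt h u) := by
    rw [Ex_add, Ex_const (sum_potLaw g u)]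
  have e2 : Ex (potLaw g u) (fun z => agr (u i) z + potWt h u z * (M - agr (u i) z)) =
      Ex (potLaw g u) (fun z => agr (u i) z) + M * Ex (potLaw g u) (potWt h u) -
        Ex (potLaw g u) (fun z => potWt h u z * agr (u i) z) := by
    rw [← Ex_const_mul, ← Ex_add, ← Ex_sub]
    congr 1
    funext z
    ring
  rw [e1, e2]
  have : 1 + Ex (potLaw g u) (potWt h u) ≠ 0 := by positivity
  field_simp
  ring

theorem abs_div_one_add_sub_le {x y : ℝ} (hx : 0 ≤ x) (hy : 0 ≤ y) :
    |x / (1 + x) - y / (1 + y)| ≤ |x - y| := by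
  have e : x / (1 + x) - y / (1 + y) = (x - y) / ((1 + x) * (1 + y)) := by
    field_simp
    ring
  rw [e, abs_div]
  refine div_le_self (abs_nonneg _) ?_
  rw [abs_of_pos (by positivity)]
  nlinarith

variable [DecidableEq ι]

/-- The gain on task `j` itself is one minus the two error probabilities, and the other tasks
respond by a covariance of order `κ * D`. The share of the complement multiplies `M - 2x`, so its
size alone would not be enough. What is used is that the flip changes it only by `Rm * κ` times the
number of sources plus a covariance, with `M * κ` bounded in the application. -/
theorem le_foldMean_sub {κ B Rm D : ℝ} {qb : Fin M → ℝ}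
    (hg : ∀ k l l', |(g k (l + 1) - g k l) - (g k (l' + 1) - g k l')| ≤ κ * |(l : ℝ) - l'|)
    (hh : ∀ k (l l' : ℕ), |h k l - h k l'| ≤ κ * |(l : ℝ) - l'|)
    (hR : ∀ (u : ι → Fin M → Bool) z, potWt h u z ≤ Rm) (hR1 : Rm ≤ 1)
    {i : ι} (hB : ∀ l, |g i (l + 1) - g i l| ≤ B) {j : Fin M}
    (hm : ∀ b, IsMeanField (setAt u i j b) (potLaw g (setAt u i j b)) κ qb)
    (hD : ∀ b, meanSqDist (setAt u i j b) (potLaw g (setAt u i j b)) ≤ D) :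
    1 - 2 * qb j - (3 / 2 * Real.exp (2 * B) * κ * D + κ * D +
        Real.exp (2 * B) * (M * κ) * κ * D + 2 * Rm * (1 + Fintype.card ι * (M * κ))) ≤
      foldMean g h (setAt u i j true) i - foldMean g h (setAt u i j false) i := by
  have hκ := (hm true).lip_nonneg
  have hD0 : 0 ≤ D := (hm true).meanSqDist_nonneg.trans (hD true)
  have hRm0 : 0 ≤ Rm := (potWt_pos h u fun _ => false).le.trans (hR _ _)
  set μ : Bool → (Fin M → Bool) → ℝ := fun b => potLaw g (setAt u i j b)
  have hμ : ∀ b z, 0 ≤ μ b z := fun b z => (potLaw_pos _ _ _).le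
  set x : Bool → ℝ := fun b => Ex (μ b) fun z => agr (setAt u i j b i) z with hx
  set y : Bool → ℝ := fun b => Ex (μ b) (potWt h (setAt u i j b)) with hy
  set c : Bool → ℝ := fun b => Ex (μ b) (fun z => potWt h (setAt u i j b) z *
    agr (setAt u i j b i) z) - y b * x b with hc
  have hf : ∀ b, foldMean g h (setAt u i j b) i =
      x b + y b / (1 + y b) * (M - 2 * x b) - c b / (1 + y b) := fun b => foldMean_eq _ _ _ _
  have hy0 : ∀ b, 0 ≤ y b := fun b =>
    sum_nonneg fun z _ => mul_nonneg (hμ b z) (potWt_pos _ _ _).le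
  have hyR : ∀ b, y b ≤ Rm := fun b =>
    (Ex_mono (hμ b) fun z => hR _ z).trans_eq (Ex_const (sum_potLaw _ _) _)
  have hRl : ∀ b z₁ z₂, |potWt h (setAt u i j b) z₁ - potWt h (setAt u i j b) z₂| ≤
      Rm * κ * agrDist (setAt u i j b) z₁ z₂ := by
    intro b z₁ z₂
    refine (abs_potWt_sub_le hh hR _ _ _ _).trans ?_
    rw [mul_assoc]
    refine mul_le_mul_of_nonneg_left (mul_le_mul_of_nonneg_left ?_ hκ) hRm0
    exact sum_le_sum fun k _ => by linarith
  have hsl : ∀ b z₁ z₂, |(agr (setAt u i j b i) z₁ : ℝ) - agr (setAt u i j b i) z₂| ≤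
      1 * agrDist (setAt u i j b) z₁ z₂ := by
    intro b z₁ z₂
    have := abs_agr_sub_le_agrDist (setAt u i j b) i z₁ z₂
    linarith
  have hcb : ∀ b, |c b / (1 + y b)| ≤ Rm * κ * D / 2 := by
    intro b
    have h1 := abs_Ex_mul_sub_le (hμ b) (sum_potLaw _ _) (hRl b) (hsl b)
    have h2 : |c b| ≤ Rm * κ * D / 2 := by
      refine h1.trans ?_
      have := mul_le_mul_of_nonneg_left (hD b) (by positivity : 0 ≤ Rm * κ)
      linarith
    rw [abs_div, abs_of_pos (by linarith [hy0 b] : 0 < 1 + y b)]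
    exact (div_le_self (abs_nonneg _) (by linarith [hy0 b])).trans h2
  -- the agreements outside `j`
  set o : Bool → ℝ := fun b => Ex (μ b) fun z => agrOff j (u i) z
  set e : Bool → ℝ := fun b => Ex (μ b) fun z => ind (z j)
  have hxt : x true = o true + 1 - e true := by
    simp only [hx, o, e]
    rw [← Ex_const (sum_potLaw g (setAt u i j true)) 1, ← Ex_add, ← Ex_sub]
    congr 1
    funext z
    rw [setAt_self, agr_eq j, agrOff_update_left, Function.update_self]
    cases z j <;> simp [ind]
  have hxf : x false = o false + e false := by
    simp only [hx, o, e]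
    rw [← Ex_add]
    congr 1
    funext z
    rw [setAt_self, agr_eq j, agrOff_update_left, Function.update_self]
    cases z j <;> simp [ind]
  have ho : |o true - o false| ≤ Real.exp (2 * B) * κ * 1 * D / 2 := by
    refine abs_Ex_setAt_sub_le hg hB (hm false) (hD false) zero_le_one
      (fun z v => by rw [agrOff_update_right]) fun z₁ z₂ => ?_
    have h1 := abs_agrOff_sub_le j (setAt u i j false i) z₁ z₂
    rw [setAt_self, agrOff_update_left, agrOff_update_left] at h1
    have h2 := abs_agr_sub_le_agrDist (setAt u i j false) i z₁ z₂
    rw [setAt_self] at h2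
    linarith
  have he : ∀ b, 0 ≤ e b ∧ e b ≤ qb j ∧ e b ≤ 1 := fun b =>
    ⟨sum_nonneg fun z _ => mul_nonneg (hμ b z) (IsMeanField.ind_nonneg _), (hm b).Ex_ind_le j,
      (Ex_mono (hμ b) fun z => IsMeanField.ind_le_one _).trans_eq (Ex_const (sum_potLaw _ _) _)⟩
  set cr := Real.exp (2 * B) * κ * 1 * D / 2 with hcr
  have hcr0 : 0 ≤ cr := by positivity
  have hdx1 : 1 - 2 * qb j - cr ≤ x true - x false := by
    linarith [(he true).2.1, (he false).2.1, (abs_le.1 ho).1]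
  have hdx2 : |x true - x false| ≤ 1 + cr := by
    rw [abs_le]
    constructor <;> linarith [(he true).1, (he false).1, (he true).2.2, (he false).2.2,
      (abs_le.1 ho).1, (abs_le.1 ho).2]
  -- the complemented part
  have hdy : |y true - y false| ≤ 2 * (Rm * (κ * Fintype.card ι)) +
      Real.exp (2 * B) * κ * (2 * (Rm * κ)) * D / 2 := by
    -- The label and the error at `j` are both reset, since `abs_Ex_setAt_sub_le` needs a fixed
    -- function that ignores task `j`. Each reset moves every agreement count by at most one in
    -- total.
    set Ψ : (Fin M → Bool) → ℝ := fun z => potWt h u (Function.update z j false) with hΨ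
    have hnear : ∀ b, |y b - Ex (μ b) Ψ| ≤ Rm * (κ * Fintype.card ι) := by
      intro b
      simp only [hy]
      rw [← Ex_sub]
      refine (abs_Ex_le (hμ b) _).trans ?_
      refine (Ex_mono (hμ b) fun z => ?_).trans_eq (Ex_const (sum_potLaw _ _) _)
      refine (abs_potWt_sub_le hh hR _ _ _ _).trans ?_
      refine mul_le_mul_of_nonneg_left (mul_le_mul_of_nonneg_left ?_ hκ) hRm0
      calc _ ≤ ∑ _k : ι, (1 : ℝ) := ?_
        _ = Fintype.card ι := by simp
      refine sum_le_sum fun k _ => ?_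
      have hoff : agrOff j (setAt u i j b k) z = agrOff j (u k) z := by
        by_cases hk : k = i
        · subst hk; rw [setAt_self, agrOff_update_left]
        · rw [setAt_apply_ne _ _ _ _ hk]
      rw [agr_update_right, agr_eq j, hoff]
      push_cast
      rw [abs_le]
      constructor <;> split_ifs <;> linarith
    have hmid : |Ex (μ true) Ψ - Ex (μ false) Ψ| ≤
        Real.exp (2 * B) * κ * (2 * (Rm * κ)) * D / 2 := by
      refine abs_Ex_setAt_sub_le hg hB (hm false) (hD false) (by positivity)
        (fun z v => by simp only [hΨ, Function.update_idem]) fun z₁ z₂ => ?_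
      refine (abs_potWt_sub_le hh hR _ _ _ _).trans ?_
      rw [mul_comm 2 (Rm * κ), mul_assoc, mul_assoc]
      refine mul_le_mul_of_nonneg_left (mul_le_mul_of_nonneg_left ?_ hκ) hRm0
      unfold agrDist
      rw [mul_sum]
      refine sum_le_sum fun k _ => ?_
      have hoff : ∀ z, agrOff j (setAt u i j false k) z = agrOff j (u k) z := by
        intro z
        by_cases hk : k = i
        · subst hk; rw [setAt_self, agrOff_update_left]
        · rw [setAt_apply_ne _ _ _ _ hk]
      have h1 := abs_agrOff_sub_le j (setAt u i j false k) z₁ z₂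
      rw [hoff, hoff] at h1
      rw [agr_update_right, agr_update_right]
      push_cast
      rw [add_sub_add_right_eq_sub]
      have := abs_nonneg ((agr (setAt u i j false k) z₁ : ℝ) - agr (setAt u i j false k) z₂)
      linarith
    have e1 := abs_le.1 (hnear true)
    have e2 := abs_le.1 (hnear false)
    have e3 := abs_le.1 hmid
    rw [abs_le]
    constructor <;> linarith [e1.1, e1.2, e2.1, e2.2, e3.1, e3.2]
  have hxM : ∀ b, |M - 2 * x b| ≤ M := by
    intro b
    have h0 : 0 ≤ x b := sum_nonneg fun z _ => mul_nonneg (hμ b z) (Nat.cast_nonneg _)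
    have h1 : x b ≤ M := (Ex_mono (hμ b) fun z => by exact_mod_cast agr_le _ z).trans_eq
      (Ex_const (sum_potLaw _ _) _)
    rw [abs_le]
    constructor <;> linarith
  set q : Bool → ℝ := fun b => y b / (1 + y b) with hq
  have hq0 : ∀ b, 0 ≤ q b := fun b => div_nonneg (hy0 b) (by linarith [hy0 b])
  have hqR : ∀ b, q b ≤ Rm := fun b =>
    (div_le_self (hy0 b) (by linarith [hy0 b])).trans (hyR b)
  have hdq : |q true - q false| ≤ |y true - y false| := abs_div_one_add_sub_le (hy0 _) (hy0 _)
  have t1 : |(q true - q false) * (M - 2 * x true)| ≤ (2 * (Rm * (κ * Fintype.card ι)) +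
      Real.exp (2 * B) * κ * (2 * (Rm * κ)) * D / 2) * M := by
    rw [abs_mul]
    exact mul_le_mul (hdq.trans hdy) (hxM _) (abs_nonneg _) (by positivity)
  have t2 : |2 * q false * (x true - x false)| ≤ 2 * Rm * (1 + cr) := by
    rw [abs_mul, abs_of_nonneg (by linarith [hq0 false] : 0 ≤ 2 * q false)]
    exact mul_le_mul (by linarith [hqR false]) hdx2 (abs_nonneg _) (by linarith)
  have t3 := abs_le.1 (hcb true)
  have t4 := abs_le.1 (hcb false)
  have t1' := abs_le.1 t1
  have t2' := abs_le.1 t2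
  rw [hf, hf]
  have hsplit : q true * (M - 2 * x true) - q false * (M - 2 * x false) =
      (q true - q false) * (M - 2 * x true) - 2 * q false * (x true - x false) := by ring
  have s1 : Rm * cr ≤ cr := mul_le_of_le_one_left hcr0 hR1
  have s2 : Rm * (κ * D) ≤ κ * D := mul_le_of_le_one_left (by positivity) hR1
  have s3 : Rm * (Real.exp (2 * B) * (M * κ) * κ * D) ≤ Real.exp (2 * B) * (M * κ) * κ * D :=
    mul_le_of_le_one_left (by positivity) hR1
  have s4 : 3 / 2 * Real.exp (2 * B) * κ * D = 3 * cr := by rw [hcr]; ring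
  rw [s4]
  have s5 : (2 * (Rm * (κ * Fintype.card ι)) + Real.exp (2 * B) * κ * (2 * (Rm * κ)) * D / 2) * M =
      2 * Rm * (Fintype.card ι * (M * κ)) + Rm * (Real.exp (2 * B) * (M * κ) * κ * D) := by ring
  rw [s5] at t1'
  simp only [hq] at hsplit t1' t2'
  linarith [t1'.1, t2'.2, t3.2, t4.1]

end Fold


/-! ### Beta weights: integrals, ratios and complementation -/

section Beta

theorem integral_pow_mul_one_sub_pow (a b : ℕ) :
    ∫ x in (0 : ℝ)..1, x ^ a * (1 - x) ^ b = betaFn (a + 1) (b + 1) := by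
  induction b generalizing a with
  | zero =>
    simp only [pow_zero, mul_one, integral_pow, betaFn]
    simp only [one_pow, zero_add, Nat.add_sub_cancel, Nat.factorial_succ, ne_eq,
      Nat.add_eq_zero_iff, one_ne_zero, and_false, not_false_eq_true, zero_pow, sub_zero]
    push_cast
    field_simp
    simp
  | succ b ih =>
    have hd : ∀ x ∈ Set.uIcc (0 : ℝ) 1, HasDerivAt (fun x : ℝ => x ^ (a + 1) * (1 - x) ^ (b + 1))
        ((a + 1) * (x ^ a * (1 - x) ^ (b + 1)) - (b + 1) * (x ^ (a + 1) * (1 - x) ^ b)) x := by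
      intro x _
      have h1 := hasDerivAt_pow (a + 1) x
      have h2 := ((hasDerivAt_id' x).const_sub 1).fun_pow (b + 1)
      refine (h1.mul h2).congr_deriv ?_
      simp only [Nat.add_sub_cancel]
      push_cast
      ring
    have hint := intervalIntegral.integral_eq_sub_of_hasDerivAt hd
      (Continuous.intervalIntegrable (by fun_prop) _ _)
    rw [intervalIntegral.integral_sub (Continuous.intervalIntegrable (by fun_prop) _ _)
      (Continuous.intervalIntegrable (by fun_prop) _ _), intervalIntegral.integral_const_mul,
      intervalIntegral.integral_const_mul, ih (a + 1)] at hint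
    simp only [one_pow, sub_self, ne_eq, Nat.add_eq_zero_iff, one_ne_zero, and_false,
      not_false_eq_true, zero_pow, mul_zero, zero_mul] at hint
    have hb : (a + 1 : ℝ) * betaFn (a + 1) (b + 1 + 1) = (b + 1) * betaFn (a + 1 + 1) (b + 1) := by
      unfold betaFn
      rw [show a + 1 + (b + 1 + 1) = a + 1 + 1 + (b + 1) by ring]
      simp only [Nat.add_sub_cancel, Nat.factorial_succ]
      push_cast
      field_simp
    have : (a + 1 : ℝ) ≠ 0 := by positivity
    apply mul_left_cancel₀ this
    linarith

/-- The beta weight is a mixture of Bernoulli likelihoods over an unknown accuracy. Bounds uniform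
in the accuracy `x` thus transfer to the posterior weights. -/
theorem betaWt_eq_integral {M c w s : ℕ} (hc : 0 < c) (hw : 0 < w) :
    betaWt M c w s = ∫ x in (0 : ℝ)..1, x ^ (s + (c - 1)) * (1 - x) ^ (M - s + (w - 1)) := by
  rw [integral_pow_mul_one_sub_pow, betaWt]
  congr 1 <;> omega

/-- The ratio of consecutive beta weights. -/
noncomputable def betaRatio (M c w s : ℕ) : ℝ := ((s : ℝ) + c) / ((M : ℝ) - 1 - s + w)

theorem betaWt_succ {M c w s : ℕ} (hc : 0 < c) (hw : 0 < w) (hs : s + 1 ≤ M) :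
    betaWt M c w (s + 1) = betaRatio M c w s * betaWt M c w s := by
  obtain ⟨m, rfl⟩ := Nat.exists_eq_add_of_le hs
  obtain ⟨c, rfl⟩ := Nat.exists_eq_add_of_le' hc
  obtain ⟨w, rfl⟩ := Nat.exists_eq_add_of_le' hw
  unfold betaWt betaRatio betaFn
  rw [show s + 1 + m - (s + 1) = m by omega, show s + 1 + m - s = m + 1 by omega,
    show s + 1 + (c + 1) - 1 = s + c + 1 by omega, show m + (w + 1) - 1 = m + w by omega,
    show s + (c + 1) - 1 = s + c by omega, show m + 1 + (w + 1) - 1 = m + w + 1 by omega,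
    show s + 1 + (c + 1) + (m + (w + 1)) = s + (c + 1) + (m + 1 + (w + 1)) by omega,
    Nat.factorial_succ, Nat.factorial_succ]
  push_cast
  have h1 : (s : ℝ) + 1 + m - 1 - s + (w + 1) = m + w + 1 := by ring
  rw [h1]
  have : (m : ℝ) + w + 1 ≠ 0 := by positivity
  field_simp
  ring

theorem betaWt_succ_left {M c w s : ℕ} (hc : 0 < c) :
    betaWt M (c + 1) w s = betaWt M c w s * ((s + c) / (s + (M - s : ℕ) + c + w)) := by
  obtain ⟨c, rfl⟩ := Nat.exists_eq_add_of_le' hc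
  unfold betaWt betaFn
  rw [show s + (c + 1 + 1) - 1 = s + c + 1 by omega, show s + (c + 1) - 1 = s + c by omega,
    show s + (c + 1 + 1) + (M - s + w) - 1 = s + (c + 1) + (M - s + w) - 1 + 1 by omega,
    Nat.factorial_succ, Nat.factorial_succ]
  generalize hr : M - s = r
  have h2 : ((s + (c + 1) + (r + w) - 1 : ℕ) : ℝ) = s + c + r + w := by
    rw [show s + (c + 1) + (r + w) - 1 = s + c + r + w by omega]; push_cast; ring
  push_cast
  rw [h2]
  have h3 : (s : ℝ) + r + (c + 1) + w = s + c + r + w + 1 := by ring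
  rw [h3]
  field_simp
  ring

theorem betaWt_compl {M s : ℕ} (hs : s ≤ M) (c w : ℕ) :
    betaWt M c w (M - s) = betaWt M w c s := by
  unfold betaWt betaFn
  rw [show M - (M - s) = s by omega, show M - s + c + (s + w) = s + w + (M - s + c) by omega,
    mul_comm]

/-- The factor by which complementing the agreements changes the beta weight. -/
noncomputable def complRatio (M c w s : ℕ) : ℝ := betaWt M c w (M - s) / betaWt M c w s

theorem complRatio_pos (M c w s : ℕ) : 0 < complRatio M c w s :=
  div_pos (betaWt_pos _ _ _ _) (betaWt_pos _ _ _ _)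

theorem complRatio_self {M s : ℕ} (hs : s ≤ M) (w : ℕ) : complRatio M w w s = 1 := by
  unfold complRatio
  rw [betaWt_compl hs, div_self (betaWt_pos _ _ _ _).ne']

theorem complRatio_symm {M s : ℕ} (hs : s ≤ M) (c w : ℕ) :
    complRatio M c w s = (complRatio M w c s)⁻¹ := by
  unfold complRatio
  rw [betaWt_compl hs, betaWt_compl hs, inv_div]

theorem complRatio_succ_left {M s : ℕ} (hs : s ≤ M) {c : ℕ} (hc : 0 < c) (w : ℕ) :
    complRatio M (c + 1) w s = complRatio M c w s * (((M : ℝ) - s + c) / (s + c)) := by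
  unfold complRatio
  rw [betaWt_succ_left hc, betaWt_succ_left hc, show M - (M - s) = s by omega, Nat.cast_sub hs]
  have h1 := (betaWt_pos M c w s).ne'
  have h2 : (0 : ℝ) < s + c := by positivity
  have h3 : (0 : ℝ) ≤ M - s := by rw [sub_nonneg]; exact_mod_cast hs
  have h4 : (0 : ℝ) < M - s + s + c + w := by positivity
  have h5 : (s : ℝ) + (M - s) + c + w = M - s + s + c + w := by ring
  rw [h5]
  field_simp

/-- For equal pseudo-counts complementation is a symmetry and the ratio is one. Raising `c` from `w`
one unit at a time multiplies it by factors in `[K⁻¹, K]`. -/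
theorem complRatio_mem {M s : ℕ} (hs : s ≤ M) {w : ℕ} (hw : 0 < w) {K : ℝ} (hK : 1 ≤ K)
    (h1 : ∀ d : ℕ, ((M : ℝ) - s + (w + d)) / (s + (w + d)) ≤ K)
    (h2 : ∀ d : ℕ, K⁻¹ ≤ ((M : ℝ) - s + (w + d)) / (s + (w + d))) (d : ℕ) :
    (K ^ d)⁻¹ ≤ complRatio M (w + d) w s ∧ complRatio M (w + d) w s ≤ K ^ d := by
  induction d with
  | zero => simp [complRatio_self hs]
  | succ d ih =>
    rw [← add_assoc, complRatio_succ_left hs (by omega)]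
    have e1 := h1 d
    have e2 := h2 d
    push_cast
    have hK0 : 0 < K := by linarith
    constructor
    · rw [pow_succ, mul_inv]
      exact mul_le_mul ih.1 e2 (by positivity) (complRatio_pos _ _ _ _).le
    · rw [pow_succ]
      exact mul_le_mul ih.2 e1 (le_trans (by positivity) e2) (by positivity)

/-- Complementation changes the beta weight by a bounded factor, away from the ends. -/
theorem complRatio_le {M s A : ℕ} {η : ℝ} (hη : 0 < η) (hη1 : η ≤ 1)
    (hs0 : η / 2 * M ≤ s) (hs1 : (s : ℝ) ≤ (1 - η / 2) * M) (hM : 0 < M) {c w : ℕ} (hc : 0 < c)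
    (hw : 0 < w) (hcA : c ≤ A) (hwA : w ≤ A) :
    complRatio M c w s ≤ (4 / η) ^ A := by
  have hMr : (0 : ℝ) < M := by exact_mod_cast hM
  have hsM : s ≤ M := by
    have : (s : ℝ) ≤ M := hs1.trans (by nlinarith)
    exact_mod_cast this
  have hK : 1 ≤ 4 / η := by rw [le_div_iff₀ hη]; linarith
  have hηM : 0 < η / 2 * M := by positivity
  have ht : ∀ t : ℝ, 0 ≤ t → ((M : ℝ) - s + t) / (s + t) ≤ 4 / η := by
    intro t ht
    rw [div_le_div_iff₀ (by linarith) hη]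
    nlinarith
  have ht' : ∀ t : ℝ, 0 ≤ t → (4 / η)⁻¹ ≤ ((M : ℝ) - s + t) / (s + t) := by
    intro t ht
    rw [inv_div, div_le_div_iff₀ (by positivity) (by linarith)]
    nlinarith
  rcases le_total w c with h | h
  · obtain ⟨d, rfl⟩ := Nat.exists_eq_add_of_le h
    exact (complRatio_mem hsM hw hK (fun d => ht _ (by positivity))
      (fun d => ht' _ (by positivity)) d).2.trans (pow_le_pow_right₀ hK (by omega))
  · obtain ⟨d, rfl⟩ := Nat.exists_eq_add_of_le h
    rw [complRatio_symm hsM]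
    have := (complRatio_mem hsM hc hK (fun d => ht _ (by positivity))
      (fun d => ht' _ (by positivity)) d).1
    exact (inv_le_of_inv_le₀ (by positivity) this).trans
      (pow_le_pow_right₀ hK (by omega))

/-- For an informative source, complementation makes the beta weight smaller. -/
theorem complRatio_le_of_lt {M s : ℕ} (hs : s ≤ M) {c w : ℕ} (hw : 0 < w) (hwc : w < c) {r : ℝ}
    (h0 : (M : ℝ) ≤ 2 * s) (h1 : ((M : ℝ) - s + w) / (s + w) ≤ r) :
    complRatio M c w s ≤ r := by
  obtain ⟨d, rfl⟩ := Nat.exists_eq_add_of_lt hwc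
  induction d with
  | zero =>
    rw [add_zero, complRatio_succ_left hs hw, complRatio_self hs, one_mul]
    exact h1
  | succ d ih =>
    rw [show w + (d + 1) + 1 = (w + d + 1) + 1 by ring, complRatio_succ_left hs (by omega)]
    -- The first unit of `c - w` already gives `r`. Further units only shrink the ratio, because the
    -- agreements are a majority.
    refine (mul_le_of_le_one_right (complRatio_pos _ _ _ _).le ?_).trans (ih (by omega))
    rw [div_le_one (by positivity)]
    linarith

/-- A binomial probability is at most one, and the beta weight is an inverse binomial coefficient up
to a polynomial factor. Any Bernoulli law is thus dominated by the beta mixture at polynomial cost.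
-/
theorem pow_mul_pow_le_betaWt {M c w A s : ℕ} (hs : s ≤ M) (hc : 0 < c) (hw : 0 < w) (hcA : c ≤ A)
    (hwA : w ≤ A) {p : ℝ} (h0 : 0 ≤ p) (h1 : p ≤ 1) :
    p ^ s * (1 - p) ^ (M - s) ≤ ((M : ℝ) + 2 * A) ^ (2 * A) * betaWt M c w s := by
  have hbin : (M.choose s : ℝ) * (p ^ s * (1 - p) ^ (M - s)) ≤ 1 := by
    have h := add_pow p (1 - p) M
    rw [add_sub_cancel, one_pow] at h
    refine le_trans ?_ h.ge
    refine le_trans (le_of_eq (by ring)) (single_le_sum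
      (f := fun m => p ^ m * (1 - p) ^ (M - m) * (M.choose m : ℝ)) (fun m _ => ?_)
      (mem_range.2 (by omega : s < M + 1)))
    have : 0 ≤ 1 - p := by linarith
    positivity
  have hfac : ((s + c + (M - s + w) - 1)! : ℝ) ≤ (M ! : ℝ) * ((M : ℝ) + 2 * A) ^ (2 * A) := by
    have h2 : s + c + (M - s + w) - 1 = M + (c + w - 1) := by omega
    have h3 := Nat.factorial_mul_ascFactorial M (c + w - 1)
    have h4 : (M + 1).ascFactorial (c + w - 1) ≤ (M + 2 * A) ^ (2 * A) := by
      refine (Nat.ascFactorial_le_pow_add M (c + w - 1)).trans ?_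
      refine (Nat.pow_le_pow_left (by omega) _).trans (Nat.pow_le_pow_right ?_ ?_) <;> omega
    rw [h2, ← h3]
    push_cast
    exact mul_le_mul_of_nonneg_left (by exact_mod_cast h4) (by positivity)
  have hbeta : (s ! : ℝ) * (M - s)! ≤ M ! * (((M : ℝ) + 2 * A) ^ (2 * A) * betaWt M c w s) := by
    unfold betaWt betaFn
    have e1 : (s ! : ℝ) ≤ (s + c - 1)! := by exact_mod_cast Nat.factorial_le (by omega)
    have e2 : ((M - s)! : ℝ) ≤ (M - s + w - 1)! := by exact_mod_cast Nat.factorial_le (by omega)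
    have e3 := mul_le_mul e1 e2 (by positivity) (by positivity)
    rw [← mul_assoc, ← mul_div_assoc, le_div_iff₀ (by positivity)]
    calc _ ≤ ((s + c - 1)! * (M - s + w - 1)! : ℝ) * (M ! * ((M : ℝ) + 2 * A) ^ (2 * A)) :=
          mul_le_mul e3 hfac (by positivity) (by positivity)
      _ = _ := by ring
  have hch : (M.choose s : ℝ) * (s ! * (M - s)!) = M ! := by
    rw [← mul_assoc]; exact_mod_cast Nat.choose_mul_factorial_mul_factorial hs
  set X := ((M : ℝ) + 2 * A) ^ (2 * A) * betaWt M c w s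
  have hpos : (0 : ℝ) < M ! := by positivity
  have hs0 : (0 : ℝ) < s ! * (M - s)! := by positivity
  have h5 : (M ! : ℝ) * (p ^ s * (1 - p) ^ (M - s)) ≤ s ! * (M - s)! := by
    rw [← hch]
    have := mul_le_mul_of_nonneg_left hbin hs0.le
    linarith
  exact le_of_mul_le_mul_left (h5.trans hbeta) hpos

end Beta


/-! ### Truncation and Lipschitz estimates -/

section Clamp

/-- Truncation of a natural number to the interval `[lo, hi]`. -/
def clampNat (lo hi l : ℕ) : ℕ := max lo (min l hi)

theorem clampNat_of_mem {lo hi l : ℕ} (h1 : lo ≤ l) (h2 : l ≤ hi) : clampNat lo hi l = l := by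
  unfold clampNat; omega

theorem le_clampNat (lo hi l : ℕ) : lo ≤ clampNat lo hi l := le_max_left _ _

theorem clampNat_le {lo hi : ℕ} (h : lo ≤ hi) (l : ℕ) : clampNat lo hi l ≤ hi := by
  unfold clampNat; omega

theorem abs_clampNat_sub_le (lo hi l l' : ℕ) :
    |(clampNat lo hi l : ℝ) - clampNat lo hi l'| ≤ |(l : ℝ) - l'| := by
  unfold clampNat
  push_cast
  refine (abs_max_sub_max_le_max _ _ _ _).trans ?_
  rw [sub_self, abs_zero]
  refine max_le (abs_nonneg _) ((abs_min_sub_min_le_max _ _ _ _).trans ?_)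
  rw [sub_self, abs_zero]
  exact max_le le_rfl (abs_nonneg _)

theorem abs_sub_le_of_step {f : ℕ → ℝ} {κ : ℝ} (h : ∀ n, |f (n + 1) - f n| ≤ κ) (l l' : ℕ) :
    |f l - f l'| ≤ κ * |(l : ℝ) - l'| := by
  have key : ∀ m d : ℕ, |f (m + d) - f m| ≤ κ * d := by
    intro m d
    induction d with
    | zero => simp
    | succ d ih =>
      have e : f (m + (d + 1)) - f m = (f (m + d + 1) - f (m + d)) + (f (m + d) - f m) := by
        rw [← add_assoc]; ring
      rw [e]
      refine (abs_add_le _ _).trans ?_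
      have := h (m + d)
      push_cast
      linarith
  rcases le_total l' l with hl | hl
  · obtain ⟨d, rfl⟩ := Nat.exists_eq_add_of_le hl
    have := key l' d
    push_cast
    rwa [add_sub_cancel_left, Nat.abs_cast]
  · obtain ⟨d, rfl⟩ := Nat.exists_eq_add_of_le hl
    have := key l d
    push_cast
    rwa [abs_sub_comm, abs_sub_comm (l : ℝ), add_sub_cancel_left, Nat.abs_cast]

theorem abs_log_sub_log_le {m x y : ℝ} (hm : 0 < m) (hx : m ≤ x) (hy : m ≤ y) :
    |Real.log x - Real.log y| ≤ |x - y| / m := by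
  have key : ∀ {x y : ℝ}, m ≤ x → m ≤ y → Real.log x - Real.log y ≤ |x - y| / m := by
    intro x y hx hy
    have hx0 : 0 < x := hm.trans_le hx
    have hy0 : 0 < y := hm.trans_le hy
    rw [← Real.log_div hx0.ne' hy0.ne']
    refine (Real.log_le_sub_one_of_pos (div_pos hx0 hy0)).trans ?_
    have : x / y - 1 = (x - y) / y := by field_simp
    rw [this]
    exact (div_le_div_of_nonneg_right (le_abs_self _) hy0.le).trans
      (div_le_div_of_nonneg_left (abs_nonneg _) hm hy)
  rw [abs_le]
  have h1 := key hx hy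
  have h2 := key hy hx
  rw [abs_sub_comm] at h2
  constructor <;> linarith

end Clamp

/-! ### Frozen potentials of one source -/

section Source

/-- The standing assumptions on one source: pseudo-counts between `1` and `A`, accuracy in
`[η, 1 - η]`, and many tasks. -/
structure Admissible (c w A M : ℕ) (p η : ℝ) : Prop where
  η_pos : 0 < η
  η_le : η ≤ 1 / 4
  c_pos : 0 < c
  w_pos : 0 < w
  c_le : c ≤ A
  w_le : w ≤ A
  p_ge : η ≤ p
  p_le : p ≤ 1 - η
  A_le : (A : ℝ) ≤ η ^ 3 / 32 * M

/-- Lower end of the window of typical agreements. -/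
noncomputable def winLo (M : ℕ) (p η : ℝ) : ℕ := ⌈(p - 3 * (η ^ 3 / 32)) * M⌉₊

/-- Upper end of the window of typical agreements. -/
noncomputable def winHi (M : ℕ) (p η : ℝ) : ℕ := ⌊(p + 3 * (η ^ 3 / 32)) * M⌋₊

/-- Truncation to the window of typical agreements. -/
noncomputable def win (M : ℕ) (p η : ℝ) (l : ℕ) : ℕ := clampNat (winLo M p η) (winHi M p η) l

/-- The log beta weight, with increments frozen outside the window. -/
noncomputable def logPot (M c w : ℕ) (p η : ℝ) (l : ℕ) : ℝ :=
  ∑ t ∈ range l, Real.log (betaRatio M c w (win M p η t))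

/-- The log complementation factor, frozen outside the window. -/
noncomputable def complPot (M c w : ℕ) (p η : ℝ) (l : ℕ) : ℝ :=
  Real.log (complRatio M c w (win M p η l))

namespace Admissible

variable {c w A M : ℕ} {p η : ℝ}

theorem one_le_A (h : Admissible c w A M p η) : 1 ≤ A := h.c_pos.trans_le h.c_le

theorem M_pos (h : Admissible c w A M p η) : (0 : ℝ) < M := by
  have h1 : (1 : ℝ) ≤ A := by exact_mod_cast h.one_le_A
  have h2 := h.A_le
  have h3 := h.η_pos
  by_contra hM
  have : η ^ 3 / 32 * M ≤ 0 := mul_nonpos_of_nonneg_of_nonpos (by positivity) (not_lt.1 hM)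
  linarith

theorem cube_le (h : Admissible c w A M p η) : η ^ 3 / 32 ≤ η / 512 := by
  have h1 := h.η_pos
  have h2 := h.η_le
  nlinarith [sq_nonneg η, mul_le_mul h2 h2 h1.le (by norm_num)]

theorem one_le (h : Admissible c w A M p η) : 1 ≤ η ^ 3 / 32 * M := by
  have h1 : (1 : ℝ) ≤ A := by exact_mod_cast h.one_le_A
  linarith [h.A_le]

theorem _root_.Crowd.winLo_ge (M : ℕ) (p η : ℝ) : (p - 3 * (η ^ 3 / 32)) * M ≤ winLo M p η :=
  Nat.le_ceil _

theorem winHi_le (h : Admissible c w A M p η) : (winHi M p η : ℝ) ≤ (p + 3 * (η ^ 3 / 32)) * M :=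
  Nat.floor_le (mul_nonneg (by
    have := h.p_ge
    have h0 := h.η_pos
    have : 0 < η ^ 3 / 32 := by positivity
    linarith) h.M_pos.le)

theorem winLo_le_winHi (h : Admissible c w A M p η) : winLo M p η ≤ winHi M p η := by
  have h1 : (winLo M p η : ℝ) < (p - 3 * (η ^ 3 / 32)) * M + 1 := Nat.ceil_lt_add_one
    (mul_nonneg (by linarith [h.cube_le, h.p_ge, h.η_pos]) h.M_pos.le)
  have h2 : (p + 3 * (η ^ 3 / 32)) * M < winHi M p η + 1 := Nat.lt_floor_add_one _
  have h3 := h.one_le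
  have h4 : (winLo M p η : ℝ) < winHi M p η + 1 := by nlinarith
  have h5 : winLo M p η < winHi M p η + 1 := by exact_mod_cast h4
  omega

theorem _root_.Crowd.win_ge (M : ℕ) (p η : ℝ) (l : ℕ) :
    (p - 3 * (η ^ 3 / 32)) * M ≤ win M p η l :=
  (Crowd.winLo_ge M p η).trans (by exact_mod_cast le_clampNat _ _ _)

theorem win_le (h : Admissible c w A M p η) (l : ℕ) :
    (win M p η l : ℝ) ≤ (p + 3 * (η ^ 3 / 32)) * M :=
  le_trans (by exact_mod_cast clampNat_le h.winLo_le_winHi l) h.winHi_le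

theorem win_ge' (h : Admissible c w A M p η) (l : ℕ) : η / 2 * M ≤ win M p η l :=
  (mul_le_mul_of_nonneg_right (by linarith [h.cube_le, h.p_ge, h.η_pos]) h.M_pos.le).trans
    (Crowd.win_ge M p η l)

theorem win_le' (h : Admissible c w A M p η) (l : ℕ) : (win M p η l : ℝ) ≤ (1 - η / 2) * M :=
  (h.win_le l).trans
    (mul_le_mul_of_nonneg_right (by linarith [h.cube_le, h.p_le, h.η_pos]) h.M_pos.le)

theorem win_le_M (h : Admissible c w A M p η) (l : ℕ) : win M p η l ≤ M := by
  have h1 : (win M p η l : ℝ) ≤ M := (h.win_le' l).trans (by nlinarith [h.η_pos, h.M_pos])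
  exact_mod_cast h1

theorem win_succ_le_M (h : Admissible c w A M p η) (l : ℕ) : win M p η l + 1 ≤ M := by
  have h0 := h.one_le
  have h1 : (win M p η l : ℝ) + 1 ≤ M := by
    have := h.win_le' l
    nlinarith [h.cube_le, h.M_pos]
  exact_mod_cast h1

theorem log_betaRatio {c w s : ℕ} {M : ℕ} (h1 : (0 : ℝ) < (s : ℝ) + c)
    (h2 : (0 : ℝ) < (M : ℝ) - 1 - s + w) : Real.log (betaRatio M c w s) =
      Real.log ((s : ℝ) + c) - Real.log ((M : ℝ) - 1 - s + w) :=
  Real.log_div h1.ne' h2.ne'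

theorem c_ge (h : Admissible c w A M p η) : (1 : ℝ) ≤ c := by exact_mod_cast h.c_pos

theorem w_ge (h : Admissible c w A M p η) : (1 : ℝ) ≤ w := by exact_mod_cast h.w_pos

theorem half_pos (h : Admissible c w A M p η) : 0 < η / 2 * M := by
  have := h.η_pos; have := h.M_pos; positivity

/-- Inside the window both counts are at least `η * M / 2`, where the logarithm has slope `O(1/M)`.
The extra factor `A` is slack, so that one constant also serves `complPot`. -/
theorem abs_log_betaRatio_sub_le (h : Admissible c w A M p η) (l l' : ℕ) :
    |Real.log (betaRatio M c w (win M p η l)) - Real.log (betaRatio M c w (win M p η l'))| ≤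
      4 * A / (η * M) * |(l : ℝ) - l'| := by
  have hm := h.half_pos
  have a1 : ∀ l, η / 2 * M ≤ (win M p η l : ℝ) + c := fun l => by linarith [h.win_ge' l, h.c_ge]
  have a2 : ∀ l, η / 2 * M ≤ (M : ℝ) - 1 - win M p η l + w := fun l => by
    linarith [h.win_le' l, h.w_ge]
  rw [log_betaRatio (hm.trans_le (a1 l)) (hm.trans_le (a2 l)),
    log_betaRatio (hm.trans_le (a1 l')) (hm.trans_le (a2 l'))]
  have e1 := abs_log_sub_log_le hm (a1 l) (a1 l')
  have e2 := abs_log_sub_log_le hm (a2 l) (a2 l')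
  rw [add_sub_add_right_eq_sub] at e1
  rw [show (M : ℝ) - 1 - win M p η l + w - ((M : ℝ) - 1 - win M p η l' + w) =
    -((win M p η l : ℝ) - win M p η l') by ring, abs_neg] at e2
  have e3 : |(win M p η l : ℝ) - win M p η l'| / (η / 2 * M) ≤ |(l : ℝ) - l'| / (η / 2 * M) :=
    div_le_div_of_nonneg_right (abs_clampNat_sub_le _ _ _ _) hm.le
  have hA : (1 : ℝ) ≤ A := by exact_mod_cast h.one_le_A
  have e4 : 4 * A / (η * M) * |(l : ℝ) - l'| = A * (2 * (|(l : ℝ) - l'| / (η / 2 * M))) := by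
    have := h.η_pos; have := h.M_pos
    field_simp
    ring
  have e5 : 0 ≤ 2 * (|(l : ℝ) - l'| / (η / 2 * M)) := by positivity
  have e6 := le_mul_of_one_le_left e5 hA
  rw [e4]
  have f1 := abs_le.1 e1
  have f2 := abs_le.1 e2
  rw [abs_le]
  constructor <;> linarith [f1.1, f1.2, f2.1, f2.2]

theorem logPot_step (l : ℕ) : logPot M c w p η (l + 1) - logPot M c w p η l =
    Real.log (betaRatio M c w (win M p η l)) := by
  unfold logPot
  rw [sum_range_succ]
  ring

theorem abs_logPot_step_sub_le (h : Admissible c w A M p η) (l l' : ℕ) :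
    |(logPot M c w p η (l + 1) - logPot M c w p η l) -
      (logPot M c w p η (l' + 1) - logPot M c w p η l')| ≤ 4 * A / (η * M) * |(l : ℝ) - l'| := by
  rw [logPot_step, logPot_step]
  exact h.abs_log_betaRatio_sub_le l l'

theorem betaRatio_pos (h : Admissible c w A M p η) (l : ℕ) :
    0 < betaRatio M c w (win M p η l) := by
  unfold betaRatio
  have hm := h.half_pos
  exact div_pos (by linarith [h.win_ge' l, h.c_ge]) (by linarith [h.win_le' l, h.w_ge])

theorem A_le_M (h : Admissible c w A M p η) : (A : ℝ) ≤ M := by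
  have := h.cube_le
  have := h.η_le
  have := h.A_le
  nlinarith [h.M_pos]

theorem betaRatio_le (h : Admissible c w A M p η) (l : ℕ) :
    betaRatio M c w (win M p η l) ≤ 4 / η := by
  unfold betaRatio
  have hm := h.half_pos
  have hc : (c : ℝ) ≤ A := by exact_mod_cast h.c_le
  have hs : (win M p η l : ℝ) ≤ M := by exact_mod_cast h.win_le_M l
  rw [div_le_div_iff₀ (by linarith [h.win_le' l, h.w_ge]) h.η_pos]
  nlinarith [h.win_le' l, h.w_ge, h.A_le_M, h.η_pos]

theorem le_betaRatio (h : Admissible c w A M p η) (l : ℕ) :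
    η / 4 ≤ betaRatio M c w (win M p η l) := by
  unfold betaRatio
  have hm := h.half_pos
  have hc : (w : ℝ) ≤ A := by exact_mod_cast h.w_le
  rw [div_le_div_iff₀ (by norm_num) (by linarith [h.win_le' l, h.w_ge])]
  nlinarith [h.win_ge' l, h.c_ge, h.A_le_M, h.η_pos]

theorem abs_log_betaRatio_le (h : Admissible c w A M p η) (l : ℕ) :
    |Real.log (betaRatio M c w (win M p η l))| ≤ Real.log (4 / η) := by
  have hη := h.η_pos
  rw [abs_le]
  constructor
  · rw [← Real.log_inv, inv_div]
    exact Real.log_le_log (by positivity) (h.le_betaRatio l)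
  · exact Real.log_le_log (h.betaRatio_pos l) (h.betaRatio_le l)

/-- One step changes the log ratio by minus the log beta ratios at `s` and at `M - 1 - s`. These are
opposite up to replacing `c` by `w`, so only `|c - w| ≤ A` remains, relative to counts of order `η *
M`. -/
theorem abs_complPot_step_le (h : Admissible c w A M p η) (l : ℕ) :
    |complPot M c w p η (l + 1) - complPot M c w p η l| ≤ 4 * A / (η * M) := by
  have hη := h.η_pos
  have hM := h.M_pos
  have hm := h.half_pos
  have hwin : win M p η (l + 1) = win M p η l ∨ win M p η (l + 1) = win M p η l + 1 := by
    unfold win clampNat; omega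
  unfold complPot
  rcases hwin with e | e
  · rw [e, sub_self, abs_zero]; positivity
  · have hlo := h.win_ge' l
    have hhi := h.win_le' (l + 1)
    have hsM := h.win_le_M (l + 1)
    rw [e] at hhi hsM ⊢
    set s := win M p η l
    push_cast at hhi
    obtain ⟨r, hr⟩ := Nat.exists_eq_add_of_le hsM
    have hrM : (M : ℝ) = s + 1 + r := by exact_mod_cast hr
    unfold complRatio
    have e1 : M - (s + 1) = r := by omega
    have e2 : M - s = r + 1 := by omega
    rw [e1, e2, betaWt_succ h.c_pos h.w_pos hsM, betaWt_succ h.c_pos h.w_pos (by omega)]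
    have b1 := betaWt_pos M c w s
    have b2 := betaWt_pos M c w r
    have hc := h.c_ge
    have hw := h.w_ge
    have q1 : (0 : ℝ) < s + c := by positivity
    have q2 : (0 : ℝ) < (M : ℝ) - 1 - s + w := by rw [hrM]; linarith [(Nat.cast_nonneg r : (0 : ℝ) ≤ r)]
    have q3 : (0 : ℝ) < r + c := by positivity
    have q4 : (0 : ℝ) < (M : ℝ) - 1 - r + w := by rw [hrM]; linarith [(Nat.cast_nonneg s : (0 : ℝ) ≤ s)]
    have r1 : 0 < betaRatio M c w s := div_pos q1 q2
    have r2 : 0 < betaRatio M c w r := div_pos q3 q4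
    rw [Real.log_div b2.ne' (by positivity), Real.log_div (by positivity) b1.ne',
      Real.log_mul r1.ne' b1.ne', Real.log_mul r2.ne' b2.ne', log_betaRatio q1 q2,
      log_betaRatio q3 q4]
    have hcw : |(c : ℝ) - w| ≤ A := by
      have hcA : (c : ℝ) ≤ A := by exact_mod_cast h.c_le
      have hwA : (w : ℝ) ≤ A := by exact_mod_cast h.w_le
      rw [abs_le]; constructor <;> linarith
    have d1 := abs_log_sub_log_le hm (x := (s : ℝ) + c) (y := (M : ℝ) - 1 - r + w)
      (by linarith) (by linarith)
    have d2 := abs_log_sub_log_le hm (x := (r : ℝ) + c) (y := (M : ℝ) - 1 - s + w)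
      (by linarith) (by linarith)
    rw [show (s : ℝ) + c - ((M : ℝ) - 1 - r + w) = c - w by rw [hrM]; ring] at d1
    rw [show (r : ℝ) + c - ((M : ℝ) - 1 - s + w) = c - w by rw [hrM]; ring] at d2
    have d3 : |(c : ℝ) - w| / (η / 2 * M) ≤ A / (η / 2 * M) :=
      div_le_div_of_nonneg_right hcw hm.le
    have d4 : 4 * A / (η * M) = 2 * (A / (η / 2 * M)) := by field_simp; ring
    rw [d4]
    have f1 := abs_le.1 d1
    have f2 := abs_le.1 d2
    rw [abs_le]
    constructor <;> linarith [f1.1, f1.2, f2.1, f2.2]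

theorem abs_complPot_sub_le (h : Admissible c w A M p η) (l l' : ℕ) :
    |complPot M c w p η l - complPot M c w p η l'| ≤ 4 * A / (η * M) * |(l : ℝ) - l'| :=
  abs_sub_le_of_step h.abs_complPot_step_le l l'

theorem exp_complPot (l : ℕ) :
    Real.exp (complPot M c w p η l) = complRatio M c w (win M p η l) :=
  Real.exp_log (complRatio_pos _ _ _ _)

theorem exp_complPot_le (h : Admissible c w A M p η) (l : ℕ) :
    Real.exp (complPot M c w p η l) ≤ (4 / η) ^ A := by
  rw [exp_complPot]
  exact complRatio_le h.η_pos (by linarith [h.η_le]) (h.win_ge' l) (h.win_le' l)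
    (by exact_mod_cast h.M_pos) h.c_pos h.w_pos h.c_le h.w_le

/-- Here the asymmetry of the accuracy prior enters: a source with a clear majority of correct
labels penalises the complement by a constant factor. -/
theorem exp_complPot_le_of_lt (h : Admissible c w A M p η) (hwc : w < c) (hp : 1 / 2 + η ≤ p)
    (l : ℕ) : Real.exp (complPot M c w p η l) ≤ 1 - η := by
  rw [exp_complPot]
  have hη := h.η_pos
  have hη4 := h.η_le
  have hM := h.M_pos
  have hs : (1 / 2 + η / 2) * M ≤ win M p η l :=
    (mul_le_mul_of_nonneg_right (by linarith [h.cube_le]) hM.le).trans (Crowd.win_ge M p η l)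
  have hwA : (w : ℝ) ≤ A := by exact_mod_cast h.w_le
  have hw := h.w_ge
  refine complRatio_le_of_lt (h.win_le_M l) h.w_pos hwc (by nlinarith) ?_
  rw [div_le_iff₀ (by nlinarith)]
  have h1 := h.A_le
  have h2 : η ^ 3 / 32 * M ≤ η * (1 - η) / 2 * M :=
    mul_le_mul_of_nonneg_right (by nlinarith [h.cube_le]) hM.le
  nlinarith

/-- On the window, the frozen potential is the log beta weight. -/
theorem betaWt_eq_exp_logPot (h : Admissible c w A M p η) {l : ℕ} (h1 : winLo M p η ≤ l)
    (h2 : l ≤ winHi M p η) : betaWt M c w l =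
      betaWt M c w (winLo M p η) / Real.exp (logPot M c w p η (winLo M p η)) *
        Real.exp (logPot M c w p η l) := by
  obtain ⟨d, rfl⟩ := Nat.exists_eq_add_of_le h1
  induction d with
  | zero => rw [add_zero, div_mul_cancel₀ _ (Real.exp_pos _).ne']
  | succ d ih =>
    have hwin : win M p η (winLo M p η + d) = winLo M p η + d :=
      clampNat_of_mem (by omega) (by omega)
    have hM := h.win_succ_le_M (winLo M p η + d)
    have hr := h.betaRatio_pos (winLo M p η + d)
    have hst := logPot_step (M := M) (c := c) (w := w) (p := p) (η := η) (winLo M p η + d)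
    rw [hwin] at hM hr hst
    rw [← add_assoc, betaWt_succ h.c_pos h.w_pos hM, ih (by omega) (by omega),
      ← sub_add_cancel (logPot M c w p η (winLo M p η + d + 1)) (logPot M c w p η (winLo M p η + d)),
      hst, Real.exp_add, Real.exp_log hr]
    ring

/-- On the window, the frozen factor is the complementation factor. -/
theorem betaWt_compl_eq {l : ℕ} (h1 : winLo M p η ≤ l)
    (h2 : l ≤ winHi M p η) :
    betaWt M c w (M - l) = betaWt M c w l * Real.exp (complPot M c w p η l) := by
  rw [exp_complPot, show win M p η l = l from clampNat_of_mem h1 h2, complRatio,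
    mul_div_cancel₀ _ (betaWt_pos _ _ _ _).ne']

theorem mem_win {l : ℕ}
    (hl : |(l : ℝ) - p * M| ≤ 3 * (η ^ 3 / 32) * M) :
    winLo M p η ≤ l ∧ l ≤ winHi M p η := by
  obtain ⟨h1, h2⟩ := abs_le.1 hl
  constructor
  · exact Nat.ceil_le.2 (by linarith)
  · exact Nat.le_floor (by linarith)

end Admissible

/-- Bound on the square root of the odds with which one source contributes to an error. -/
noncomputable def errFactor (p η : ℝ) (b : Bool) : ℝ :=
  if b then Real.sqrt ((1 - p + 4 * (η ^ 3 / 32)) / (p - 4 * (η ^ 3 / 32)))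
  else Real.sqrt ((p + 4 * (η ^ 3 / 32)) / (1 - p - 4 * (η ^ 3 / 32)))

theorem errFactor_nonneg (p η : ℝ) (b : Bool) : 0 ≤ errFactor p η b := by
  unfold errFactor; split_ifs <;> exact Real.sqrt_nonneg _

namespace Admissible

variable {c w A M : ℕ} {p η : ℝ}

/-- The window has half-width `3 * (η ^ 3 / 32) * M`. The fourth unit in `errFactor` absorbs the
pseudo-counts, which are at most `A ≤ η ^ 3 / 32 * M`. -/
theorem exp_neg_sgn_le (h : Admissible c w A M p η) (b : Bool) (l : ℕ) :
    Real.exp (-(sgn b * (logPot M c w p η (l + 1) - logPot M c w p η l))) ≤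
      errFactor p η b ^ 2 := by
  have hη := h.η_pos
  have hM := h.M_pos
  have hc3 := h.cube_le
  have hp0 := h.p_ge
  have hp1 := h.p_le
  have hA := h.A_le
  have hcA : (c : ℝ) ≤ A := by exact_mod_cast h.c_le
  have hwA : (w : ℝ) ≤ A := by exact_mod_cast h.w_le
  have hc1 := h.c_ge
  have hw1 := h.w_ge
  have hge := Crowd.win_ge M p η l
  have hle := h.win_le l
  have hr := h.betaRatio_pos l
  have hge' := h.win_ge' l
  have hle' := h.win_le' l
  have hm := h.half_pos
  rw [logPot_step]
  set ε := η ^ 3 / 32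
  have hε : 0 < ε := by positivity
  have ha : 0 < p - 4 * ε := by linarith
  have ha' : 0 < 1 - p - 4 * ε := by linarith
  unfold betaRatio at *
  cases b
  · simp only [sgn, errFactor, Bool.false_eq_true, if_false, neg_mul, one_mul, neg_neg]
    change _ ≤ Real.sqrt ((p + 4 * ε) / (1 - p - 4 * ε)) ^ 2
    rw [Real.exp_log hr, Real.sq_sqrt (div_nonneg (by linarith) ha'.le),
      div_le_div_iff₀ (by linarith) ha']
    set s : ℝ := (win M p η l : ℝ)
    have e1 : s + c ≤ (p + 4 * ε) * M := by linarith
    have e2 : (1 - p - 4 * ε) * M ≤ M - 1 - s + w := by nlinarith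
    calc (s + c) * (1 - p - 4 * ε) ≤ (p + 4 * ε) * M * (1 - p - 4 * ε) :=
          mul_le_mul_of_nonneg_right e1 ha'.le
      _ = (p + 4 * ε) * ((1 - p - 4 * ε) * M) := by ring
      _ ≤ _ := mul_le_mul_of_nonneg_left e2 (by linarith)
  · simp only [sgn, errFactor, if_true, one_mul]
    change _ ≤ Real.sqrt ((1 - p + 4 * ε) / (p - 4 * ε)) ^ 2
    rw [Real.exp_neg, Real.exp_log hr, inv_div,
      Real.sq_sqrt (div_nonneg (by linarith) ha.le), div_le_div_iff₀ (by linarith) ha]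
    set s : ℝ := (win M p η l : ℝ)
    have e1 : (p - 4 * ε) * M ≤ s + c := by nlinarith
    have e2 : M - 1 - s + w ≤ (1 - p + 4 * ε) * M := by linarith
    calc (M - 1 - s + w) * (p - 4 * ε) ≤ (1 - p + 4 * ε) * M * (p - 4 * ε) :=
          mul_le_mul_of_nonneg_right e2 ha.le
      _ = (1 - p + 4 * ε) * ((p - 4 * ε) * M) := by ring
      _ ≤ _ := mul_le_mul_of_nonneg_left e1 (by linarith)

/-- Without the window margin the left side is the Bhattacharyya coefficient `2 √(p (1 - p))`, at
most `1 - 2η²`. The margin is cubic in `η`, hence negligible against this gap. -/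
theorem sum_bern_mul_errFactor_le (h : Admissible c w A M p η) (hp : 1 / 2 + η ≤ p) :
    p * errFactor p η true + (1 - p) * errFactor p η false ≤ 1 - η ^ 2 / 4 := by
  have hη := h.η_pos
  have hη4 := h.η_le
  have hc3 := h.cube_le
  have hp1 := h.p_le
  have hε2 : η ^ 3 / 32 = η ^ 2 * η / 32 := by ring
  set ε := η ^ 3 / 32
  have hε : 0 < ε := by positivity
  have hη2 : 0 < η ^ 2 := by positivity
  have hη2' : η ^ 2 ≤ 1 / 16 := by nlinarith
  -- `√((1 - a) / a) = √(a (1 - a)) / a`, together with `√(1 - η²) ≤ 1 - η² / 2`.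
  have key : ∀ a : ℝ, 0 < a → a * (1 - a) ≤ (1 - η ^ 2) / 4 →
      Real.sqrt ((1 - a) / a) ≤ (1 / 2 * (1 - η ^ 2 / 2)) / a := by
    intro a ha hab
    refine Real.sqrt_le_iff.2 ⟨div_nonneg (by nlinarith) ha.le, ?_⟩
    rw [div_pow, div_le_div_iff₀ ha (by positivity)]
    have : a * (1 - a) ≤ (1 / 2 * (1 - η ^ 2 / 2)) ^ 2 := by nlinarith
    nlinarith
  have k1 := key (p - 4 * ε) (by linarith) (by nlinarith)
  have k2 := key (1 - p - 4 * ε) (by linarith) (by nlinarith)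
  have hx : 0 ≤ 1 / 2 * (1 - η ^ 2 / 2) := by nlinarith
  have t1 : p * errFactor p η true ≤ (1 + η ^ 2 / 4) * (1 / 2 * (1 - η ^ 2 / 2)) := by
    simp only [errFactor, if_true]
    rw [show 1 - p + 4 * ε = 1 - (p - 4 * ε) by ring]
    calc _ ≤ p * ((1 / 2 * (1 - η ^ 2 / 2)) / (p - 4 * ε)) :=
          mul_le_mul_of_nonneg_left k1 (by linarith)
      _ = p / (p - 4 * ε) * (1 / 2 * (1 - η ^ 2 / 2)) := by ring
      _ ≤ _ := by
        refine mul_le_mul_of_nonneg_right ?_ hx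
        rw [div_le_iff₀ (by linarith)]
        nlinarith
  have t2 : (1 - p) * errFactor p η false ≤ (1 + η ^ 2 / 4) * (1 / 2 * (1 - η ^ 2 / 2)) := by
    simp only [errFactor, Bool.false_eq_true, if_false]
    rw [show p + 4 * ε = 1 - (1 - p - 4 * ε) by ring]
    calc _ ≤ (1 - p) * ((1 / 2 * (1 - η ^ 2 / 2)) / (1 - p - 4 * ε)) :=
          mul_le_mul_of_nonneg_left k2 (by linarith)
      _ = (1 - p) / (1 - p - 4 * ε) * (1 / 2 * (1 - η ^ 2 / 2)) := by ring
      _ ≤ _ := by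
        refine mul_le_mul_of_nonneg_right ?_ hx
        rw [div_le_iff₀ (by linarith)]
        nlinarith
  nlinarith

end Admissible

end Source


/-! ### Hellinger affinity of one source -/

section Hellinger

variable {M : ℕ}

/-- The number of errors of a candidate. -/
def errs (z : Fin M → Bool) : ℕ := #{j | z j = true}

theorem errs_le (z : Fin M → Bool) : errs z ≤ M := (card_le_univ _).trans (by simp)

theorem prod_bern_xor (x : ℝ) (v z : Fin M → Bool) :
    ∏ j, bern x (v j ^^ z j) = x ^ agr v z * (1 - x) ^ (M - agr v z) := by
  have h : ∀ j, bern x (v j ^^ z j) = if v j ≠ z j then x else 1 - x := by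
    intro j
    cases v j <;> cases z j <;> simp [bern]
  simp_rw [h]
  rw [prod_ite, prod_const, prod_const]
  have h2 := card_eq_add_agr v z
  have h3 : #{j | ¬ v j ≠ z j} = M - agr v z := by
    simp only [ne_eq, not_not]
    omega
  rw [h3]
  rfl

theorem prod_bern_eq (x : ℝ) (v : Fin M → Bool) :
    ∏ j, bern x (v j) =
      x ^ agr v (fun _ => false) * (1 - x) ^ (M - agr v (fun _ => false)) := by
  rw [← prod_bern_xor]
  simp

theorem sum_prod_bern_xor (x : ℝ) (z : Fin M → Bool) (f : Fin M → Bool → ℝ) :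
    ∑ v : Fin M → Bool, (∏ j, bern x (v j ^^ z j)) * ∏ j, f j (v j) =
      ∏ j, (x * f j (!z j) + (1 - x) * f j (z j)) := by
  simp_rw [← prod_mul_distrib]
  rw [sum_prod_pi fun j b => bern x (b ^^ z j) * f j b]
  refine prod_congr rfl fun j _ => ?_
  cases z j <;> simp [bern, add_comm]

theorem sum_betaWt_mul_le {c w : ℕ} (hc : 0 < c) (hw : 0 < w) (z : Fin M → Bool)
    {E : (Fin M → Bool) → ℝ} (hE : ∀ v, 0 ≤ E v) {S : ℝ}
    (hS : ∀ x : ℝ, 0 ≤ x → x ≤ 1 → ∑ v, (∏ j, bern x (v j ^^ z j)) * E v ≤ S) :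
    ∑ v, betaWt M c w (agr v z) * E v ≤ S := by
  have hint : ∀ v : Fin M → Bool, IntervalIntegrable (fun x : ℝ =>
      x ^ (agr v z + (c - 1)) * (1 - x) ^ (M - agr v z + (w - 1)) * E v)
      MeasureTheory.volume 0 1 := fun v =>
    Continuous.intervalIntegrable (by fun_prop) _ _
  calc ∑ v, betaWt M c w (agr v z) * E v
      = ∫ x in (0 : ℝ)..1, ∑ v : Fin M → Bool,
          x ^ (agr v z + (c - 1)) * (1 - x) ^ (M - agr v z + (w - 1)) * E v := by
        rw [intervalIntegral.integral_finsetSum fun v _ => hint v]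
        refine sum_congr rfl fun v _ => ?_
        rw [intervalIntegral.integral_mul_const, betaWt_eq_integral hc hw]
    _ ≤ ∫ _ in (0 : ℝ)..1, S := by
        refine intervalIntegral.integral_mono_on zero_le_one
          (Continuous.intervalIntegrable (by fun_prop) _ _) (by simp) fun x hx => ?_
        refine le_trans (sum_le_sum fun v _ => ?_) (hS x hx.1 hx.2)
        have h1 : 0 ≤ 1 - x := by linarith [hx.2]
        have h2 : 1 - x ≤ 1 := by linarith [hx.1]
        rw [prod_bern_xor, pow_add, pow_add]
        refine mul_le_mul_of_nonneg_right ?_ (hE v)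
        exact mul_le_mul (mul_le_of_le_one_right (pow_nonneg hx.1 _) (pow_le_one₀ hx.1 hx.2))
          (mul_le_of_le_one_right (pow_nonneg h1 _) (pow_le_one₀ h1 h2))
          (by positivity) (pow_nonneg hx.1 _)
    _ = S := by simp

/-- Hellinger affinity between the label law of a source and its law under the candidate `z`. -/
noncomputable def affinity (M c w : ℕ) (p : ℝ) (z : Fin M → Bool) : ℝ :=
  ∑ v : Fin M → Bool, (∏ j, bern p (v j)) *
    Real.sqrt (betaWt M c w (agr v z) / betaWt M c w (agr v fun _ => false))

theorem affinity_nonneg {c w : ℕ} {p : ℝ} (h0 : 0 ≤ p) (h1 : p ≤ 1) (z : Fin M → Bool) :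
    0 ≤ affinity M c w p z :=
  sum_nonneg fun _ _ => mul_nonneg (prod_nonneg fun _ _ => bern_nonneg h0 h1 _)
    (Real.sqrt_nonneg _)

/-- Polynomial factor comparing a Bernoulli law with the beta mixture. -/
noncomputable def mixFactor (M A : ℕ) : ℝ := ((M : ℝ) + 2 * A) ^ (2 * A)

theorem mixFactor_nonneg (M A : ℕ) : 0 ≤ mixFactor M A := by unfold mixFactor; positivity

/-- Cauchy–Schwarz with a free test weight `E`. The Bernoulli law is at most `mixFactor` times the
beta weight at the truth, so the weight in the denominator cancels and the second factor is a beta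
mixture centred at `z`. -/
theorem sum_bern_mul_sqrt_le {c w A : ℕ} (hc : 0 < c) (hw : 0 < w) (hcA : c ≤ A) (hwA : w ≤ A)
    {p : ℝ} (h0 : 0 ≤ p) (h1 : p ≤ 1) (z : Fin M → Bool) {G E : (Fin M → Bool) → ℝ}
    (hE : ∀ v, 0 < E v) {S₁ S₂ : ℝ}
    (hS₁ : ∑ v, (∏ j, bern p (v j)) * (G v ^ 2 / E v) ≤ S₁)
    (hS₂ : ∀ x : ℝ, 0 ≤ x → x ≤ 1 → ∑ v, (∏ j, bern x (v j ^^ z j)) * E v ≤ S₂) :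
    ∑ v : Fin M → Bool, (∏ j, bern p (v j)) * (G v *
      Real.sqrt (betaWt M c w (agr v z) / betaWt M c w (agr v fun _ => false))) ≤
      Real.sqrt (mixFactor M A * S₁ * S₂) := by
  have hP : ∀ v : Fin M → Bool, 0 ≤ ∏ j, bern p (v j) := fun v =>
    prod_nonneg fun _ _ => bern_nonneg h0 h1 _
  have hmix := mixFactor_nonneg M A
  have hS1' : 0 ≤ S₁ := le_trans (sum_nonneg fun v _ => mul_nonneg (hP v)
    (div_nonneg (sq_nonneg _) (hE v).le)) hS₁
  have hS := sum_betaWt_mul_le hc hw z (fun v => (hE v).le) hS₂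
  calc _ ≤ ∑ v, Real.sqrt (mixFactor M A * ((∏ j, bern p (v j)) * (G v ^ 2 / E v))) *
        Real.sqrt (betaWt M c w (agr v z) * E v) := by
        refine sum_le_sum fun v _ => ?_
        have hb := betaWt_pos M c w (agr v z)
        have hb0 := betaWt_pos M c w (agr v fun _ => false)
        have hv := hE v
        have hPv := hP v
        rw [← Real.sqrt_mul (mul_nonneg hmix (mul_nonneg (hP v)
          (div_nonneg (sq_nonneg _) (hE v).le)))]
        refine Real.le_sqrt_of_sq_le ?_
        rw [mul_pow, mul_pow, Real.sq_sqrt (by positivity)]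
        have hle := pow_mul_pow_le_betaWt (agr_le v fun _ => false) hc hw hcA hwA h0 h1
        rw [← prod_bern_eq] at hle
        have e : mixFactor M A * ((∏ j, bern p (v j)) * (G v ^ 2 / E v)) *
            (betaWt M c w (agr v z) * E v) =
            (∏ j, bern p (v j)) * (G v ^ 2 * betaWt M c w (agr v z) /
              betaWt M c w (agr v fun _ => false)) *
              (mixFactor M A * betaWt M c w (agr v fun _ => false)) := by
          field_simp
        rw [e, show (∏ j, bern p (v j)) ^ 2 * (G v ^ 2 * (betaWt M c w (agr v z) /
            betaWt M c w (agr v fun _ => false))) = (∏ j, bern p (v j)) *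
            (G v ^ 2 * betaWt M c w (agr v z) / betaWt M c w (agr v fun _ => false)) *
            ∏ j, bern p (v j) by ring]
        exact mul_le_mul_of_nonneg_left hle (by positivity)
    _ ≤ Real.sqrt (∑ v, mixFactor M A * ((∏ j, bern p (v j)) * (G v ^ 2 / E v))) *
        Real.sqrt (∑ v, betaWt M c w (agr v z) * E v) :=
        Real.sum_sqrt_mul_sqrt_le _ (fun v => mul_nonneg hmix (mul_nonneg (hP v)
          (div_nonneg (sq_nonneg _) (hE v).le)))
          fun v => mul_nonneg (betaWt_pos _ _ _ _).le (hE v).le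
    _ ≤ Real.sqrt (mixFactor M A * S₁) * Real.sqrt S₂ := by
        rw [← mul_sum]
        exact mul_le_mul (Real.sqrt_le_sqrt (mul_le_mul_of_nonneg_left hS₁ hmix))
          (Real.sqrt_le_sqrt hS) (Real.sqrt_nonneg _) (Real.sqrt_nonneg _)
    _ = _ := (Real.sqrt_mul (by positivity) _).symm

/-- The trivial test weight. This bound serves the two sources that need not be informative. -/
theorem affinity_le_sqrt {c w A : ℕ} (hc : 0 < c) (hw : 0 < w) (hcA : c ≤ A) (hwA : w ≤ A)
    {p : ℝ} (h0 : 0 ≤ p) (h1 : p ≤ 1) (z : Fin M → Bool) :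
    affinity M c w p z ≤ Real.sqrt (mixFactor M A) := by
  have := sum_bern_mul_sqrt_le hc hw hcA hwA h0 h1 z (G := fun _ => 1) (E := fun _ => 1)
    (S₁ := 1) (S₂ := 1) (fun _ => zero_lt_one) ?_ fun x hx0 hx1 => ?_
  · simpa [affinity] using this
  · have := sum_prod_bern (M := M) p fun _ _ => 1
    simp only [prod_const_one, mul_one] at this
    simp [this]
  · have := sum_prod_bern_xor x z fun _ _ => 1
    simp only [prod_const_one, mul_one] at this
    simp [this]

theorem exp_le_one_add_add_sq {x : ℝ} (hx : |x| ≤ 1) : Real.exp x ≤ 1 + x + x ^ 2 := by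
  have := (abs_le.1 (Real.abs_exp_sub_one_sub_id_le hx)).2
  linarith

/-- Exponential moment of a tilted label bit. -/
theorem bern_exp_le {x t : ℝ} (h0 : 0 ≤ x) (h1 : x ≤ 1) (ht : |t| ≤ 1) :
    x * Real.exp (t / 2) + (1 - x) * Real.exp (-(t / 2)) ≤
      Real.exp (t * (x - 1 / 2) + t ^ 2 / 4) := by
  obtain ⟨a, b⟩ := abs_le.1 ht
  have e1 := exp_le_one_add_add_sq (x := t / 2) (by rw [abs_le]; constructor <;> linarith)
  have e2 := exp_le_one_add_add_sq (x := -(t / 2)) (by rw [abs_le]; constructor <;> linarith)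
  have e3 := Real.add_one_le_exp (t * (x - 1 / 2) + t ^ 2 / 4)
  have e4 := mul_le_mul_of_nonneg_left e1 h0
  have e5 := mul_le_mul_of_nonneg_left e2 (by linarith : 0 ≤ 1 - x)
  nlinarith

theorem sum_bern_mul_exp_le {x : ℝ} (h0 : 0 ≤ x) (h1 : x ≤ 1) {t : Fin M → ℝ}
    (ht : ∀ j, |t j| ≤ 1) :
    ∑ v : Fin M → Bool, (∏ j, bern x (v j)) * Real.exp (∑ j, t j * sgn (v j) / 2) ≤
      Real.exp (∑ j, (t j * (x - 1 / 2) + t j ^ 2 / 4)) := by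
  simp_rw [Real.exp_sum]
  rw [sum_prod_bern x fun j b => Real.exp (t j * sgn b / 2)]
  refine prod_le_prod (fun j _ => ?_) fun j _ => ?_
  · have : 0 ≤ 1 - x := by linarith
    positivity
  · refine le_trans (le_of_eq ?_) (bern_exp_le h0 h1 (ht j))
    simp [sgn, neg_div]

theorem sum_bern_xor_mul_exp_le {x : ℝ} (h0 : 0 ≤ x) (h1 : x ≤ 1) (z : Fin M → Bool)
    {t : Fin M → ℝ} (ht : ∀ j, |t j| ≤ 1) :
    ∑ v : Fin M → Bool, (∏ j, bern x (v j ^^ z j)) * Real.exp (∑ j, t j * sgn (v j) / 2) ≤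
      Real.exp (∑ j, (-(t j * sgn (z j)) * (x - 1 / 2) + t j ^ 2 / 4)) := by
  simp_rw [Real.exp_sum]
  rw [sum_prod_bern_xor x z fun j b => Real.exp (t j * sgn b / 2)]
  refine prod_le_prod (fun j _ => ?_) fun j _ => ?_
  · have : 0 ≤ 1 - x := by linarith
    positivity
  · cases hz : z j
    · refine le_trans (le_of_eq ?_) ((bern_exp_le h0 h1 (ht j)).trans (le_of_eq ?_))
      · simp [sgn, neg_div]
      · simp [sgn]
    · refine le_trans (le_of_eq ?_) ((bern_exp_le h0 h1 (t := -(t j))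
        (by rw [abs_neg]; exact ht j)).trans (le_of_eq ?_))
      · simp [sgn, neg_div]
      · simp [sgn]

/-- Contraction of the affinity of an informative source, exponential in the distance of the
candidate to the truth and to its complement. -/
theorem affinity_le_exp {c w A : ℕ} (hc : 0 < c) (hw : 0 < w) (hcA : c ≤ A) (hwA : w ≤ A)
    {p η : ℝ} (hη : 0 < η) (hp : 1 / 2 + η ≤ p) (h1 : p ≤ 1) (z : Fin M → Bool)
    {κ : ℝ} (hκ : 0 < κ) (hκ1 : κ ≤ errs z) (hκ2 : κ ≤ M - errs z) :
    affinity M c w p z ≤ Real.sqrt (mixFactor M A) * Real.exp (-(κ * η ^ 2 / 8)) := by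
  have h0 : 0 ≤ p := by linarith
  have hm : (0 : ℝ) < errs z := hκ.trans_le hκ1
  have hm' : (0 : ℝ) < M - errs z := hκ.trans_le hκ2
  -- With this choice the linear gain `2 * lam * κ * η` dominates the two quadratic losses `lam ^ 2
  -- * κ / 2`.
  set lam := η / 4 with hlam
  have hlam0 : 0 < lam := by positivity
  set a : ℝ := κ / errs z with ha
  set a' : ℝ := κ / (M - errs z) with ha'
  have ha0 : 0 < a := by positivity
  have ha0' : 0 < a' := by positivity
  have ha1 : a ≤ 1 := (div_le_one hm).2 hκ1
  have ha1' : a' ≤ 1 := (div_le_one hm').2 hκ2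
  -- The test gives equal total weight to the tasks with and without an error. Under the candidate
  -- `z` its mean then vanishes for every accuracy `x`, while under the truth it is proportional to
  -- `p - 1/2`.
  set t : Fin M → ℝ := fun j => lam * if z j then a else a' with ht
  have ht1 : ∀ j, |t j| ≤ 1 := by
    intro j
    simp only [ht]
    rw [abs_le]
    split_ifs <;> constructor <;> nlinarith
  have hsum : ∀ x y : ℝ, (∑ j, if z j then x else y) = errs z * x + (M - errs z) * y := by
    intro x y
    rw [sum_ite, sum_const, sum_const, nsmul_eq_mul, nsmul_eq_mul]
    congr 2
    have := card_filter_add_card_filter_not (s := (univ : Finset (Fin M))) (fun j => z j = true)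
    rw [card_univ, Fintype.card_fin] at this
    rw [eq_sub_iff_add_eq]
    unfold errs
    rw [add_comm]
    exact_mod_cast this
  have hea : errs z * a = κ := by rw [ha]; field_simp
  have hea' : (M - errs z) * a' = κ := by rw [ha']; field_simp
  have hsq : ∑ j, t j ^ 2 / 4 ≤ lam ^ 2 * κ / 2 := by
    calc ∑ j, t j ^ 2 / 4 ≤ ∑ j, if z j then lam ^ 2 / 4 * a else lam ^ 2 / 4 * a' := by
          refine sum_le_sum fun j _ => ?_
          simp only [ht]
          split_ifs
          · nlinarith [mul_le_mul_of_nonneg_left ha1 ha0.le, sq_nonneg lam]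
          · nlinarith [mul_le_mul_of_nonneg_left ha1' ha0'.le, sq_nonneg lam]
      _ = lam ^ 2 / 4 * (errs z * a) + lam ^ 2 / 4 * ((M - errs z) * a') := by rw [hsum]; ring
      _ = _ := by rw [hea, hea']; ring
  have hlin : ∑ j, t j = 2 * lam * κ := by
    simp only [ht]
    rw [← mul_sum, hsum, hea, hea']
    ring
  have hzero : ∑ j, t j * sgn (z j) = 0 := by
    have : ∀ j, t j * sgn (z j) = if z j then lam * a else -(lam * a') := by
      intro j
      simp only [ht]
      cases z j <;> simp [sgn]
    simp_rw [this]
    rw [hsum]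
    linear_combination lam * hea - lam * hea'
  set E : (Fin M → Bool) → ℝ := fun v => Real.exp (∑ j, t j * sgn (v j) / 2) with hE
  have key := sum_bern_mul_sqrt_le hc hw hcA hwA h0 h1 z (G := fun _ => 1) (E := E)
    (S₁ := Real.exp (-(2 * lam * κ * η) + lam ^ 2 * κ / 2)) (S₂ := Real.exp (lam ^ 2 * κ / 2))
    (fun _ => Real.exp_pos _) ?_ fun x hx0 hx1 => ?_
  · simp only [one_mul] at key
    refine key.trans (le_of_eq_of_le (b := Real.sqrt (mixFactor M A) *
      Real.exp ((-(2 * lam * κ * η) + lam ^ 2 * κ / 2 + lam ^ 2 * κ / 2) / 2)) ?_ ?_)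
    · rw [mul_assoc, ← Real.exp_add, Real.sqrt_mul (mixFactor_nonneg _ _), Real.exp_half]
    · refine mul_le_mul_of_nonneg_left (Real.exp_le_exp.2 ?_) (Real.sqrt_nonneg _)
      rw [hlam]
      nlinarith [mul_pos hκ (pow_pos hη 2)]
  · have h2 := sum_bern_mul_exp_le h0 h1 (t := fun j => -t j) (fun j => by rw [abs_neg]; exact ht1 j)
    refine le_trans (le_of_eq ?_) (h2.trans (Real.exp_le_exp.2 ?_))
    · refine sum_congr rfl fun v _ => ?_
      simp only [hE]
      rw [one_pow, one_div, ← Real.exp_neg, ← sum_neg_distrib]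
      congr 3
      funext j
      ring
    · rw [sum_add_distrib]
      simp only [even_two, Even.neg_pow]
      have : ∑ j, -t j * (p - 1 / 2) = -(2 * lam * κ) * (p - 1 / 2) := by
        rw [← sum_mul, sum_neg_distrib, hlin]
      rw [this]
      have : 0 < lam * κ := by positivity
      nlinarith
  · refine (sum_bern_xor_mul_exp_le hx0 hx1 z ht1).trans (Real.exp_le_exp.2 ?_)
    rw [sum_add_distrib, ← sum_mul, sum_neg_distrib, hzero]
    linarith

end Hellinger


/-! ### Typical data and affinity near the truth -/

section Typical

variable {M : ℕ}

/-- The source has a typical number of correct labels. -/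
def IsTypical (p ε : ℝ) (v : Fin M → Bool) : Prop :=
  |(agr v (fun _ => false) : ℝ) - p * M| ≤ ε * M

theorem two_mul_agr_sub (p : ℝ) (v : Fin M → Bool) :
    2 * ((agr v (fun _ => false) : ℝ) - p * M) = ∑ j, (sgn (v j) + (1 - 2 * p)) := by
  have : (agr v (fun _ => false) : ℝ) = ∑ j, ind (v j) := by
    unfold agr ind
    rw [card_filter]
    push_cast
    refine sum_congr rfl fun j _ => ?_
    cases v j <;> simp
  rw [this, sum_add_distrib, sum_const, card_univ, Fintype.card_fin, nsmul_eq_mul, mul_sub,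
    mul_sum]
  have h2 : ∀ j, sgn (v j) = 2 * ind (v j) - 1 := fun j => by
    cases v j <;> norm_num [sgn, ind]
  simp_rw [h2]
  rw [sum_sub_distrib, sum_const, card_univ, Fintype.card_fin, nsmul_eq_mul]
  ring

open Classical in
/-- Large deviations of the number of correct labels of one source. -/
theorem sum_bern_not_typical_le {p ε : ℝ} (h0 : 0 ≤ p) (h1 : p ≤ 1) (hε : 0 ≤ ε) (hε1 : ε ≤ 1 / 2) :
    ∑ v : Fin M → Bool, (∏ j, bern p (v j)) * (if IsTypical p ε v then 0 else 1) ≤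
      2 * Real.exp (-(ε ^ 2 * M)) := by
  have key : ∀ t : ℝ, |t| ≤ 1 → ∑ v : Fin M → Bool, (∏ j, bern p (v j)) *
      Real.exp (t * ((agr v (fun _ => false) : ℝ) - p * M)) ≤ Real.exp (t ^ 2 / 4 * M) := by
    intro t ht
    have := sum_bern_mul_exp_le (M := M) h0 h1 (t := fun _ => t) (fun _ => ht)
    calc _ = (∑ v : Fin M → Bool, (∏ j, bern p (v j)) * Real.exp (∑ j, t * sgn (v j) / 2)) *
          Real.exp (-(t * (p - 1 / 2) * M)) := by
          rw [sum_mul]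
          refine sum_congr rfl fun v _ => ?_
          rw [mul_assoc, ← Real.exp_add]
          congr 2
          have e := two_mul_agr_sub p v
          rw [sum_add_distrib, sum_const, card_univ, Fintype.card_fin, nsmul_eq_mul] at e
          rw [← sum_div, ← mul_sum]
          linear_combination t / 2 * e
      _ ≤ Real.exp (∑ _j : Fin M, (t * (p - 1 / 2) + t ^ 2 / 4)) *
          Real.exp (-(t * (p - 1 / 2) * M)) :=
          mul_le_mul_of_nonneg_right this (Real.exp_pos _).le
      _ = _ := by
          rw [← Real.exp_add, sum_const, card_univ, Fintype.card_fin, nsmul_eq_mul]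
          congr 1
          ring
  -- `t = 2ε` minimises the Chernoff exponent `t² / 4 - t ε`.
  have k1 := key (2 * ε) (by rw [abs_le]; constructor <;> linarith)
  have k2 := key (-(2 * ε)) (by rw [abs_le]; constructor <;> linarith)
  have hpt : ∀ v : Fin M → Bool, (if IsTypical p ε v then (0 : ℝ) else 1) ≤
      (Real.exp (2 * ε * ((agr v (fun _ => false) : ℝ) - p * M)) +
        Real.exp (-(2 * ε) * ((agr v (fun _ => false) : ℝ) - p * M))) *
          Real.exp (-(2 * ε ^ 2 * M)) := by
    intro v
    split_ifs with hv
    · positivity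
    · unfold IsTypical at hv
      rw [add_mul, ← Real.exp_add, ← Real.exp_add]
      set d := (agr v (fun _ => false) : ℝ) - p * M
      rcases lt_abs.1 (not_le.1 hv) with h | h
      · have := Real.one_le_exp (x := 2 * ε * d + -(2 * ε ^ 2 * M)) (by nlinarith)
        linarith [Real.exp_pos (-(2 * ε) * d + -(2 * ε ^ 2 * M))]
      · have := Real.one_le_exp (x := -(2 * ε) * d + -(2 * ε ^ 2 * M)) (by nlinarith)
        linarith [Real.exp_pos (2 * ε * d + -(2 * ε ^ 2 * M))]
  calc _ ≤ ∑ v : Fin M → Bool, (∏ j, bern p (v j)) *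
        ((Real.exp (2 * ε * ((agr v (fun _ => false) : ℝ) - p * M)) +
          Real.exp (-(2 * ε) * ((agr v (fun _ => false) : ℝ) - p * M))) *
            Real.exp (-(2 * ε ^ 2 * M))) :=
        sum_le_sum fun v _ => mul_le_mul_of_nonneg_left (hpt v)
          (prod_nonneg fun _ _ => bern_nonneg h0 h1 _)
    _ = (∑ v : Fin M → Bool, (∏ j, bern p (v j)) *
          Real.exp (2 * ε * ((agr v (fun _ => false) : ℝ) - p * M)) +
        ∑ v : Fin M → Bool, (∏ j, bern p (v j)) *
          Real.exp (-(2 * ε) * ((agr v (fun _ => false) : ℝ) - p * M))) *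
            Real.exp (-(2 * ε ^ 2 * M)) := by
        rw [← sum_add_distrib, sum_mul]
        refine sum_congr rfl fun v _ => ?_
        ring
    _ ≤ (Real.exp ((2 * ε) ^ 2 / 4 * M) + Real.exp ((-(2 * ε)) ^ 2 / 4 * M)) *
          Real.exp (-(2 * ε ^ 2 * M)) :=
        mul_le_mul_of_nonneg_right (add_le_add k1 k2) (Real.exp_pos _).le
    _ = 2 * Real.exp (-(ε ^ 2 * M)) := by
        rw [add_mul, ← Real.exp_add, ← Real.exp_add,
          show (2 * ε) ^ 2 / 4 * M + -(2 * ε ^ 2 * M) = -(ε ^ 2 * M) by ring,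
          show (-(2 * ε)) ^ 2 / 4 * M + -(2 * ε ^ 2 * M) = -(ε ^ 2 * M) by ring]
        ring

theorem abs_agr_sub_agr_zero_le (v z : Fin M → Bool) :
    |(agr v z : ℝ) - agr v (fun _ => false)| ≤ errs z := by
  rw [agr_eq_sub_sum, sub_sub_cancel_left, abs_neg]
  refine (abs_sum_le_sum_abs _ _).trans (le_of_le_of_eq (sum_le_sum (g := fun j => ind (z j))
    fun j _ => ?_) ?_)
  · rw [abs_mul, abs_of_nonneg (IsMeanField.ind_nonneg _)]
    exact mul_le_of_le_one_left (IsMeanField.ind_nonneg _) (IsMeanField.abs_sgn _)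
  · unfold errs ind
    rw [card_filter]
    push_cast
    rfl

theorem agr_not (v z : Fin M → Bool) : agr v (fun j => !z j) = M - agr v z := by
  have h := card_eq_add_agr v z
  have h2 : agr v (fun j => !z j) = #{j | v j = z j} := by
    unfold agr
    congr 1
    ext j
    simp only [mem_filter, mem_univ, true_and]
    cases v j <;> cases z j <;> simp
  omega

theorem errs_not (z : Fin M → Bool) : errs (fun j => !z j) = M - errs z := by
  have h1 : ∀ z : Fin M → Bool, errs z = agr (fun _ => false) z := by
    intro z
    unfold errs agr
    congr 1
    ext j
    simp only [mem_filter, mem_univ, true_and]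
    cases z j <;> simp
  rw [h1, h1, agr_not]

/-- Frozen weights pay at most the squared error factor for each error. -/
theorem exp_logPot_le {c w A : ℕ} {p η : ℝ} (h : Admissible c w A M p η) (v z : Fin M → Bool) :
    Real.exp (logPot M c w p η (agr v z)) ≤
      Real.exp (logPot M c w p η (agr v fun _ => false)) *
        ∏ j, (if z j then errFactor p η (v j) ^ 2 else 1) := by
  have key : ∀ S : Finset (Fin M),
      Real.exp (logPot M c w p η (agr v fun j => decide (j ∈ S))) ≤
        Real.exp (logPot M c w p η (agr v fun _ => false)) * ∏ j ∈ S, errFactor p η (v j) ^ 2 := by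
    intro S
    induction S using Finset.induction_on with
    | empty => simp
    | insert a S ha ih =>
      set z : Fin M → Bool := fun j => decide (j ∈ S) with hz
      have e1 : (fun j => decide (j ∈ insert a S)) = Function.update z a true := by
        funext j
        by_cases hj : j = a
        · subst hj; simp
        · simp [hz, hj]
      have e0 : z = Function.update z a false := by
        rw [eq_comm, Function.update_eq_self_iff]
        simp [hz, ha]
      rw [e1, prod_insert ha, agr_update_right]
      rw [e0, agr_update_right] at ih
      have hst := h.exp_neg_sgn_le (v a) (agrOff a v z)
      cases hv : v a
      · simp only [hv, ne_eq, Bool.false_eq_true, not_false_eq_true, if_true, not_true_eq_false,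
          if_false, add_zero, sgn, neg_mul, one_mul, neg_neg] at ih hst ⊢
        calc _ = Real.exp (logPot M c w p η (agrOff a v z + 1) - logPot M c w p η (agrOff a v z)) *
              Real.exp (logPot M c w p η (agrOff a v z)) := by rw [← Real.exp_add]; ring_nf
          _ ≤ _ := mul_le_mul hst ih (Real.exp_pos _).le (sq_nonneg _)
          _ = _ := by ring
      · simp only [hv, ne_eq, Bool.true_eq_false, not_false_eq_true, if_true, not_true_eq_false,
          if_false, add_zero, sgn, one_mul] at ih hst ⊢
        calc _ = Real.exp (-(logPot M c w p η (agrOff a v z + 1) -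
                logPot M c w p η (agrOff a v z))) *
              Real.exp (logPot M c w p η (agrOff a v z + 1)) := by rw [← Real.exp_add]; ring_nf
          _ ≤ _ := mul_le_mul hst ih (Real.exp_pos _).le (sq_nonneg _)
          _ = _ := by ring
  have := key (univ.filter fun j => z j = true)
  rw [prod_filter] at this
  simpa using this

theorem IsTypical.mem_win {p η : ℝ} {v : Fin M → Bool} (hv : IsTypical p (η ^ 3 / 32) v)
    (hM : 0 ≤ η ^ 3 / 32 * M) {z : Fin M → Bool} (hz : (errs z : ℝ) ≤ η ^ 3 / 32 * M) :
    winLo M p η ≤ agr v z ∧ agr v z ≤ winHi M p η := by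
  refine Admissible.mem_win ?_
  unfold IsTypical at hv
  have := abs_agr_sub_agr_zero_le v z
  obtain ⟨a1, a2⟩ := abs_le.1 hv
  obtain ⟨b1, b2⟩ := abs_le.1 this
  rw [abs_le]
  constructor <;> linarith

/-- On typical data the beta weights themselves obey the bound of the frozen ones. -/
theorem sqrt_betaWt_div_le {c w A : ℕ} {p η : ℝ} (h : Admissible c w A M p η) {v z : Fin M → Bool}
    (hv : IsTypical p (η ^ 3 / 32) v) (hz : (errs z : ℝ) ≤ η ^ 3 / 32 * M) :
    Real.sqrt (betaWt M c w (agr v z) / betaWt M c w (agr v fun _ => false)) ≤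
      ∏ j, (if z j then errFactor p η (v j) else 1) := by
  have hM : 0 ≤ η ^ 3 / 32 * M := by linarith [h.one_le]
  obtain ⟨h1, h2⟩ := hv.mem_win hM hz
  obtain ⟨h3, h4⟩ := hv.mem_win hM (z := fun _ => false) (by simpa [errs] using hM)
  rw [h.betaWt_eq_exp_logPot h1 h2, h.betaWt_eq_exp_logPot h3 h4,
    mul_div_mul_left _ _ (div_pos (betaWt_pos _ _ _ _) (Real.exp_pos _)).ne']
  refine Real.sqrt_le_iff.2 ⟨prod_nonneg fun j _ => ?_, ?_⟩
  · split_ifs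
    · exact errFactor_nonneg _ _ _
    · exact zero_le_one
  · rw [div_le_iff₀ (Real.exp_pos _), mul_comm, ← prod_pow]
    refine (exp_logPot_le h v z).trans (le_of_eq ?_)
    congr 1
    refine prod_congr rfl fun j _ => ?_
    split_ifs <;> simp

/-- Complementation costs a factor `1 - η`, whose square root is at most `1 - η² / 4`. The
complement thus behaves as if it had one additional error. -/
theorem sqrt_betaWt_not_div_le {c w A : ℕ} {p η : ℝ} (h : Admissible c w A M p η) (hwc : w < c)
    (hp : 1 / 2 + η ≤ p) {v z : Fin M → Bool}
    (hv : IsTypical p (η ^ 3 / 32) v) (hz : (errs z : ℝ) ≤ η ^ 3 / 32 * M) :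
    Real.sqrt (betaWt M c w (agr v fun j => !z j) / betaWt M c w (agr v fun _ => false)) ≤
      (1 - η ^ 2 / 4) * ∏ j, (if z j then errFactor p η (v j) else 1) := by
  have hM : 0 ≤ η ^ 3 / 32 * M := by linarith [h.one_le]
  have hη := h.η_pos
  have hη4 := h.η_le
  obtain ⟨h1, h2⟩ := hv.mem_win hM hz
  rw [agr_not, Admissible.betaWt_compl_eq h1 h2, mul_comm (betaWt _ _ _ _), mul_div_assoc,
    Real.sqrt_mul (Real.exp_pos _).le]
  refine mul_le_mul (Real.sqrt_le_iff.2 ⟨by nlinarith, ?_⟩) (sqrt_betaWt_div_le h hv hz)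
    (Real.sqrt_nonneg _) (by nlinarith)
  refine (h.exp_complPot_le_of_lt hwc hp _).trans ?_
  nlinarith [sq_nonneg (η ^ 2 / 4)]

open Classical in
-- On typical data the root of the likelihood ratio is a product over tasks, whose mean factorises.
-- On atypical data no such bound holds, but Cauchy–Schwarz with the indicator costs only the root
-- of a large-deviation probability times a polynomial.
theorem affinity_le_add {c w A : ℕ} {p η : ℝ} (h : Admissible c w A M p η) (hp : 1 / 2 + η ≤ p)
    (z : Fin M → Bool) {x : ℝ} (hx : 0 ≤ x) {z' : Fin M → Bool}
    (hz : ∀ v, IsTypical p (η ^ 3 / 32) v →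
      Real.sqrt (betaWt M c w (agr v z) / betaWt M c w (agr v fun _ => false)) ≤
        x * ∏ j, (if z' j then errFactor p η (v j) else 1)) :
    affinity M c w p z ≤ x * (1 - η ^ 2 / 4) ^ errs z' +
      Real.sqrt (mixFactor M A * (2 * Real.exp (-((η ^ 3 / 32) ^ 2 * M)))) := by
  have hη := h.η_pos
  have hη4 := h.η_le
  have h0 : 0 ≤ p := by linarith
  have h1 : p ≤ 1 := by linarith [h.p_le]
  have hc3 := h.cube_le
  have hP : ∀ v : Fin M → Bool, 0 ≤ ∏ j, bern p (v j) := fun v =>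
    prod_nonneg fun _ _ => bern_nonneg h0 h1 _
  have hf : ∀ b, 0 ≤ errFactor p η b := errFactor_nonneg p η
  set r : (Fin M → Bool) → ℝ := fun v =>
    Real.sqrt (betaWt M c w (agr v z) / betaWt M c w (agr v fun _ => false))
  have hr : ∀ v, 0 ≤ r v := fun v => Real.sqrt_nonneg _
  have hbad := sum_bern_mul_sqrt_le h.c_pos h.w_pos h.c_le h.w_le h0 h1 z
    (G := fun v => if IsTypical p (η ^ 3 / 32) v then 0 else 1) (E := fun _ => 1)
    (S₁ := 2 * Real.exp (-((η ^ 3 / 32) ^ 2 * M))) (S₂ := 1)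
    (fun _ => zero_lt_one) ?_ fun x hx0 hx1 => ?_
  · rw [mul_one] at hbad
    calc affinity M c w p z ≤ ∑ v : Fin M → Bool, ((∏ j, bern p (v j)) *
          (x * ∏ j, (if z' j then errFactor p η (v j) else 1)) +
          (∏ j, bern p (v j)) * ((if IsTypical p (η ^ 3 / 32) v then 0 else 1) * r v)) := by
          refine sum_le_sum fun v _ => ?_
          rw [← mul_add]
          refine mul_le_mul_of_nonneg_left ?_ (hP v)
          split_ifs with hv
          · rw [zero_mul, add_zero]
            exact hz v hv
          · rw [one_mul]
            refine le_add_of_nonneg_left (mul_nonneg hx (prod_nonneg fun j _ => ?_))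
            split_ifs
            · exact hf _
            · exact zero_le_one
      _ = x * ∏ j, (p * (if z' j then errFactor p η true else 1) +
            (1 - p) * (if z' j then errFactor p η false else 1)) +
          ∑ v : Fin M → Bool, (∏ j, bern p (v j)) *
            ((if IsTypical p (η ^ 3 / 32) v then 0 else 1) * r v) := by
          rw [sum_add_distrib, ← sum_prod_bern p fun j b => if z' j then errFactor p η b else 1,
            mul_sum]
          congr 1
          exact sum_congr rfl fun v _ => by ring
      _ ≤ _ := by
          refine add_le_add (mul_le_mul_of_nonneg_left ?_ hx) hbad
          unfold errs
          rw [← prod_const, prod_filter]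
          refine prod_le_prod (fun j _ => ?_) fun j _ => ?_
          · have := hf true
            have := hf false
            have : 0 ≤ 1 - p := by linarith
            split_ifs <;> positivity
          · split_ifs
            · exact h.sum_bern_mul_errFactor_le hp
            · exact le_of_eq (by ring)
  · refine le_trans (le_of_eq (sum_congr rfl fun v _ => ?_))
      (sum_bern_not_typical_le h0 h1 (by positivity) (by linarith))
    split_ifs <;> simp
  · have := sum_prod_bern_xor x z fun _ _ => 1
    simp only [prod_const_one, mul_one] at this
    simp [this]

/-- The affinity of an informative source decays exponentially in the number of errors, or in one
plus the number of errors of the complementary candidate. -/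
theorem affinity_le_pow {c w A : ℕ} {p η : ℝ} (h : Admissible c w A M p η) (hwc : w < c)
    (hp : 1 / 2 + η ≤ p) (z : Fin M → Bool) :
    affinity M c w p z ≤ (1 - η ^ 2 / 4) ^ errs z +
        Real.sqrt (mixFactor M A * (2 * Real.exp (-((η ^ 3 / 32) ^ 2 * M)))) ∨
    affinity M c w p z ≤ (1 - η ^ 2 / 4) ^ (M - errs z + 1) +
        Real.sqrt (mixFactor M A * (2 * Real.exp (-((η ^ 3 / 32) ^ 2 * M)))) := by
  have hη := h.η_pos
  have hη4 := h.η_le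
  have hρ : 0 ≤ 1 - η ^ 2 / 4 := by nlinarith
  by_cases h1 : (errs z : ℝ) ≤ η ^ 3 / 32 * M
  · left
    simpa using affinity_le_add h hp z zero_le_one (z' := z) fun v hv => by
      simpa using sqrt_betaWt_div_le h hv h1
  by_cases h2 : ((M - errs z : ℕ) : ℝ) ≤ η ^ 3 / 32 * M
  · right
    have := affinity_le_add h hp z hρ (z' := fun j => !z j) fun v hv => by
      simpa using sqrt_betaWt_not_div_le h hwc hp hv (z := fun j => !z j)
        (by rw [errs_not]; exact h2)
    rwa [errs_not, mul_comm, ← pow_succ] at this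
  -- Far from both the truth and its complement: the balanced test gives decay exponential in `M`,
  -- already below the additive term.
  · left
    rw [not_le] at h1 h2
    rw [Nat.cast_sub (errs_le z)] at h2
    have hε : 0 < η ^ 3 / 32 * M := by linarith [h.one_le]
    refine (affinity_le_exp h.c_pos h.w_pos h.c_le h.w_le hη hp (by linarith [h.p_le]) z hε h1.le
      h2.le).trans (le_add_of_nonneg_of_le (pow_nonneg hρ _) ?_)
    rw [Real.sqrt_mul (mixFactor_nonneg _ _)]
    refine mul_le_mul_of_nonneg_left (Real.le_sqrt_of_sq_le ?_) (Real.sqrt_nonneg _)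
    rw [← Real.exp_nat_mul]
    refine le_trans (Real.exp_le_exp.2 ?_) (le_mul_of_one_le_left (Real.exp_pos _).le one_le_two)
    push_cast
    have e1 : (η ^ 3 / 32) ^ 2 * M = η ^ 3 / 32 * (η ^ 3 / 32 * M) := by ring
    rw [e1]
    have e2 : η ^ 3 / 32 ≤ η ^ 2 / 4 := by nlinarith [sq_nonneg η]
    nlinarith [mul_le_mul_of_nonneg_right e2 hε.le]

end Typical


/-! ### Expected posterior mass away from the truth -/

section Posterior

variable {M : ℕ} {ι : Type*} [Fintype ι]

/-- Posterior mass of a set of candidates. -/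
noncomputable def postMass (c w : ι → ℕ) (u : ι → Fin M → Bool) (S : Finset (Fin M → Bool)) : ℝ :=
  (∑ z ∈ S, wt c w u z) / ∑ z, wt c w u z

theorem sum_wt_pos (c w : ι → ℕ) (u : ι → Fin M → Bool) : 0 < ∑ z, wt c w u z :=
  sum_pos (fun z _ => wt_pos c w u z) univ_nonempty

theorem postMass_nonneg (c w : ι → ℕ) (u : ι → Fin M → Bool) (S : Finset (Fin M → Bool)) :
    0 ≤ postMass c w u S :=
  div_nonneg (sum_nonneg fun z _ => (wt_pos c w u z).le) (sum_wt_pos c w u).le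

theorem abs_meanAgr_sub_le (c w : ι → ℕ) (u : ι → Fin M → Bool) (i : ι) :
    |meanAgr c w u i - agr (u i) fun _ => false| ≤
      M * postMass c w u (univ.erase fun _ => false) := by
  have hS := sum_wt_pos c w u
  unfold meanAgr postMass
  rw [div_sub' hS.ne', abs_div, abs_of_pos hS, mul_div_assoc']
  refine div_le_div_of_nonneg_right ?_ hS.le
  rw [sum_mul, ← sum_sub_distrib, ← add_sum_erase _ _ (mem_univ fun _ => false), sub_self, zero_add,
    mul_sum]
  refine (abs_sum_le_sum_abs _ _).trans (sum_le_sum fun z _ => ?_)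
  rw [← mul_sub, abs_mul, abs_of_pos (wt_pos c w u z), mul_comm]
  refine mul_le_mul_of_nonneg_right ?_ (wt_pos c w u z).le
  have h1 : (agr (u i) z : ℝ) ≤ M := by exact_mod_cast agr_le _ _
  have h2 : (agr (u i) (fun _ => false) : ℝ) ≤ M := by exact_mod_cast agr_le _ _
  rw [abs_le]
  constructor <;> linarith [(Nat.cast_nonneg (agr (u i) z) : (0 : ℝ) ≤ _),
    (Nat.cast_nonneg (agr (u i) fun _ => false) : (0 : ℝ) ≤ _)]

variable [DecidableEq ι]

/-- A posterior probability is at most the square root of the likelihood ratio to the truth, because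
both weights are below the total. The ratio is a product over independent sources, so its expected
root factorises into affinities. -/
theorem sum_prob_mul_post_le (c w : ι → ℕ) {p : ι → ℝ} (h0 : ∀ k, 0 ≤ p k) (h1 : ∀ k, p k ≤ 1)
    (z : Fin M → Bool) :
    ∑ u, prob p u * (wt c w u z / ∑ z', wt c w u z') ≤
      ∏ k, affinity M (c k) (w k) (p k) z := by
  unfold affinity
  rw [← sum_prod_pi fun k (v : Fin M → Bool) => (∏ j, bern (p k) (v j)) *
    Real.sqrt (betaWt M (c k) (w k) (agr v z) / betaWt M (c k) (w k) (agr v fun _ => false))]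
  refine sum_le_sum fun u _ => ?_
  rw [prod_mul_distrib]
  refine mul_le_mul_of_nonneg_left ?_ (prob_nonneg h0 h1 u)
  have hs : ∏ k, Real.sqrt (betaWt M (c k) (w k) (agr (u k) z) /
      betaWt M (c k) (w k) (agr (u k) fun _ => false)) =
      Real.sqrt (wt c w u z / wt c w u fun _ => false) := by
    unfold wt
    rw [← prod_div_distrib, Real.sqrt_prod _ fun k _ =>
      (div_pos (betaWt_pos _ _ _ _) (betaWt_pos _ _ _ _)).le]
  rw [hs]
  have hz := wt_pos c w u z
  have hz0 := wt_pos c w u fun _ => false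
  have hle : ∀ z, wt c w u z ≤ ∑ z', wt c w u z' := fun z =>
    single_le_sum (f := wt c w u) (fun z _ => (wt_pos c w u z).le) (mem_univ z)
  have hS := sum_wt_pos c w u
  have hle0 := hle fun _ => false
  have hlez := hle z
  clear hle hs
  generalize wt c w u (fun _ => false) = a at *
  generalize wt c w u z = b at *
  generalize ∑ z', wt c w u z' = S at *
  refine Real.le_sqrt_of_sq_le ?_
  rw [div_pow, div_le_div_iff₀ (by positivity) hz0, sq, sq]
  calc b * b * a = b * (b * a) := by ring
    _ ≤ b * (S * S) :=
        mul_le_mul_of_nonneg_left (mul_le_mul hlez hle0 hz0.le hS.le) hz.le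

theorem sum_prob_mul_postMass_le (c w : ι → ℕ) {p : ι → ℝ} (h0 : ∀ k, 0 ≤ p k)
    (h1 : ∀ k, p k ≤ 1) (S : Finset (Fin M → Bool)) :
    ∑ u : ι → Fin M → Bool, prob p u * postMass c w u S ≤ ∑ z ∈ S, ∏ k, affinity M (c k) (w k) (p k) z := by
  unfold postMass
  simp_rw [sum_div, mul_sum]
  rw [sum_comm]
  exact sum_le_sum fun z _ => sum_prob_mul_post_le c w h0 h1 z

/-- A family of admissible sources, all but two of which are informative. -/
structure Crowdlike (c w : ι → ℕ) (A M : ℕ) (p : ι → ℝ) (η : ℝ) (I : Finset ι) : Prop where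
  adm : ∀ k, Admissible (c k) (w k) A M (p k) η
  lt : ∀ k ∈ I, w k < c k
  half_le : ∀ k ∈ I, 1 / 2 + η ≤ p k
  card_compl : #Iᶜ = 2

/-- A slightly worse rate absorbs the additive error. Exponents never exceed `M + 1`, so comparing
with `ρ ^ (M + 1)` is enough. -/
theorem pow_add_le_pow {ρ' ρ s : ℝ} {k M : ℕ} (h0 : 0 ≤ ρ') (hρ : ρ' ≤ ρ) (h1 : ρ ≤ 1)
    (hs : s ≤ (ρ - ρ') * ρ ^ (M + 1)) (hk : 1 ≤ k) (hkM : k ≤ M + 1) : ρ' ^ k + s ≤ ρ ^ k := by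
  obtain ⟨d, rfl⟩ := Nat.exists_eq_add_of_le' hk
  have hρ0 : 0 ≤ ρ := h0.trans hρ
  have e1 : ρ' ^ d ≤ ρ ^ d := pow_le_pow_left₀ h0 hρ d
  have e2 : ρ ^ (M + 1) ≤ ρ ^ d := pow_le_pow_of_le_one hρ0 h1 (by omega)
  have e3 := mul_le_mul_of_nonneg_left e2 (sub_nonneg.2 hρ)
  have e4 := mul_le_mul_of_nonneg_left e1 h0
  rw [pow_succ, pow_succ]
  linarith

variable {c w : ι → ℕ} {A : ℕ} {p : ι → ℝ} {η : ℝ} {I : Finset ι}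

namespace Crowdlike

theorem p_nonneg (h : Crowdlike c w A M p η I) (k : ι) : 0 ≤ p k :=
  (h.adm k).η_pos.le.trans (h.adm k).p_ge

theorem p_le_one (h : Crowdlike c w A M p η I) (k : ι) : p k ≤ 1 :=
  (h.adm k).p_le.trans (by linarith [(h.adm k).η_pos])

theorem prod_affinity_le (h : Crowdlike c w A M p η I) {ρ : ℝ} (hρ : 1 - η ^ 2 / 4 ≤ ρ)
    (hρ1 : ρ ≤ 1) (hoff : Real.sqrt (mixFactor M A * (2 * Real.exp (-((η ^ 3 / 32) ^ 2 * M)))) ≤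
      (ρ - (1 - η ^ 2 / 4)) * ρ ^ (M + 1)) {z : Fin M → Bool} (hz : z ≠ fun _ => false) :
    ∏ k, affinity M (c k) (w k) (p k) z ≤
      mixFactor M A * (ρ ^ #I) ^ min (errs z) (M - errs z + 1) := by
  have hη : ∀ _k : ι, 0 ≤ 1 - η ^ 2 / 4 := fun k => by
    nlinarith [(h.adm k).η_pos, (h.adm k).η_le]
  have ha : ∀ k, 0 ≤ affinity M (c k) (w k) (p k) z := fun k =>
    affinity_nonneg (h.p_nonneg k) (h.p_le_one k) z
  have hpos : 1 ≤ errs z := by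
    refine Nat.one_le_iff_ne_zero.2 fun h0 => hz ?_
    unfold errs at h0
    rw [card_eq_zero, filter_eq_empty_iff] at h0
    funext j
    simpa using h0 (mem_univ j)
  rw [← prod_mul_prod_compl I, mul_comm]
  refine mul_le_mul ?_ ?_ (prod_nonneg fun k _ => ha k) (mixFactor_nonneg _ _)
  · calc ∏ k ∈ Iᶜ, affinity M (c k) (w k) (p k) z ≤ ∏ k ∈ Iᶜ, Real.sqrt (mixFactor M A) :=
          prod_le_prod (fun k _ => ha k) fun k _ => affinity_le_sqrt (h.adm k).c_pos
            (h.adm k).w_pos (h.adm k).c_le (h.adm k).w_le (h.p_nonneg k) (h.p_le_one k) z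
      _ = mixFactor M A := by
          rw [prod_const, h.card_compl, Real.sq_sqrt (mixFactor_nonneg _ _)]
  · rw [← pow_mul, mul_comm (#I), pow_mul, ← prod_const]
    refine prod_le_prod (fun k _ => ha k) fun k hk => ?_
    have hρ0 : 0 ≤ ρ := (hη k).trans hρ
    rcases affinity_le_pow (h.adm k) (h.lt k hk) (h.half_le k hk) z with h1 | h1
    · exact h1.trans ((pow_add_le_pow (hη k) hρ hρ1 hoff hpos
        (by have := errs_le z; omega)).trans
          (pow_le_pow_of_le_one hρ0 hρ1 (min_le_left _ _)))
    · exact h1.trans ((pow_add_le_pow (hη k) hρ hρ1 hoff (by omega)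
        (by omega)).trans (pow_le_pow_of_le_one hρ0 hρ1 (min_le_right _ _)))

end Crowdlike

theorem sum_pow_errs (M : ℕ) (x : ℝ) : ∑ z : Fin M → Bool, x ^ errs z = (1 + x) ^ M := by
  have h : ∀ z : Fin M → Bool, x ^ errs z = ∏ j, if z j then x else 1 := by
    intro z
    unfold errs
    rw [← prod_const, prod_filter]
  simp_rw [h]
  refine (sum_prod_pi fun (_ : Fin M) (b : Bool) => if b = true then x else 1).trans ?_
  simp [add_comm]

theorem sum_pow_sub_errs (M : ℕ) (x : ℝ) :
    ∑ z : Fin M → Bool, x ^ (M - errs z) = (1 + x) ^ M := by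
  rw [← sum_pow_errs]
  refine Fintype.sum_equiv (Function.Involutive.toPerm (fun z j => !z j) fun z => by simp) _ _
    fun z => ?_
  rw [← errs_not]
  rfl

namespace Crowdlike

/-- Expected posterior mass away from the truth. -/
theorem sum_prob_mul_postMass_ne_le (h : Crowdlike c w A M p η I) {ρ : ℝ}
    (hρ : 1 - η ^ 2 / 4 ≤ ρ) (hρ0 : 0 ≤ ρ) (hρ1 : ρ ≤ 1)
    (hoff : Real.sqrt (mixFactor M A * (2 * Real.exp (-((η ^ 3 / 32) ^ 2 * M)))) ≤
      (ρ - (1 - η ^ 2 / 4)) * ρ ^ (M + 1)) (hM : 1 ≤ M) (hx : M * ρ ^ #I ≤ 1) :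
    ∑ u : ι → Fin M → Bool, prob p u * postMass c w u (univ.erase fun _ => false) ≤
      mixFactor M A * (5 * (M * ρ ^ #I)) := by
  refine (sum_prob_mul_postMass_le c w h.p_nonneg h.p_le_one _).trans ?_
  refine (sum_le_sum fun z hz => h.prod_affinity_le hρ hρ1 hoff (ne_of_mem_erase hz)).trans ?_
  rw [← mul_sum]
  refine mul_le_mul_of_nonneg_left ?_ (mixFactor_nonneg _ _)
  set x := ρ ^ #I
  have hx0 : 0 ≤ x := pow_nonneg hρ0 _
  have hM1 : (1 : ℝ) ≤ M := by exact_mod_cast hM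
  have hx1 : x ≤ M * x := le_mul_of_one_le_left hx0 hM1
  have hxM : (1 + x) ^ M ≤ 1 + 2 * (M * x) := by
    calc (1 + x) ^ M ≤ Real.exp x ^ M :=
          pow_le_pow_left₀ (by linarith) (by linarith [Real.add_one_le_exp x]) M
      _ = Real.exp (M * x) := (Real.exp_nat_mul x M).symm
      _ ≤ 1 + M * x + (M * x) ^ 2 :=
          exp_le_one_add_add_sq (by rw [abs_of_nonneg (by positivity)]; exact hx)
      _ ≤ _ := by nlinarith [mul_nonneg (Nat.cast_nonneg M : (0 : ℝ) ≤ M) hx0]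
  -- The extra factor `x` on the complement side is what makes the term at the complement of the
  -- truth small.
  have hpt : ∀ z : Fin M → Bool, x ^ min (errs z) (M - errs z + 1) ≤
      x ^ errs z + x * x ^ (M - errs z) := by
    intro z
    rw [← pow_succ']
    rcases min_choice (errs z) (M - errs z + 1) with e | e <;> rw [e]
    · exact le_add_of_nonneg_right (pow_nonneg hx0 _)
    · exact le_add_of_nonneg_left (pow_nonneg hx0 _)
  have hsplit := add_sum_erase univ (fun z : Fin M → Bool => x ^ errs z)
    (mem_univ fun _ => false)
  rw [sum_pow_errs] at hsplit
  have h00 : errs (fun _ : Fin M => false) = 0 := by simp [errs]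
  simp only [h00, pow_zero] at hsplit
  calc ∑ z ∈ univ.erase fun _ => false, x ^ min (errs z) (M - errs z + 1)
      ≤ ∑ z ∈ univ.erase fun _ => false, (x ^ errs z + x * x ^ (M - errs z)) :=
        sum_le_sum fun z _ => hpt z
    _ ≤ ∑ z ∈ univ.erase fun _ => false, x ^ errs z + x * (1 + x) ^ M := by
        rw [sum_add_distrib, ← mul_sum, ← sum_pow_sub_errs]
        refine add_le_add le_rfl (mul_le_mul_of_nonneg_left (sum_le_sum_of_subset_of_nonneg
          (erase_subset _ _) fun z _ _ => pow_nonneg hx0 _) hx0)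
    _ ≤ _ := by nlinarith

/-- Expected posterior mass of the candidates far from the truth and from its complement. -/
theorem sum_prob_mul_postMass_far_le (h : Crowdlike c w A M p η I) {ρ : ℝ}
    (hρ : 1 - η ^ 2 / 4 ≤ ρ) (hρ0 : 0 ≤ ρ) (hρ1 : ρ ≤ 1)
    (hoff : Real.sqrt (mixFactor M A * (2 * Real.exp (-((η ^ 3 / 32) ^ 2 * M)))) ≤
      (ρ - (1 - η ^ 2 / 4)) * ρ ^ (M + 1)) {κ : ℕ} (hκ : 1 ≤ κ) :
    ∑ u : ι → Fin M → Bool, prob p u * postMass c w u {z | κ ≤ errs z ∧ κ ≤ M - errs z} ≤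
      mixFactor M A * (2 ^ M * (ρ ^ #I) ^ κ) := by
  refine (sum_prob_mul_postMass_le c w h.p_nonneg h.p_le_one _).trans ?_
  have hx0 : 0 ≤ ρ ^ #I := pow_nonneg hρ0 _
  have hx1 : ρ ^ #I ≤ 1 := pow_le_one₀ hρ0 hρ1
  calc _ ≤ ∑ z ∈ univ.filter (fun z : Fin M → Bool => κ ≤ errs z ∧ κ ≤ M - errs z),
        mixFactor M A * (ρ ^ #I) ^ κ := by
        refine sum_le_sum fun z hz => ?_
        rw [mem_filter] at hz
        have hz0 : z ≠ fun _ => false := by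
          rintro rfl
          have : errs (fun _ : Fin M => false) = 0 := by simp [errs]
          omega
        refine (h.prod_affinity_le hρ hρ1 hoff hz0).trans
          (mul_le_mul_of_nonneg_left (pow_le_pow_of_le_one hx0 hx1 ?_) (mixFactor_nonneg _ _))
        exact le_min hz.2.1 (by omega)
    -- A union bound over all candidates. It is affordable later, when `κ` is proportional to `M`
    -- and `ρ ^ #I` is tiny.
    _ ≤ 2 ^ M * (mixFactor M A * (ρ ^ #I) ^ κ) := by
        rw [sum_const, nsmul_eq_mul]
        refine mul_le_mul_of_nonneg_right ?_
          (mul_nonneg (mixFactor_nonneg _ _) (pow_nonneg hx0 _))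
        have := card_le_univ (univ.filter fun z : Fin M → Bool => κ ≤ errs z ∧ κ ≤ M - errs z)
        rw [Fintype.card_fun, Fintype.card_bool, Fintype.card_fin] at this
        exact_mod_cast this
    _ = _ := by ring

/-- Truthful labels pay off when the truth carries almost all posterior mass. -/
theorem le_sum_prob_meanAgr_sub_of_concentrated (h : Crowdlike c w A M p η I) {ρ : ℝ}
    (hρ : 1 - η ^ 2 / 4 ≤ ρ) (hρ0 : 0 ≤ ρ) (hρ1 : ρ ≤ 1)
    (hoff : Real.sqrt (mixFactor M A * (2 * Real.exp (-((η ^ 3 / 32) ^ 2 * M)))) ≤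
      (ρ - (1 - η ^ 2 / 4)) * ρ ^ (M + 1)) (hM : 1 ≤ M) (hx : M * ρ ^ #I ≤ 1)
    (i : ι) (j : Fin M) :
    1 - 2 * M / η * (mixFactor M A * (5 * (M * ρ ^ #I))) ≤
      ∑ u, prob p u * (meanAgr c w (setAt u i j true) i - meanAgr c w (setAt u i j false) i) := by
  have hη := (h.adm i).η_pos
  set F : (ι → Fin M → Bool) → ℝ := fun u => postMass c w u (univ.erase fun _ => false)
  have hF : ∀ u, 0 ≤ F u := fun u => postMass_nonneg _ _ _ _
  have hE := h.sum_prob_mul_postMass_ne_le hρ hρ0 hρ1 hoff hM hx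
  have hb : ∀ b, ∑ u, prob p u * F (setAt u i j b) ≤ (∑ u, prob p u * F u) / η := fun b =>
    sum_prob_mul_setAt_le h.p_nonneg h.p_le_one hη i (h.adm i).p_ge (h.adm i).p_le j b hF
  have hpt : ∀ u, 1 - M * (F (setAt u i j true) + F (setAt u i j false)) ≤
      meanAgr c w (setAt u i j true) i - meanAgr c w (setAt u i j false) i := by
    intro u
    have h1 := abs_le.1 (abs_meanAgr_sub_le c w (setAt u i j true) i)
    have h2 := abs_le.1 (abs_meanAgr_sub_le c w (setAt u i j false) i)
    have h3 : ∀ b, (agr (setAt u i j b i) (fun _ => false) : ℝ) =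
        agrOff j (u i) (fun _ => false) + ind b := by
      intro b
      rw [setAt_self, agr_eq j, agrOff_update_left]
      push_cast
      congr 1
      cases b <;> simp [ind]
    rw [h3] at h1 h2
    simp only [ind, if_true, Bool.false_eq_true, if_false] at h1 h2
    linarith [h1.1, h2.2]
  calc 1 - 2 * M / η * (mixFactor M A * (5 * (M * ρ ^ #I)))
      ≤ 1 - 2 * M / η * ∑ u, prob p u * F u :=
        sub_le_sub_left (mul_le_mul_of_nonneg_left hE (by positivity)) _
    _ = 1 - M * ((∑ u, prob p u * F u) / η + (∑ u, prob p u * F u) / η) := by ring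
    _ ≤ 1 - M * (∑ u, prob p u * F (setAt u i j true) +
          ∑ u, prob p u * F (setAt u i j false)) :=
        sub_le_sub_left (mul_le_mul_of_nonneg_left (add_le_add (hb true) (hb false))
          (Nat.cast_nonneg _)) _
    _ = ∑ u, prob p u * (1 - M * (F (setAt u i j true) + F (setAt u i j false))) := by
        simp_rw [mul_sub, mul_one]
        rw [← sum_add_distrib, mul_sum, sum_sub_distrib, sum_prob]
        congr 1
        exact sum_congr rfl fun u _ => by ring
    _ ≤ _ := sum_le_sum fun u _ =>
        mul_le_mul_of_nonneg_left (hpt u) (prob_nonneg h.p_nonneg h.p_le_one u)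

end Crowdlike

end Posterior


/-! ### Independence across tasks and across sources -/

section Marginals

variable {M : ℕ} {ι : Type*} [Fintype ι] [DecidableEq ι]

theorem sum_prob_mul_prod (p : ι → ℝ) (f : Fin M → (ι → Bool) → ℝ) :
    ∑ u : ι → Fin M → Bool, prob p u * ∏ l, f l (fun k => u k l) =
      ∏ l, ∑ x : ι → Bool, (∏ k, bern (p k) (x k)) * f l x := by
  rw [← sum_prod_pi fun l (x : ι → Bool) => (∏ k, bern (p k) (x k)) * f l x]
  refine Fintype.sum_equiv (Equiv.piComm fun (_ : ι) (_ : Fin M) => Bool) _ _ fun u => ?_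
  rw [prod_mul_distrib, prod_comm]
  rfl

theorem sum_prod_bern_mul_prod (p : ι → ℝ) (f : ι → Bool → ℝ) :
    ∑ x : ι → Bool, (∏ k, bern (p k) (x k)) * ∏ k, f k (x k) =
      ∏ k, (p k * f k true + (1 - p k) * f k false) := by
  simp_rw [← prod_mul_distrib]
  rw [sum_prod_pi fun k b => bern (p k) b * f k b]
  simp [bern]

theorem sum_prod_bern_eq_one (p : ι → ℝ) : ∑ x : ι → Bool, ∏ k, bern (p k) (x k) = 1 := by
  simpa using sum_prod_bern_mul_prod p fun _ _ => 1

theorem sum_prob_mul_column (p : ι → ℝ) (l : Fin M) (F : (ι → Bool) → ℝ) :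
    ∑ u : ι → Fin M → Bool, prob p u * F (fun k => u k l) =
      ∑ x : ι → Bool, (∏ k, bern (p k) (x k)) * F x := by
  have := sum_prob_mul_prod p fun (l' : Fin M) x => if l' = l then F x else 1
  rw [← mul_prod_erase univ _ (mem_univ l)] at this
  rw [prod_congr (g := fun _ => 1) rfl fun l' hl' => by
    simp [ne_of_mem_erase hl', sum_prod_bern_eq_one]] at this
  simpa using this

theorem sum_prob_mul_row (p : ι → ℝ) (k : ι) (F : (Fin M → Bool) → ℝ) :
    ∑ u : ι → Fin M → Bool, prob p u * F (u k) =
      ∑ v : Fin M → Bool, (∏ j, bern (p k) (v j)) * F v := by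
  have := sum_prod_pi fun k' (v : Fin M → Bool) =>
    (∏ j, bern (p k') (v j)) * if k' = k then F v else 1
  rw [← mul_prod_erase univ _ (mem_univ k)] at this
  rw [prod_congr (s₁ := univ.erase k) (g := fun _ => 1) rfl fun k' hk' => by
    simp only [ne_of_mem_erase hk', if_false, mul_one]
    rw [sum_prod_pi fun (_ : Fin M) b => bern (p k') b]
    exact prod_eq_one fun _ _ => sum_bern _] at this
  simp only [prod_mul_distrib, if_true, prod_const_one, mul_one] at this
  rw [← this]
  refine sum_congr rfl fun u _ => ?_
  simp [prob]

end Marginals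

/-! ### Error probability of one task from its correctness pattern -/

section ErrBound

variable {M : ℕ} {ι : Type*}

/-- Bound on the conditional error probability of a task with correctness pattern `x`. -/
noncomputable def errBound (p : ι → ℝ) (η : ℝ) (I : Finset ι) (x : ι → Bool) : ℝ :=
  min 1 (4 / η * ∏ k ∈ I, errFactor (p k) η (x k))

variable {c w : ι → ℕ} {A : ℕ} {p : ι → ℝ} {η : ℝ} {I : Finset ι}

/-- The frozen potentials of a family of sources. -/
noncomputable def logPots (M : ℕ) (c w : ι → ℕ) (p : ι → ℝ) (η : ℝ) (k : ι) : ℕ → ℝ :=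
  logPot M (c k) (w k) (p k) η

/-- The frozen complementation potentials of a family of sources. -/
noncomputable def complPots (M : ℕ) (c w : ι → ℕ) (p : ι → ℝ) (η : ℝ) (k : ι) : ℕ → ℝ :=
  complPot M (c k) (w k) (p k) η

theorem errBound_nonneg (hη : 0 < η) (x : ι → Bool) : 0 ≤ errBound p η I x :=
  le_min zero_le_one (mul_nonneg (by positivity) (prod_nonneg fun _ _ => errFactor_nonneg _ _ _))

theorem errBound_le_one (x : ι → Bool) : errBound p η I x ≤ 1 := min_le_left _ _

theorem errBound_congr {x y : ι → Bool} (h : ∀ k ∈ I, x k = y k) :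
    errBound p η I x = errBound p η I y := by
  unfold errBound
  rw [prod_congr rfl fun k hk => by rw [h k hk]]

variable [Fintype ι] [DecidableEq ι]

namespace Crowdlike

theorem abs_logPots_step_le (h : Crowdlike c w A M p η I) (k : ι) (l : ℕ) :
    |logPots M c w p η k (l + 1) - logPots M c w p η k l| ≤ Real.log (4 / η) := by
  unfold logPots
  rw [Admissible.logPot_step]
  exact (h.adm k).abs_log_betaRatio_le l

/-- A probability bounded by the odds and by one is also bounded by the square root of the odds. The
root is taken because its mean contracts per informative source, with the Bhattacharyya rate. -/
theorem condErr_le_errBound (h : Crowdlike c w A M p η I) [Nonempty ι] (u : ι → Fin M → Bool)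
    (l : Fin M) (z : Fin M → Bool) :
    condErr (potLaw (logPots M c w p η) u) l z ≤ errBound p η I (fun k => u k l) := by
  have hη := (h.adm (Classical.arbitrary ι)).η_pos
  set y := 4 / η * ∏ k ∈ I, errFactor (p k) η (u k l) with hy
  have hy0 : 0 ≤ y :=
    mul_nonneg (by positivity) (prod_nonneg fun _ _ => errFactor_nonneg _ _ _)
  refine (condErr_potLaw_le l z).trans ?_
  change _ ≤ min 1 y
  have hle : Real.exp (logOdds (logPots M c w p η) u l z) ≤ y ^ 2 := by
    unfold logOdds
    rw [Real.exp_sum, ← prod_mul_prod_compl I, hy, mul_pow, mul_comm, ← prod_pow]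
    refine mul_le_mul ?_ (prod_le_prod (fun _ _ => (Real.exp_pos _).le) fun k _ =>
      (h.adm k).exp_neg_sgn_le (u k l) (agrOff l (u k) z)) (prod_nonneg fun _ _ =>
        (Real.exp_pos _).le) (by positivity)
    -- The two remaining sources contribute at most `4 / η` each to the odds, hence `4 / η` in total
    -- after the root.
    have hc : (4 / η) ^ 2 = ∏ _k ∈ Iᶜ, 4 / η := by rw [prod_const, h.card_compl]
    rw [hc]
    refine prod_le_prod (fun _ _ => (Real.exp_pos _).le) fun k _ => ?_
    rw [← Real.exp_log (show 0 < 4 / η by positivity)]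
    refine Real.exp_le_exp.2 ((neg_le_abs _).trans ?_)
    rw [abs_mul]
    exact (mul_le_of_le_one_left (abs_nonneg _) (IsMeanField.abs_sgn _)).trans
      (h.abs_logPots_step_le k _)
  refine le_min (min_le_left _ _) ?_
  rcases le_total y 1 with h1 | h1
  · exact (min_le_right _ _).trans (hle.trans (by nlinarith))
  · exact (min_le_left _ _).trans h1

theorem sum_bern_mul_errBound_le (h : Crowdlike c w A M p η I) [Nonempty ι] :
    ∑ x : ι → Bool, (∏ k, bern (p k) (x k)) * errBound p η I x ≤
      4 / η * (1 - η ^ 2 / 4) ^ #I := by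
  have hη := (h.adm (Classical.arbitrary ι)).η_pos
  calc _ ≤ ∑ x : ι → Bool, (∏ k, bern (p k) (x k)) *
        (4 / η * ∏ k, if k ∈ I then errFactor (p k) η (x k) else 1) := by
        refine sum_le_sum fun x _ => mul_le_mul_of_nonneg_left ?_
          (prod_nonneg fun k _ => bern_nonneg (h.p_nonneg k) (h.p_le_one k) _)
        refine (min_le_right _ _).trans (le_of_eq ?_)
        rw [prod_ite_mem, univ_inter]
    _ = 4 / η * ∏ k, (p k * (if k ∈ I then errFactor (p k) η true else 1) +
          (1 - p k) * (if k ∈ I then errFactor (p k) η false else 1)) := by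
        rw [← sum_prod_bern_mul_prod p fun k b => if k ∈ I then errFactor (p k) η b else 1, mul_sum]
        exact sum_congr rfl fun x _ => by ring
    _ ≤ 4 / η * ∏ k, (if k ∈ I then 1 - η ^ 2 / 4 else 1) := by
        refine mul_le_mul_of_nonneg_left (prod_le_prod (fun k _ => ?_) fun k _ => ?_)
          (by positivity)
        · have := h.p_nonneg k
          have : 0 ≤ 1 - p k := sub_nonneg.2 (h.p_le_one k)
          have := errFactor_nonneg (p k) η
          have := this true
          have := errFactor_nonneg (p k) η false
          split_ifs <;> positivity
        · split_ifs with hk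
          · exact (h.adm k).sum_bern_mul_errFactor_le (h.half_le k hk)
          · exact le_of_eq (by ring)
    _ = _ := by rw [prod_ite_mem, univ_inter, prod_const]

theorem sum_prob_mul_errBound_le (h : Crowdlike c w A M p η I) [Nonempty ι] (l : Fin M) :
    ∑ u : ι → Fin M → Bool, prob p u * errBound p η I (fun k => u k l) ≤
      4 / η * (1 - η ^ 2 / 4) ^ #I := by
  rw [sum_prob_mul_column p l]
  exact h.sum_bern_mul_errBound_le

open Classical in
/-- Large deviations of the total error bound. -/
theorem sum_prob_errBound_gt_le (h : Crowdlike c w A M p η I) [Nonempty ι] (T : ℝ) :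
    ∑ u : ι → Fin M → Bool, prob p u *
        (if T < ∑ l, errBound p η I (fun k => u k l) then 1 else 0) ≤
      Real.exp (2 * M * (4 / η * (1 - η ^ 2 / 4) ^ #I) - T) := by
  have hη := (h.adm (Classical.arbitrary ι)).η_pos
  set s := 4 / η * (1 - η ^ 2 / 4) ^ #I
  have hb : ∀ x : ι → Bool, 0 ≤ ∏ k, bern (p k) (x k) := fun x =>
    prod_nonneg fun k _ => bern_nonneg (h.p_nonneg k) (h.p_le_one k) _
  have hcol : ∑ x : ι → Bool, (∏ k, bern (p k) (x k)) * Real.exp (errBound p η I x) ≤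
      Real.exp (2 * s) := by
    calc _ ≤ ∑ x : ι → Bool, ((∏ k, bern (p k) (x k)) +
          2 * ((∏ k, bern (p k) (x k)) * errBound p η I x)) := by
          refine sum_le_sum fun x _ => ?_
          have h0 := errBound_nonneg (p := p) (I := I) hη x
          have h1 := errBound_le_one (p := p) (η := η) (I := I) x
          have := exp_le_one_add_add_sq (x := errBound p η I x) (by rwa [abs_of_nonneg h0])
          have h2 : Real.exp (errBound p η I x) ≤ 1 + 2 * errBound p η I x := by nlinarith
          have := mul_le_mul_of_nonneg_left h2 (hb x)
          linarith
      _ ≤ 1 + 2 * s := by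
          rw [sum_add_distrib, sum_prod_bern_eq_one, ← mul_sum]
          linarith [h.sum_bern_mul_errBound_le]
      _ ≤ _ := by linarith [Real.add_one_le_exp (2 * s)]
  calc _ ≤ ∑ u : ι → Fin M → Bool, prob p u *
        ((∏ l, Real.exp (errBound p η I fun k => u k l)) * Real.exp (-T)) := by
        refine sum_le_sum fun u _ => mul_le_mul_of_nonneg_left ?_
          (prob_nonneg h.p_nonneg h.p_le_one u)
        rw [← Real.exp_sum, ← Real.exp_add]
        split_ifs with hT
        · exact Real.one_le_exp (by linarith)
        · exact (Real.exp_pos _).le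
    _ = (∏ _l : Fin M, ∑ x : ι → Bool, (∏ k, bern (p k) (x k)) *
          Real.exp (errBound p η I x)) * Real.exp (-T) := by
        rw [← sum_prob_mul_prod p fun (_ : Fin M) x => Real.exp (errBound p η I x), sum_mul]
        exact sum_congr rfl fun u _ => by ring
    _ ≤ (∏ _l : Fin M, Real.exp (2 * s)) * Real.exp (-T) := by
        refine mul_le_mul_of_nonneg_right (prod_le_prod (fun _ _ => sum_nonneg fun x _ =>
          mul_nonneg (hb x) (Real.exp_pos _).le) fun _ _ => hcol) (Real.exp_pos _).le
    _ = _ := by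
        rw [prod_const, card_univ, Fintype.card_fin, ← Real.exp_nat_mul, ← Real.exp_add]
        congr 1
        ring

end Crowdlike

end ErrBound

/-! ### Exponential moments of the number of errors -/

section Moment

variable {M : ℕ} {ι : Type*} [Fintype ι] {u : ι → Fin M → Bool} {μ : (Fin M → Bool) → ℝ} {κ : ℝ}
  {qb : Fin M → ℝ}

/-- The number of errors has the exponential moments of a sum of independent indicators. -/
theorem IsMeanField.Ex_exp_errs_le (h : IsMeanField u μ κ qb) :
    Ex μ (fun z => Real.exp (errs z)) ≤ Real.exp (2 * ∑ j, qb j) := by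
  have hμ : ∀ z, 0 ≤ μ z := fun z => (h.pos z).le
  have key : ∀ S : Finset (Fin M), Ex μ (fun z => ∏ j ∈ S, (1 + 2 * ind (z j))) ≤
      ∏ j ∈ S, (1 + 2 * qb j) := by
    intro S
    induction S using Finset.induction_on with
    | empty => simp [Ex_const h.sum_eq]
    | insert a S ha ih =>
      set Φ : (Fin M → Bool) → ℝ := fun z => ∏ j ∈ S, (1 + 2 * ind (z j)) with hΦdef
      have hΦ0 : ∀ z, 0 ≤ Φ z := fun z => prod_nonneg fun j _ => by
        linarith [IsMeanField.ind_nonneg (z j)]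
      have hΦ : ∀ z b, Φ (Function.update z a b) = Φ z := by
        intro z b
        refine prod_congr rfl fun j hj => ?_
        rw [Function.update_of_ne]
        rintro rfl
        exact ha hj
      rw [prod_insert ha]
      calc Ex μ (fun z => ∏ j ∈ insert a S, (1 + 2 * ind (z j)))
          = Ex μ (fun z => Φ z + 2 * (ind (z a) * Φ z)) := by
            congr 1
            funext z
            rw [prod_insert ha]
            ring
        _ = Ex μ Φ + 2 * Ex μ (fun z => condErr μ a z * Φ z) := by
            rw [Ex_add, Ex_const_mul, h.Ex_ind_mul a hΦ]
        _ ≤ Ex μ Φ + 2 * Ex μ (fun z => qb a * Φ z) := by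
            have := Ex_mono hμ fun z => mul_le_mul_of_nonneg_right (h.cond a z) (hΦ0 z)
            linarith
        _ = (1 + 2 * qb a) * Ex μ Φ := by rw [Ex_const_mul]; ring
        _ ≤ _ := mul_le_mul_of_nonneg_left ih (by linarith [h.bound_nonneg a])
  refine (Ex_mono hμ fun z => ?_).trans ((key univ).trans ?_)
  · have : ((errs z : ℕ) : ℝ) = ∑ j, ind (z j) := by
      unfold errs ind
      rw [card_filter]
      push_cast
      rfl
    rw [this, Real.exp_sum]
    refine prod_le_prod (fun _ _ => (Real.exp_pos _).le) fun j _ => ?_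
    cases z j
    · simp [ind]
    -- `exp` of an indicator is at most one plus twice the indicator, since `e < 3`.
    · have := Real.exp_one_lt_d9
      simp only [ind, if_true]
      linarith
  · rw [mul_sum, Real.exp_sum]
    refine prod_le_prod (fun j _ => by linarith [h.bound_nonneg j]) fun j _ => ?_
    linarith [Real.add_one_le_exp (2 * qb j)]

theorem IsMeanField.sum_errs_ge_le (h : IsMeanField u μ κ qb) (m : ℕ) :
    ∑ z with m ≤ errs z, μ z ≤ Real.exp (2 * (∑ j, qb j) - m) := by
  have hμ : ∀ z, 0 ≤ μ z := fun z => (h.pos z).le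
  have h1 := h.Ex_exp_errs_le
  rw [Real.exp_sub, le_div_iff₀ (Real.exp_pos _)]
  refine le_trans ?_ h1
  unfold Ex
  rw [sum_mul]
  refine (sum_le_sum fun z hz => mul_le_mul_of_nonneg_left (Real.exp_le_exp.2 ?_) (hμ z)).trans
    (sum_le_sum_of_subset_of_nonneg (filter_subset (fun z => m ≤ errs z) _)
      fun z _ _ => mul_nonneg (hμ z) (Real.exp_pos _).le)
  exact_mod_cast (mem_filter.1 hz).2

end Moment


/-! ### Comparing the posterior with the folded mean-field law -/

section Comparison

variable {M : ℕ} {ι : Type*} [Fintype ι]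

theorem abs_div_add_sub_div_le {X Y N Z m : ℝ} (hX0 : 0 ≤ X) (hX : X ≤ m * Y) (hN0 : 0 ≤ N)
    (hN : N ≤ m * Z) (hY : 0 < Y) (hZ : 0 ≤ Z) :
    |(X + N) / (Y + Z) - X / Y| ≤ m * (Z / (Y + Z)) := by
  have hYZ : 0 < Y + Z := by linarith
  have e : (X + N) / (Y + Z) - X / Y = (N * Y - X * Z) / (Y * (Y + Z)) := by
    field_simp
    ring
  rw [e, abs_div, abs_of_pos (mul_pos hY hYZ), div_le_iff₀ (mul_pos hY hYZ)]
  have e2 : m * (Z / (Y + Z)) * (Y * (Y + Z)) = m * Z * Y := by field_simp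
  rw [e2, abs_le]
  constructor <;> nlinarith [mul_nonneg hX0 hZ, mul_nonneg hN0 hY.le,
    mul_le_mul_of_nonneg_right hX hZ, mul_le_mul_of_nonneg_right hN hY.le]

theorem foldMean_eq_div (g h : ι → ℕ → ℝ) (u : ι → Fin M → Bool) (i : ι) :
    foldMean g h u i =
      (∑ z, potWt g u z * (agr (u i) z + potWt h u z * (M - agr (u i) z))) /
        ∑ z, potWt g u z * (1 + potWt h u z) := by
  have hS := sum_potWt_pos g u
  unfold foldMean Ex potLaw
  simp_rw [div_mul_eq_mul_div]
  rw [← sum_div, ← sum_div, div_div_div_cancel_right₀ hS.ne']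

/-- Candidates with fewer than `m` errors. -/
def nearSet (M m : ℕ) : Finset (Fin M → Bool) := {z | errs z < m}

/-- Candidates far from the truth and from its complement. -/
def farSet (M m : ℕ) : Finset (Fin M → Bool) := {z | m ≤ errs z ∧ m ≤ M - errs z}

/-- `2 * m ≤ M` keeps the neighbourhoods of the truth and of its complement disjoint, and
complementation carries one onto the other. -/
theorem sum_eq_near_add_far {m : ℕ} (hm : 2 * m ≤ M) (F : (Fin M → Bool) → ℝ) :
    ∑ z, F z = ∑ z ∈ nearSet M m, (F z + F fun j => !z j) + ∑ z ∈ farSet M m, F z := by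
  have hnot : ∑ z ∈ nearSet M m, F (fun j => !z j) =
      ∑ z with M - errs z < m, F z := by
    unfold nearSet
    rw [sum_filter, sum_filter]
    refine Fintype.sum_equiv (Function.Involutive.toPerm (fun z j => !z j) fun z => by simp) _ _
      fun z => ?_
    have := errs_not z
    have h2 := errs_le z
    change (if _ then _ else _) = if M - errs (fun j => !z j) < m then F (fun j => !z j) else 0
    rw [this, Nat.sub_sub_self h2]
  rw [sum_add_distrib, hnot]
  unfold nearSet farSet
  rw [sum_filter, sum_filter, sum_filter, ← sum_add_distrib, ← sum_add_distrib]
  refine sum_congr rfl fun z _ => ?_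
  have h2 := errs_le z
  split_ifs <;> first | omega | simp

variable [DecidableEq ι] {c w : ι → ℕ} {A : ℕ} {p : ι → ℝ} {η : ℝ} {I : Finset ι}

namespace Crowdlike

/-- On windowed data the posterior mean is close to the folded mean of the frozen potentials. -/
theorem abs_meanAgr_sub_foldMean_le (h : Crowdlike c w A M p η I) {m : ℕ} (hm1 : 1 ≤ m)
    (hm : 2 * m ≤ M) (u : ι → Fin M → Bool)
    (hwin : ∀ k z, errs z < m → winLo M (p k) η ≤ agr (u k) z ∧ agr (u k) z ≤ winHi M (p k) η)
    (hR : ∀ z, potWt (complPots M c w p η) u z ≤ 1) (i : ι) :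
    |meanAgr c w u i - foldMean (logPots M c w p η) (complPots M c w p η) u i| ≤
      M * postMass c w u (farSet M m) +
        2 * M * ∑ z with m ≤ errs z, potLaw (logPots M c w p η) u z := by
  set g := logPots M c w p η
  set k' := complPots M c w p η
  -- The constant between true and frozen weights on the window, the same for all near candidates;
  -- it cancels in the posterior mean.
  set K : ℝ := ∏ k, betaWt M (c k) (w k) (winLo M (p k) η) / Real.exp (g k (winLo M (p k) η))
  have hK : 0 < K := prod_pos fun k _ => div_pos (betaWt_pos _ _ _ _) (Real.exp_pos _)
  have hwt : ∀ z ∈ nearSet M m, wt c w u z = K * potWt g u z := by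
    intro z hz
    unfold wt potWt
    rw [Real.exp_sum, ← prod_mul_distrib]
    refine prod_congr rfl fun k _ => ?_
    obtain ⟨h1, h2⟩ := hwin k z (mem_filter.1 hz).2
    exact (h.adm k).betaWt_eq_exp_logPot h1 h2
  have hwt' : ∀ z ∈ nearSet M m, wt c w u (fun j => !z j) = K * (potWt g u z * potWt k' u z) := by
    intro z hz
    rw [← mul_assoc, ← hwt z hz]
    unfold wt potWt
    rw [Real.exp_sum, ← prod_mul_distrib]
    refine prod_congr rfl fun k _ => ?_
    obtain ⟨h1, h2⟩ := hwin k z (mem_filter.1 hz).2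
    rw [agr_not]
    exact Admissible.betaWt_compl_eq h1 h2
  have hagr : ∀ z, (0 : ℝ) ≤ agr (u i) z ∧ (agr (u i) z : ℝ) ≤ M := fun z =>
    ⟨Nat.cast_nonneg _, by exact_mod_cast agr_le _ _⟩
  have hagr' : ∀ z : Fin M → Bool, (agr (u i) (fun j => !z j) : ℝ) = M - agr (u i) z := by
    intro z
    rw [agr_not, Nat.cast_sub (agr_le _ _)]
  have hg := potWt_pos g u
  have hk := potWt_pos k' u
  set X := ∑ z ∈ nearSet M m, potWt g u z * (agr (u i) z + potWt k' u z * (M - agr (u i) z))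
  set Y := ∑ z ∈ nearSet M m, potWt g u z * (1 + potWt k' u z)
  have hterm : ∀ z, 0 ≤ potWt g u z * (agr (u i) z + potWt k' u z * (M - agr (u i) z)) ∧
      potWt g u z * (agr (u i) z + potWt k' u z * (M - agr (u i) z)) ≤
        M * (potWt g u z * (1 + potWt k' u z)) := by
    intro z
    obtain ⟨a1, a2⟩ := hagr z
    have a3 : 0 ≤ potWt k' u z * (M - agr (u i) z) := mul_nonneg (hk z).le (by linarith)
    have a4 : potWt k' u z * (M - agr (u i) z) ≤ potWt k' u z * M :=
      mul_le_mul_of_nonneg_left (by linarith) (hk z).le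
    refine ⟨mul_nonneg (hg z).le (by linarith), ?_⟩
    calc _ ≤ potWt g u z * (M * (1 + potWt k' u z)) :=
          mul_le_mul_of_nonneg_left (by linarith) (hg z).le
      _ = _ := by ring
  have hX0 : 0 ≤ X := sum_nonneg fun z _ => (hterm z).1
  have hXY : X ≤ M * Y := by
    rw [mul_sum]
    exact sum_le_sum fun z _ => (hterm z).2
  have hY : 0 < Y := sum_pos (fun z _ => mul_pos (hg z) (by linarith [hk z]))
    ⟨fun _ => false, mem_filter.2 ⟨mem_univ _, by simpa [errs] using Nat.lt_of_succ_le hm1⟩⟩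
  have hf : |meanAgr c w u i - X / Y| ≤ M * postMass c w u (farSet M m) := by
    have e1 : ∑ z, wt c w u z = K * Y + ∑ z ∈ farSet M m, wt c w u z := by
      rw [sum_eq_near_add_far hm, mul_sum]
      congr 1
      refine sum_congr rfl fun z hz => ?_
      rw [hwt z hz, hwt' z hz]
      ring
    have e2 : ∑ z, wt c w u z * agr (u i) z =
        K * X + ∑ z ∈ farSet M m, wt c w u z * agr (u i) z := by
      rw [sum_eq_near_add_far hm, mul_sum]
      congr 1
      refine sum_congr rfl fun z hz => ?_
      rw [hwt z hz, hwt' z hz, hagr']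
      ring
    unfold meanAgr postMass
    rw [e1, e2, ← mul_div_mul_left X Y hK.ne']
    refine abs_div_add_sub_div_le (by positivity) ?_ (sum_nonneg fun z _ =>
      mul_nonneg (wt_pos c w u z).le (hagr z).1) ?_ (by positivity) (sum_nonneg fun z _ =>
        (wt_pos c w u z).le)
    · linarith [mul_le_mul_of_nonneg_left hXY hK.le]
    · rw [mul_sum]
      refine sum_le_sum fun z _ => ?_
      rw [mul_comm]
      exact mul_le_mul_of_nonneg_right (hagr z).2 (wt_pos c w u z).le
  have hf' : |foldMean g k' u i - X / Y| ≤ 2 * M * ∑ z with m ≤ errs z, potLaw g u z := by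
    have hsplit : ∀ F : (Fin M → Bool) → ℝ,
        ∑ z, F z = ∑ z ∈ nearSet M m, F z + ∑ z with m ≤ errs z, F z := by
      intro F
      rw [← sum_filter_add_sum_filter_not univ (fun z => errs z < m)]
      simp only [not_lt]
      rfl
    rw [foldMean_eq_div, hsplit fun z => potWt g u z *
      (agr (u i) z + potWt k' u z * (M - agr (u i) z)),
      hsplit fun z => potWt g u z * (1 + potWt k' u z)]
    have hZ0 : 0 ≤ ∑ z with m ≤ errs z, potWt g u z * (1 + potWt k' u z) :=
      sum_nonneg fun z _ => mul_nonneg (hg z).le (by linarith [hk z])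
    refine (abs_div_add_sub_div_le hX0 hXY (sum_nonneg fun z _ => (hterm z).1) ?_ hY hZ0).trans ?_
    · rw [mul_sum]
      exact sum_le_sum fun z _ => (hterm z).2
    · rw [mul_comm 2, mul_assoc]
      refine mul_le_mul_of_nonneg_left ?_ (Nat.cast_nonneg _)
      rw [← hsplit fun z => potWt g u z * (1 + potWt k' u z)]
      have hS := sum_potWt_pos g u
      have hle : ∑ z, potWt g u z ≤ ∑ z, potWt g u z * (1 + potWt k' u z) :=
        sum_le_sum fun z _ => le_mul_of_one_le_right (hg z).le (by linarith [hk z])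
      have hle2 : ∑ z with m ≤ errs z, potWt g u z * (1 + potWt k' u z) ≤
          2 * ∑ z with m ≤ errs z, potWt g u z := by
        rw [mul_sum]
        refine sum_le_sum fun z _ => ?_
        rw [mul_comm]
        exact mul_le_mul_of_nonneg_right (by linarith [hR z]) (hg z).le
      unfold potLaw
      rw [← sum_div, mul_div_assoc']
      exact div_le_div₀ (mul_nonneg zero_le_two (sum_nonneg fun z _ => (hg z).le)) hle2 hS hle
  have e : meanAgr c w u i - foldMean g k' u i =
      (meanAgr c w u i - X / Y) - (foldMean g k' u i - X / Y) := by ring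
  rw [e]
  exact (abs_sub _ _).trans (add_le_add hf hf')

/-- The two sources outside `I` may favour the complement, but only by a constant; each informative
source costs it a factor `1 - η`. Freezing makes this hold for all data. -/
theorem potWt_complPots_le (h : Crowdlike c w A M p η I) [Nonempty ι] (u : ι → Fin M → Bool)
    (z : Fin M → Bool) :
    potWt (complPots M c w p η) u z ≤ (4 / η) ^ (2 * A) * (1 - η) ^ #I := by
  have hη := (h.adm (Classical.arbitrary ι)).η_pos
  have hη4 := (h.adm (Classical.arbitrary ι)).η_le
  unfold potWt
  rw [Real.exp_sum, ← prod_mul_prod_compl I, mul_comm]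
  refine mul_le_mul ?_ ?_ (prod_nonneg fun _ _ => (Real.exp_pos _).le) (by positivity)
  · have hc : (4 / η) ^ (2 * A) = ∏ _k ∈ Iᶜ, (4 / η) ^ A := by
      rw [prod_const, h.card_compl, mul_comm, pow_mul]
    rw [hc]
    exact prod_le_prod (fun _ _ => (Real.exp_pos _).le) fun k _ => (h.adm k).exp_complPot_le _
  · rw [← prod_const]
    exact prod_le_prod (fun _ _ => (Real.exp_pos _).le) fun k hk =>
      (h.adm k).exp_complPot_le_of_lt (h.lt k hk) (h.half_le k hk) _

/-- `errBound` sees only the informative sources, so the same bounds hold for both values of a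
flipped label of a source outside `I`. -/
theorem isMeanField (h : Crowdlike c w A M p η I) [Nonempty ι] {u u' : ι → Fin M → Bool}
    (hu : ∀ k ∈ I, u' k = u k) :
    IsMeanField u' (potLaw (logPots M c w p η) u') (4 * A / (η * M))
      (fun l => errBound p η I fun k => u k l) := by
  have hη := (h.adm (Classical.arbitrary ι)).η_pos
  refine potLaw_isMeanField (fun k => (h.adm k).abs_logPot_step_sub_le) (by positivity)
    fun l z => (h.condErr_le_errBound u' l z).trans (le_of_eq (errBound_congr fun k hk => ?_))
  rw [hu k hk]

end Crowdlike

end Comparison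


/-! ### Gain of a correct label when tasks are numerous -/

section MeanField

variable {M : ℕ} {ι : Type*} [Fintype ι]

theorem abs_agr_update_sub_le (v z : Fin M → Bool) (j : Fin M) (b : Bool) :
    |(agr (Function.update v j b) z : ℝ) - agr v z| ≤ 1 := by
  rw [agr_eq j, agr_eq j v, agrOff_update_left]
  split_ifs <;> norm_num

theorem meanAgr_mem (c w : ι → ℕ) (u : ι → Fin M → Bool) (i : ι) :
    0 ≤ meanAgr c w u i ∧ meanAgr c w u i ≤ M := by
  unfold meanAgr
  have hS := sum_wt_pos c w u
  refine ⟨div_nonneg (sum_nonneg fun z _ => mul_nonneg (wt_pos c w u z).le (Nat.cast_nonneg _))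
    hS.le, (div_le_iff₀ hS).2 ?_⟩
  rw [mul_sum]
  refine sum_le_sum fun z _ => ?_
  rw [mul_comm]
  exact mul_le_mul_of_nonneg_right (by exact_mod_cast agr_le _ _) (wt_pos c w u z).le

variable [DecidableEq ι] {c w : ι → ℕ} {A : ℕ} {p : ι → ℝ} {η : ℝ} {I : Finset ι}

namespace Crowdlike

/-- The three units of the window are spent on the deviation of typical data, on fewer than `m`
errors, and on the flipped label. -/
theorem win_setAt (h : Crowdlike c w A M p η I) {m : ℕ} (hm : (m : ℝ) ≤ η ^ 3 / 32 * M + 1)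
    {u : ι → Fin M → Bool} (hu : ∀ k, IsTypical (p k) (η ^ 3 / 32) (u k)) (i : ι) (j : Fin M)
    (b : Bool) (k : ι) (z : Fin M → Bool) (hz : errs z < m) :
    winLo M (p k) η ≤ agr (setAt u i j b k) z ∧ agr (setAt u i j b k) z ≤ winHi M (p k) η := by
  refine Admissible.mem_win ?_
  have hz' : (errs z : ℝ) + 1 ≤ m := by exact_mod_cast hz
  have h1 : |(agr (setAt u i j b k) z : ℝ) - agr (u k) z| ≤ 1 := by
    by_cases hk : k = i
    · subst hk
      rw [setAt_self]
      exact abs_agr_update_sub_le _ _ _ _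
    · rw [setAt_apply_ne _ _ _ _ hk]
      simp
  have h2 := abs_agr_sub_agr_zero_le (u k) z
  have h3 := hu k
  unfold IsTypical at h3
  have h4 := (h.adm k).one_le
  obtain ⟨a1, a2⟩ := abs_le.1 h1
  obtain ⟨b1, b2⟩ := abs_le.1 h2
  obtain ⟨d1, d2⟩ := abs_le.1 h3
  rw [abs_le]
  constructor <;> linarith

/-- On typical data, a truthful label increases the posterior mean by almost one. -/
theorem le_meanAgr_sub (h : Crowdlike c w A M p η I) {m : ℕ} (hm1 : 1 ≤ m)
    (hm : 2 * m ≤ M) (hmε : (m : ℝ) ≤ η ^ 3 / 32 * M + 1) {T Rm d : ℝ}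
    (hR : (4 / η) ^ (2 * A) * (1 - η) ^ #I ≤ Rm) (hR1 : Rm ≤ 1)
    (hs : Fintype.card ι * (4 * A / (η * M)) * T ≤ 1 / 4)
    (hd : 4 * A / (η * M) * (64 * (Fintype.card ι : ℝ) ^ 2 * (T + 1)) ≤ d)
    {i : ι} (hi : i ∉ I) (j : Fin M) {u : ι → Fin M → Bool}
    (hu : ∀ k, IsTypical (p k) (η ^ 3 / 32) (u k))
    (hQ : ∑ l, errBound p η I (fun k => u k l) ≤ T) :
    1 - (2 * errBound p η I (fun k => u k j) +
        ((5 / 2 + 4 * A / η) * (4 / η) ^ 2 * d + 2 * Rm * (1 + Fintype.card ι * (4 * A / η))) +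
        M * (postMass c w (setAt u i j true) (farSet M m) +
          postMass c w (setAt u i j false) (farSet M m)) +
        4 * M * Real.exp (2 * T - m)) ≤
      meanAgr c w (setAt u i j true) i - meanAgr c w (setAt u i j false) i := by
  have : Nonempty ι := ⟨i⟩
  have hη := (h.adm i).η_pos
  have hη4 := (h.adm i).η_le
  have hM := (h.adm i).M_pos
  set κ := 4 * A / (η * M) with hκ
  have hκ0 : 0 ≤ κ := by positivity
  have hMκ : M * κ = 4 * A / η := by rw [hκ]; field_simp
  have hmf : ∀ b, IsMeanField (setAt u i j b) (potLaw (logPots M c w p η) (setAt u i j b)) κ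
      (fun l => errBound p η I fun k => u k l) := fun b =>
    h.isMeanField fun k hk => setAt_apply_ne _ _ _ _ fun e => hi (e ▸ hk)
  have hD : ∀ b, meanSqDist (setAt u i j b) (potLaw (logPots M c w p η) (setAt u i j b)) ≤
      64 * (Fintype.card ι : ℝ) ^ 2 * (T + 1) := by
    intro b
    refine ((hmf b).meanSqDist_le (le_trans ?_ hs)).trans ?_
    · exact mul_le_mul_of_nonneg_left hQ (by positivity)
    · exact mul_le_mul_of_nonneg_left (by linarith) (by positivity)
  have hRm : ∀ (u : ι → Fin M → Bool) z, potWt (complPots M c w p η) u z ≤ Rm := fun u z =>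
    (h.potWt_complPots_le u z).trans hR
  have hfold := le_foldMean_sub (g := logPots M c w p η) (h := complPots M c w p η)
    (fun k => (h.adm k).abs_logPot_step_sub_le)
    (fun k => (h.adm k).abs_complPot_sub_le) hRm hR1 (h.abs_logPots_step_le i) hmf hD
  have hcmp : ∀ b, |meanAgr c w (setAt u i j b) i -
      foldMean (logPots M c w p η) (complPots M c w p η) (setAt u i j b) i| ≤
      M * postMass c w (setAt u i j b) (farSet M m) + 2 * M * Real.exp (2 * T - m) := by
    intro b
    refine (h.abs_meanAgr_sub_foldMean_le hm1 hm _ (h.win_setAt hmε hu i j b)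
      (fun z => (hRm _ z).trans hR1) i).trans ?_
    refine add_le_add le_rfl (mul_le_mul_of_nonneg_left
      (((hmf b).sum_errs_ge_le m).trans (Real.exp_le_exp.2 (by linarith))) (by positivity))
  have hB : Real.exp (2 * Real.log (4 / η)) = (4 / η) ^ 2 := by
    rw [mul_comm, Real.exp_mul, Real.exp_log (by positivity)]
    norm_cast
  rw [hB, mul_assoc (3 / 2 * (4 / η) ^ 2), mul_assoc ((4 / η) ^ 2 * (M * κ)), hMκ] at hfold
  have he : 1 ≤ (4 / η) ^ 2 := one_le_pow₀ (by rw [le_div_iff₀ hη]; linarith)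
  have hL : 0 ≤ 4 * A / η := by positivity
  have hd0 : 0 ≤ κ * (64 * (Fintype.card ι : ℝ) ^ 2 * (T + 1)) := by
    refine mul_nonneg hκ0 (mul_nonneg (by positivity) ?_)
    have : 0 ≤ ∑ l, errBound p η I (fun k => u k l) := sum_nonneg fun l _ => errBound_nonneg hη _
    linarith
  have hErr : 3 / 2 * (4 / η) ^ 2 * (κ * (64 * (Fintype.card ι : ℝ) ^ 2 * (T + 1))) +
      κ * (64 * (Fintype.card ι : ℝ) ^ 2 * (T + 1)) +
      (4 / η) ^ 2 * (4 * A / η) * (κ * (64 * (Fintype.card ι : ℝ) ^ 2 * (T + 1))) ≤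
      (5 / 2 + 4 * A / η) * (4 / η) ^ 2 * d := by
    refine le_trans (le_trans (b := (5 / 2 + 4 * A / η) * (4 / η) ^ 2 *
      (κ * (64 * (Fintype.card ι : ℝ) ^ 2 * (T + 1)))) ?_ le_rfl)
      (mul_le_mul_of_nonneg_left hd (by positivity))
    have := mul_le_mul_of_nonneg_right he hd0
    nlinarith
  have c1 := (abs_le.1 (hcmp true)).1
  have c2 := (abs_le.1 (hcmp false)).2
  linarith

open Classical in
/-- Truthful labels pay off when there are many more tasks than sources. -/
theorem le_sum_prob_meanAgr_sub_of_mean_field (h : Crowdlike c w A M p η I) {ρ : ℝ}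
    (hρ : 1 - η ^ 2 / 4 ≤ ρ) (hρ0 : 0 ≤ ρ) (hρ1 : ρ ≤ 1)
    (hoff : Real.sqrt (mixFactor M A * (2 * Real.exp (-((η ^ 3 / 32) ^ 2 * M)))) ≤
      (ρ - (1 - η ^ 2 / 4)) * ρ ^ (M + 1)) {m : ℕ} (hm1 : 1 ≤ m)
    (hm : 2 * m ≤ M) (hmε : (m : ℝ) ≤ η ^ 3 / 32 * M + 1) {T Rm d : ℝ} (hT : 0 ≤ T)
    (hR : (4 / η) ^ (2 * A) * (1 - η) ^ #I ≤ Rm) (hR1 : Rm ≤ 1)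
    (hs : Fintype.card ι * (4 * A / (η * M)) * T ≤ 1 / 4)
    (hd : 4 * A / (η * M) * (64 * (Fintype.card ι : ℝ) ^ 2 * (T + 1)) ≤ d)
    {i : ι} (hi : i ∉ I) (j : Fin M) :
    1 - (2 * (4 / η * (1 - η ^ 2 / 4) ^ #I) +
        ((5 / 2 + 4 * A / η) * (4 / η) ^ 2 * d + 2 * Rm * (1 + Fintype.card ι * (4 * A / η))) +
        2 * M / η * (mixFactor M A * (2 ^ M * (ρ ^ #I) ^ m)) +
        4 * M * Real.exp (2 * T - m) +
        (M + 1) * (Fintype.card ι * (2 * Real.exp (-((η ^ 3 / 32) ^ 2 * M))) +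
          Real.exp (2 * M * (4 / η * (1 - η ^ 2 / 4) ^ #I) - T))) ≤
      ∑ u, prob p u * (meanAgr c w (setAt u i j true) i - meanAgr c w (setAt u i j false) i) := by
  have : Nonempty ι := ⟨i⟩
  have hη := (h.adm i).η_pos
  have hη4 := (h.adm i).η_le
  have hM := (h.adm i).M_pos
  set err := (5 / 2 + 4 * A / η) * (4 / η) ^ 2 * d + 2 * Rm * (1 + Fintype.card ι * (4 * A / η))
  have hd0 : 0 ≤ d := le_trans (by positivity) hd
  have hRm0 : 0 ≤ Rm := le_trans (mul_nonneg (by positivity)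
    (pow_nonneg (by linarith) _)) hR
  have herr : 0 ≤ err := by positivity
  set F : (ι → Fin M → Bool) → ℝ := fun u => postMass c w u (farSet M m)
  have hF : ∀ u, 0 ≤ F u := fun u => postMass_nonneg _ _ _ _
  set q : (ι → Fin M → Bool) → ℝ := fun u => errBound p η I (fun k => u k j)
  have hq : ∀ u, 0 ≤ q u := fun u => errBound_nonneg hη _
  set X : ι → (ι → Fin M → Bool) → ℝ := fun k u =>
    if IsTypical (p k) (η ^ 3 / 32) (u k) then 0 else 1
  set Y : (ι → Fin M → Bool) → ℝ := fun u =>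
    if T < ∑ l, errBound p η I (fun k => u k l) then 1 else 0
  have hX : ∀ k u, 0 ≤ X k u := fun k u => by
    simp only [X]; split_ifs <;> norm_num
  have hY : ∀ u, 0 ≤ Y u := fun u => by
    simp only [Y]; split_ifs <;> norm_num
  have hXs : ∀ u, 0 ≤ ∑ k, X k u := fun u => sum_nonneg fun k _ => hX k u
  have hM1 : (0 : ℝ) ≤ M + 1 := by linarith
  have hpt : ∀ u, 1 - (2 * q u + err + M * (F (setAt u i j true) + F (setAt u i j false)) +
      4 * M * Real.exp (2 * T - m) + (M + 1) * (∑ k, X k u + Y u)) ≤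
      meanAgr c w (setAt u i j true) i - meanAgr c w (setAt u i j false) i := by
    intro u
    by_cases hgood : (∀ k, IsTypical (p k) (η ^ 3 / 32) (u k)) ∧
        ∑ l, errBound p η I (fun k => u k l) ≤ T
    · have := h.le_meanAgr_sub hm1 hm hmε hR hR1 hs hd hi j hgood.1 hgood.2
      have h2 := mul_nonneg hM1 (add_nonneg (hXs u) (hY u))
      simp only [F, q, err]
      linarith
    -- On bad data the difference of posterior means is only known to be at least `-M`, so a weight
    -- `M + 1` on the bad event covers the claim.
    · have hbad : 1 ≤ ∑ k, X k u + Y u := by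
        rw [not_and_or, not_forall, not_le] at hgood
        rcases hgood with ⟨k, hk⟩ | hlt
        · have : X k u = 1 := if_neg hk
          have h3 := single_le_sum (f := fun k => X k u) (fun k _ => hX k u) (mem_univ k)
          linarith [hY u]
        · have : Y u = 1 := if_pos hlt
          linarith [hXs u]
      have h1 := (meanAgr_mem c w (setAt u i j true) i).1
      have h2 := (meanAgr_mem c w (setAt u i j false) i).2
      have h3 := mul_le_mul_of_nonneg_left hbad hM1
      have h4 := mul_nonneg hM.le (add_nonneg (hF (setAt u i j true)) (hF (setAt u i j false)))
      have h5 : 0 ≤ 4 * M * Real.exp (2 * T - m) := by positivity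
      linarith [hq u]
  have hp0 := prob_nonneg (M := M) h.p_nonneg h.p_le_one
  have e1 : ∑ u, prob p u * q u ≤ 4 / η * (1 - η ^ 2 / 4) ^ #I := h.sum_prob_mul_errBound_le j
  have e2 : ∀ b, ∑ u, prob p u * F (setAt u i j b) ≤
      mixFactor M A * (2 ^ M * (ρ ^ #I) ^ m) / η := fun b =>
    (sum_prob_mul_setAt_le h.p_nonneg h.p_le_one hη i (h.adm i).p_ge (h.adm i).p_le j b hF).trans
      (div_le_div_of_nonneg_right (h.sum_prob_mul_postMass_far_le hρ hρ0 hρ1 hoff hm1) hη.le)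
  have e3 : ∀ k, ∑ u, prob p u * X k u ≤ 2 * Real.exp (-((η ^ 3 / 32) ^ 2 * M)) := by
    intro k
    have hc3 := (h.adm k).cube_le
    have := sum_prob_mul_row p k fun v : Fin M → Bool =>
      if IsTypical (p k) (η ^ 3 / 32) v then (0 : ℝ) else 1
    exact this.trans_le (sum_bern_not_typical_le (h.p_nonneg k) (h.p_le_one k) (by positivity)
      (by linarith))
  have e4 : ∑ u, prob p u * Y u ≤
      Real.exp (2 * M * (4 / η * (1 - η ^ 2 / 4) ^ #I) - T) := h.sum_prob_errBound_gt_le T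
  have e5 : ∑ u, prob p u * ∑ k, X k u ≤
      Fintype.card ι * (2 * Real.exp (-((η ^ 3 / 32) ^ 2 * M))) := by
    simp_rw [mul_sum]
    rw [sum_comm]
    refine (sum_le_sum fun k _ => e3 k).trans (le_of_eq ?_)
    rw [sum_const, card_univ, nsmul_eq_mul]
  have hsum : ∑ u, prob p u * (1 - (2 * q u + err + M * (F (setAt u i j true) +
      F (setAt u i j false)) + 4 * M * Real.exp (2 * T - m) + (M + 1) * (∑ k, X k u + Y u))) =
      1 - (2 * ∑ u, prob p u * q u + err + M * (∑ u, prob p u * F (setAt u i j true) +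
        ∑ u, prob p u * F (setAt u i j false)) + 4 * M * Real.exp (2 * T - m) +
        (M + 1) * (∑ u, prob p u * ∑ k, X k u + ∑ u, prob p u * Y u)) := by
    have hone := sum_prob (M := M) p
    have hterm : ∀ u, prob p u * (1 - (2 * q u + err + M * (F (setAt u i j true) +
        F (setAt u i j false)) + 4 * M * Real.exp (2 * T - m) + (M + 1) * (∑ k, X k u + Y u))) =
        prob p u * (1 - err - 4 * M * Real.exp (2 * T - m)) - 2 * (prob p u * q u) -
        M * (prob p u * F (setAt u i j true)) - M * (prob p u * F (setAt u i j false)) -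
        (M + 1) * (prob p u * ∑ k, X k u) - (M + 1) * (prob p u * Y u) := fun u => by ring
    simp_rw [hterm]
    simp only [sum_sub_distrib, ← mul_sum, ← sum_mul, hone]
    ring
  refine le_trans ?_ (hsum.symm.le.trans (sum_le_sum fun u _ =>
    mul_le_mul_of_nonneg_left (hpt u) (hp0 u)))
  have g1 := mul_le_mul_of_nonneg_left (add_le_add (e2 true) (e2 false)) hM.le
  have g2 := mul_le_mul_of_nonneg_left (add_le_add e5 e4) hM1
  have g3 : M * (mixFactor M A * (2 ^ M * (ρ ^ #I) ^ m) / η +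
      mixFactor M A * (2 ^ M * (ρ ^ #I) ^ m) / η) =
      2 * M / η * (mixFactor M A * (2 ^ M * (ρ ^ #I) ^ m)) := by ring
  linarith

end Crowdlike

end MeanField


/-! ### Choice of thresholds -/

section Asymptotics

open Filter

theorem tendsto_add_two_pow_mul_pow (k : ℕ) {ρ : ℝ} (h0 : 0 < ρ) (h1 : ρ < 1) :
    Tendsto (fun r : ℕ => ((r : ℝ) + 2) ^ k * ρ ^ r) atTop (nhds 0) := by
  have h := ((tendsto_pow_const_mul_const_pow_of_abs_lt_one k
    (by rwa [abs_of_pos h0] : |ρ| < 1)).comp (tendsto_add_atTop_nat 2)).const_mul (ρ ^ 2)⁻¹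
  rw [mul_zero] at h
  refine h.congr fun r => ?_
  simp only [Function.comp_apply, pow_add]
  push_cast
  field_simp

theorem mixFactor_le {M : ℕ} (hM : 1 ≤ M) (A : ℕ) :
    mixFactor M A ≤ (2 * A + 1) ^ (2 * A) * (M : ℝ) ^ (2 * A) := by
  unfold mixFactor
  rw [← mul_pow]
  have : (1 : ℝ) ≤ M := by exact_mod_cast hM
  have hA : (0 : ℝ) ≤ A := Nat.cast_nonneg _
  exact pow_le_pow_left₀ (by positivity) (by nlinarith) _

theorem tendsto_pow_mul_mixFactor_mul_pow (k A : ℕ) {q : ℝ} (h0 : 0 < q) (h1 : q < 1) :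
    Tendsto (fun M : ℕ => (M : ℝ) ^ k * mixFactor M A * q ^ M) atTop (nhds 0) := by
  have h := (tendsto_pow_const_mul_const_pow_of_abs_lt_one (k + 2 * A)
    (by rwa [abs_of_pos h0] : |q| < 1)).const_mul ((2 * A + 1 : ℝ) ^ (2 * A))
  rw [mul_zero] at h
  refine squeeze_zero' (Eventually.of_forall fun M => ?_) ?_ h
  · have := mixFactor_nonneg M A
    positivity
  · filter_upwards [eventually_ge_atTop 1] with M hM
    calc _ ≤ (M : ℝ) ^ k * ((2 * A + 1) ^ (2 * A) * (M : ℝ) ^ (2 * A)) * q ^ M := by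
          gcongr
          exact mixFactor_le hM A
      _ = _ := by rw [pow_add]; ring

theorem eventually_le_of_tendsto_zero {f : ℕ → ℝ} (h : Tendsto f atTop (nhds 0)) {δ : ℝ}
    (hδ : 0 < δ) : ∀ᶠ n in atTop, f n ≤ δ :=
  (h.eventually (gt_mem_nhds hδ)).mono fun _ h => h.le

/-- A common contraction rate for all informative sources. -/
theorem exists_rate (A : ℕ) {η : ℝ} (hη : 0 < η) :
    ∃ ρ : ℝ, 1 - η ^ 2 / 4 ≤ ρ ∧ 0 < ρ ∧ ρ < 1 ∧ ∀ᶠ M : ℕ in atTop,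
      Real.sqrt (mixFactor M A * (2 * Real.exp (-((η ^ 3 / 32) ^ 2 * M)))) ≤
        (ρ - (1 - η ^ 2 / 4)) * ρ ^ (M + 1) := by
  set ε := η ^ 3 / 32 with hε
  have hε0 : 0 < ε := by positivity
  -- The first entry leaves a gap of `η ^ 2 / 8` above the true rate. The second makes `ρ ^ M` decay
  -- no faster than `exp (-(ε ^ 2 * M) / 4)`, hence more slowly than the large-deviation term.
  set ρ := max (1 - η ^ 2 / 8) (Real.exp (-(ε ^ 2 / 4)))
  have h1 : 1 - η ^ 2 / 8 ≤ ρ := le_max_left _ _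
  have h2 : Real.exp (-(ε ^ 2 / 4)) ≤ ρ := le_max_right _ _
  have hη2 : 0 < η ^ 2 := by positivity
  have hρ0 : 0 < ρ := (Real.exp_pos _).trans_le h2
  have hq : Real.exp (-(ε ^ 2 / 2)) < 1 := Real.exp_lt_one_iff.2 (by nlinarith [sq_pos_of_pos hε0])
  refine ⟨ρ, by linarith, hρ0, max_lt (by linarith)
    (Real.exp_lt_one_iff.2 (by nlinarith [sq_pos_of_pos hε0])), ?_⟩
  have hpos : 0 < (η ^ 2 / 8 * ρ) ^ 2 / 2 := by positivity
  filter_upwards [eventually_le_of_tendsto_zero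
    (tendsto_pow_mul_mixFactor_mul_pow 0 A (Real.exp_pos _) hq) hpos] with M hM
  rw [pow_zero, one_mul] at hM
  have h3 : 0 ≤ ρ - (1 - η ^ 2 / 4) := by linarith
  refine Real.sqrt_le_iff.2 ⟨mul_nonneg h3 (pow_nonneg hρ0.le _), ?_⟩
  have e1 : Real.exp (-(ε ^ 2 * M)) =
      Real.exp (-(ε ^ 2 / 2)) ^ M * Real.exp (-(ε ^ 2 / 4)) ^ (2 * M) := by
    rw [← Real.exp_nat_mul, ← Real.exp_nat_mul, ← Real.exp_add]
    congr 1
    push_cast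
    ring
  calc mixFactor M A * (2 * Real.exp (-(ε ^ 2 * M)))
      = mixFactor M A * Real.exp (-(ε ^ 2 / 2)) ^ M * 2 * Real.exp (-(ε ^ 2 / 4)) ^ (2 * M) := by
        rw [e1]; ring
    _ ≤ (η ^ 2 / 8 * ρ) ^ 2 / 2 * 2 * ρ ^ (2 * M) :=
        mul_le_mul (mul_le_mul_of_nonneg_right hM zero_le_two)
          (pow_le_pow_left₀ (Real.exp_pos _).le h2 _) (pow_nonneg (Real.exp_pos _).le _)
          (by positivity)
    _ = (η ^ 2 / 8) ^ 2 * (ρ ^ (M + 1)) ^ 2 := by rw [mul_comm 2 M, pow_mul, pow_succ]; ring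
    _ ≤ (ρ - (1 - η ^ 2 / 4)) ^ 2 * (ρ ^ (M + 1)) ^ 2 :=
        mul_le_mul_of_nonneg_right (pow_le_pow_left₀ (by positivity) (by linarith) 2)
          (sq_nonneg _)
    _ = _ := by ring

/-- When `M` is polynomial in `r`, every power of `M` is beaten by `ρ ^ r`. -/
theorem exists_concentrated_error_le (A : ℕ) {η ρ δ : ℝ} (hη : 0 < η) (h0 : 0 < ρ) (h1 : ρ < 1)
    (hδ : 0 < δ) : ∃ R : ℕ, ∀ r M : ℕ, R ≤ r → 1 ≤ M → M ≤ (r + 2) ^ 4 →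
      M * ρ ^ r ≤ 1 ∧ 2 * M / η * (mixFactor M A * (5 * (M * ρ ^ r))) ≤ δ := by
  have t1 := eventually_le_of_tendsto_zero (tendsto_add_two_pow_mul_pow 4 h0 h1) zero_lt_one
  have t2 := (tendsto_add_two_pow_mul_pow (4 * (2 * A + 2)) h0 h1).const_mul
    (10 / η * (2 * A + 1) ^ (2 * A))
  rw [mul_zero] at t2
  obtain ⟨R, hR⟩ := eventually_atTop.1 (t1.and (eventually_le_of_tendsto_zero t2 hδ))
  refine ⟨R, fun r M hr hM1 hM => ?_⟩
  obtain ⟨b1, b2⟩ := hR r hr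
  have hM' : (M : ℝ) ≤ ((r : ℝ) + 2) ^ 4 := by exact_mod_cast hM
  have hρr : 0 ≤ ρ ^ r := pow_nonneg h0.le _
  refine ⟨(mul_le_mul_of_nonneg_right hM' hρr).trans b1, le_trans ?_ b2⟩
  calc 2 * M / η * (mixFactor M A * (5 * (M * ρ ^ r)))
      ≤ 2 * M / η * ((2 * A + 1) ^ (2 * A) * (M : ℝ) ^ (2 * A) * (5 * (M * ρ ^ r))) := by
        gcongr
        exact mixFactor_le hM1 A
    _ = 10 / η * (2 * A + 1) ^ (2 * A) * ((M : ℝ) ^ (2 * A + 2) * ρ ^ r) := by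
        rw [pow_add]; ring
    _ ≤ _ := by
        rw [pow_mul ((r : ℝ) + 2)]
        gcongr

/-- These are the conditions that involve only the number of informative sources, independently of
`M`. -/
theorem exists_few_sources_error_le (A : ℕ) {η ρ δ δ₁ : ℝ} (hη : 0 < η) (hη4 : η ≤ 1 / 4)
    (h0 : 0 < ρ) (h1 : ρ < 1) (hδ : 0 < δ) (hδ₁ : 0 < δ₁) : ∃ R : ℕ, ∀ r : ℕ, R ≤ r →
      2 * (4 / η * (1 - η ^ 2 / 4) ^ r) ≤ δ ∧
      (4 / η) ^ (2 * A) * (1 - η) ^ r ≤ 1 ∧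
      2 * ((4 / η) ^ (2 * A) * (1 - η) ^ r) * (1 + ((r : ℝ) + 2) * (4 * A / η)) ≤ δ ∧
      ((r : ℝ) + 2) ^ 2 * (1 - η ^ 2 / 4) ^ r ≤ δ₁ * η / 16 ∧
      1 ≤ δ₁ * ((r : ℝ) + 2) ^ 2 ∧
      ρ ^ r ≤ (1 / 4 : ℝ) ^ ⌈1 / (η ^ 3 / 32)⌉₊ := by
  have hη2 : 0 < η ^ 2 := by positivity
  have a0 : 0 < 1 - η ^ 2 / 4 := by nlinarith
  have a1 : 1 - η ^ 2 / 4 < 1 := by linarith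
  have b0 : 0 < 1 - η := by linarith
  have b1 : 1 - η < 1 := by linarith
  have p0 := fun k => tendsto_add_two_pow_mul_pow k a0 a1
  have q0 := fun k => tendsto_add_two_pow_mul_pow k b0 b1
  have t1 := (p0 0).const_mul (2 * (4 / η))
  have t2 := (q0 0).const_mul ((4 / η) ^ (2 * A))
  have t3 := ((q0 0).const_mul (2 * (4 / η) ^ (2 * A))).add
    ((q0 1).const_mul (2 * (4 / η) ^ (2 * A) * (4 * A / η)))
  have t6 := tendsto_add_two_pow_mul_pow 0 h0 h1
  simp only [mul_zero, add_zero] at t1 t2 t3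
  have t5 : ∀ᶠ r : ℕ in atTop, 1 / δ₁ ≤ (r : ℝ) :=
    tendsto_natCast_atTop_atTop.eventually_ge_atTop _
  obtain ⟨R, hR⟩ := eventually_atTop.1
    ((eventually_le_of_tendsto_zero t1 hδ).and ((eventually_le_of_tendsto_zero t2 zero_lt_one).and
      ((eventually_le_of_tendsto_zero t3 hδ).and
        ((eventually_le_of_tendsto_zero (p0 2) (show 0 < δ₁ * η / 16 by positivity)).and
          (t5.and (eventually_le_of_tendsto_zero t6
            (show (0 : ℝ) < (1 / 4 : ℝ) ^ ⌈1 / (η ^ 3 / 32)⌉₊ by positivity)))))))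
  refine ⟨R, fun r hr => ?_⟩
  obtain ⟨c1, c2, c3, c4, c5, c6⟩ := hR r hr
  simp only [pow_zero, one_mul, pow_one] at c1 c2 c3 c6
  refine ⟨by linarith, c2, by linarith, c4, ?_, c6⟩
  have hr0 : (0 : ℝ) ≤ r := Nat.cast_nonneg _
  rw [div_le_iff₀ hδ₁] at c5
  nlinarith

theorem exists_many_tasks_error_le (A : ℕ) {η δ δ₁ : ℝ} (hη : 0 < η)
    (hδ : 0 < δ) (hδ₁ : 0 < δ₁) : ∃ M₀ : ℕ, ∀ M : ℕ, M₀ ≤ M →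
      2 * M / η * (mixFactor M A * (1 / 2) ^ M) ≤ δ ∧
      4 * M * Real.exp (-(η ^ 3 / 32 / 2)) ^ M ≤ δ ∧
      (M + 1) * (M * (2 * Real.exp (-((η ^ 3 / 32) ^ 2 * M)))) ≤ δ ∧
      (M + 1) * (24 / ((δ₁ / 2) ^ 4 * (M : ℝ) ^ 2)) ≤ δ ∧
      A ≤ η ^ 3 / 32 * M := by
  set ε := η ^ 3 / 32
  have hε : 0 < ε := by positivity
  have hε2 : 0 < ε ^ 2 := by positivity
  have t1 := (tendsto_pow_mul_mixFactor_mul_pow 1 A (q := 1 / 2) (by norm_num)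
    (by norm_num)).const_mul (2 / η)
  have hq : |Real.exp (-(ε / 2))| < 1 := by
    rw [abs_of_pos (Real.exp_pos _)]; exact Real.exp_lt_one_iff.2 (by linarith)
  have hq2 : |Real.exp (-(ε ^ 2))| < 1 := by
    rw [abs_of_pos (Real.exp_pos _)]; exact Real.exp_lt_one_iff.2 (by linarith)
  have t2 := (tendsto_pow_const_mul_const_pow_of_abs_lt_one 1 hq).const_mul 4
  have t3 := (tendsto_pow_const_mul_const_pow_of_abs_lt_one 2 hq2).const_mul 4
  simp only [mul_zero] at t1 t2 t3
  have t4 : ∀ᶠ M : ℕ in atTop, 48 / ((δ₁ / 2) ^ 4 * δ) ≤ (M : ℝ) :=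
    tendsto_natCast_atTop_atTop.eventually_ge_atTop _
  have t5 : ∀ᶠ M : ℕ in atTop, A / ε ≤ (M : ℝ) :=
    tendsto_natCast_atTop_atTop.eventually_ge_atTop _
  obtain ⟨M₀, hM₀⟩ := eventually_atTop.1
    ((eventually_le_of_tendsto_zero t1 hδ).and ((eventually_le_of_tendsto_zero t2 hδ).and
      ((eventually_le_of_tendsto_zero t3 hδ).and (t4.and (t5.and (eventually_ge_atTop 1))))))
  refine ⟨M₀, fun M hM => ?_⟩
  obtain ⟨c1, c2, c3, c4, c5, c6⟩ := hM₀ M hM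
  have hM1 : (1 : ℝ) ≤ M := by exact_mod_cast c6
  have hM0 : (0 : ℝ) < M := by linarith
  simp only [pow_one] at c1 c2
  refine ⟨?_, by linarith, ?_, ?_, ?_⟩
  · calc _ = 2 / η * (M * mixFactor M A * (1 / 2) ^ M) := by ring
      _ ≤ δ := c1
  · have e : Real.exp (-(ε ^ 2 * M)) = Real.exp (-(ε ^ 2)) ^ M := by
      rw [← Real.exp_nat_mul]; congr 1; ring
    rw [e]
    have hx : 0 ≤ Real.exp (-(ε ^ 2)) ^ M := by positivity
    have : (M : ℝ) * Real.exp (-(ε ^ 2)) ^ M ≤ M * (M * Real.exp (-(ε ^ 2)) ^ M) :=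
      le_mul_of_one_le_left (by positivity) hM1
    linarith [c3]
  · have hd : 0 < (δ₁ / 2) ^ 4 := by positivity
    rw [div_le_iff₀ (by positivity)] at c4
    rw [mul_div_assoc', div_le_iff₀ (by positivity)]
    nlinarith
  · rwa [div_le_iff₀ hε, mul_comm] at c5

end Asymptotics


/-! ### Assembly of the two regimes -/

section Incentive

set_option maxHeartbeats 600000 in
/-- With many tasks and many informative sources, a truthful label increases the expected posterior
mean agreement by almost one. -/
theorem exists_le_sum_prob_meanAgr_sub (A : ℕ) {η δ : ℝ} (hη : 0 < η) (hη4 : η ≤ 1 / 4)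
    (hδ : 0 < δ) : ∃ M₀ R : ℕ, ∀ M : ℕ, M₀ ≤ M → ∀ {ι : Type} [Fintype ι] [DecidableEq ι]
      (c w : ι → ℕ) (p : ι → ℝ) (I : Finset ι), Crowdlike c w A M p η I → R ≤ #I →
      ∀ i ∉ I, ∀ j : Fin M, 1 - δ ≤ ∑ u, prob p u *
        (meanAgr c w (setAt u i j true) i - meanAgr c w (setAt u i j false) i) := by
  obtain ⟨ρ, hρ, hρ0, hρ1, hoff⟩ := exists_rate A hη
  set ε := η ^ 3 / 32 with hε
  have hε0 : 0 < ε := by positivity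
  set C := (5 / 2 + 4 * A / η) * (4 / η) ^ 2 * (512 * A / η) with hC
  have hC0 : 0 ≤ C := by positivity
  -- The mean-field bound has seven error terms.
  set δ' := δ / 7 with hδ'
  have hδ'0 : 0 < δ' := by positivity
  -- The three entries bound the covariance error, keep `2 * T` below `ε * M / 2`, and secure the
  -- weak coupling needed for `meanSqDist_le`.
  set δ₁ := min (δ' / (C + 1)) (min (ε / 4) (η / (16 * (A + 1)))) with hδ₁
  have hδ₁0 : 0 < δ₁ := by positivity
  have d1 : δ₁ ≤ δ' / (C + 1) := min_le_left _ _
  have d2 : δ₁ ≤ ε / 4 := (min_le_right _ _).trans (min_le_left _ _)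
  have d3 : δ₁ ≤ η / (16 * (A + 1)) := (min_le_right _ _).trans (min_le_right _ _)
  rw [le_div_iff₀ (by positivity)] at d1 d3
  obtain ⟨M₁, hM₁⟩ := Filter.eventually_atTop.1 hoff
  obtain ⟨R₁, hR₁⟩ := exists_concentrated_error_le A hη hρ0 hρ1 hδ
  obtain ⟨R₂, hR₂⟩ := exists_few_sources_error_le A hη hη4 hρ0 hρ1 hδ'0 hδ₁0
  obtain ⟨M₂, hM₂⟩ := exists_many_tasks_error_le A hη hδ'0 hδ₁0
  refine ⟨max (max M₁ M₂) 1, max R₁ R₂, fun M hM ι _ _ c w p I h hR i hi j => ?_⟩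
  have hoffM := hM₁ M ((le_max_left _ _).trans ((le_max_left _ _).trans hM))
  obtain ⟨m1, m2, m3, m4, -⟩ := hM₂ M ((le_max_right _ _).trans ((le_max_left _ _).trans hM))
  have hM1 : 1 ≤ M := (le_max_right _ _).trans hM
  set r := #I with hr
  obtain ⟨r1, r2, r3, r4, r5, r6⟩ := hR₂ r ((le_max_right _ _).trans hR)
  have hcard : (Fintype.card ι : ℝ) = r + 2 := by
    have := card_add_card_compl I
    rw [h.card_compl] at this
    rw [hr]
    exact_mod_cast this.symm
  -- With `n = r + 2`, the exponent four suits both sides: polynomial growth suffices for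
  -- concentration, and beyond it `M / n ^ 2 ≥ √M`.
  rcases le_or_gt M ((r + 2) ^ 4) with hcase | hcase
  · obtain ⟨a1, a2⟩ := hR₁ r M ((le_max_left _ _).trans hR) hM1 hcase
    exact le_trans (by linarith)
      (h.le_sum_prob_meanAgr_sub_of_concentrated hρ hρ0.le hρ1.le hoffM hM1 a1 i j)
  have hMn : ((r : ℝ) + 2) ^ 4 ≤ M := by exact_mod_cast hcase.le
  have hM0 : (1 : ℝ) ≤ M := by exact_mod_cast hM1
  have hMpos : (0 : ℝ) < M := by linarith
  set n : ℝ := (r : ℝ) + 2 with hn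
  have hn2 : 2 ≤ n := by linarith [(Nat.cast_nonneg r : (0 : ℝ) ≤ r)]
  have hn0 : 0 < n := by linarith
  have hεM : 1 ≤ ε * M := (h.adm i).one_le
  have hc3 := (h.adm i).cube_le
  set m := ⌈ε * M⌉₊ with hm
  have hm1 : ε * M ≤ m := Nat.le_ceil _
  have hm2 : (m : ℝ) ≤ ε * M + 1 := (Nat.ceil_lt_add_one (by positivity)).le
  have hm1' : 1 ≤ m := Nat.one_le_ceil_iff.2 (by linarith)
  have hm2' : 2 * m ≤ M := by
    have h1 : ε * M ≤ 1 / 4 * M := mul_le_mul_of_nonneg_right (by linarith) hMpos.le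
    have : 2 * (m : ℝ) ≤ M := by linarith
    exact_mod_cast this
  -- The threshold for the total error bound: `n ^ 2 * T / M` must be small for the mean-field
  -- error, yet `T` must exceed the typical total, of order `M * (1 - η ^ 2 / 4) ^ r`.
  set T := δ₁ * M / n ^ 2 with hT
  have hTε : T ≤ ε / 4 * M := by
    rw [hT, div_le_iff₀ (by positivity)]
    calc δ₁ * M ≤ ε / 4 * M := mul_le_mul_of_nonneg_right d2 hMpos.le
      _ ≤ ε / 4 * M * n ^ 2 := le_mul_of_one_le_right (by positivity) (one_le_pow₀ (by linarith))
  have hs : Fintype.card ι * (4 * A / (η * M)) * T ≤ 1 / 4 := by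
    have e : Fintype.card ι * (4 * A / (η * M)) * T = 4 * A * δ₁ / (η * n) := by
      rw [hcard, hT]
      field_simp
    rw [e, div_le_iff₀ (by positivity)]
    have h1 : δ₁ * (16 * A) ≤ η := by linarith
    have h2 : η ≤ η * n := le_mul_of_one_le_right hη.le (by linarith)
    linarith
  have hd : 4 * A / (η * M) * (64 * (Fintype.card ι : ℝ) ^ 2 * (T + 1)) ≤ 512 * A / η * δ₁ := by
    have e : 4 * A / (η * M) * (64 * (Fintype.card ι : ℝ) ^ 2 * (T + 1)) =
        256 * A / η * (δ₁ + n ^ 2 / M) := by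
      rw [hcard, hT]
      field_simp
      ring
    have e2 : n ^ 2 / M ≤ δ₁ := by
      rw [div_le_iff₀ hMpos]
      calc n ^ 2 ≤ δ₁ * n ^ 2 * n ^ 2 := le_mul_of_one_le_left (by positivity) r5
        _ = δ₁ * n ^ 4 := by ring
        _ ≤ δ₁ * M := mul_le_mul_of_nonneg_left hMn hδ₁0.le
    rw [e]
    have : 256 * A / η * (δ₁ + n ^ 2 / M) ≤ 256 * A / η * (δ₁ + δ₁) := by gcongr
    calc _ ≤ _ := this
      _ = _ := by ring
  have key := h.le_sum_prob_meanAgr_sub_of_mean_field hρ hρ0.le hρ1.le hoffM hm1' hm2' hm2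
    (T := T) (by positivity) le_rfl r2 hs hd hi j
  refine le_trans ?_ key
  rw [hcard]
  have t2 : (5 / 2 + 4 * A / η) * (4 / η) ^ 2 * (512 * A / η * δ₁) ≤ δ' := by
    rw [← mul_assoc, ← hC]
    linarith
  have t4 : 2 * M / η * (mixFactor M A * (2 ^ M * (ρ ^ r) ^ m)) ≤ δ' := by
    refine le_trans (mul_le_mul_of_nonneg_left (mul_le_mul_of_nonneg_left ?_
      (mixFactor_nonneg _ _)) (by positivity)) m1
    -- Far candidates have `m` of order `ε * M`, so `ρ ^ r ≤ (1 / 4) ^ ⌈1 / ε⌉₊` beats their number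
    -- `2 ^ M`.
    have hL : M ≤ ⌈1 / ε⌉₊ * m := by
      have h1 : 1 / ε ≤ ⌈1 / ε⌉₊ := Nat.le_ceil _
      rw [div_le_iff₀ hε0] at h1
      have h2 : (M : ℝ) ≤ ⌈1 / ε⌉₊ * m := by
        calc (M : ℝ) ≤ (⌈1 / ε⌉₊ * ε) * M := le_mul_of_one_le_left hMpos.le h1
          _ = ⌈1 / ε⌉₊ * (ε * M) := by ring
          _ ≤ _ := mul_le_mul_of_nonneg_left hm1 (Nat.cast_nonneg _)
      exact_mod_cast h2
    calc (2 : ℝ) ^ M * (ρ ^ r) ^ m ≤ 2 ^ M * ((1 / 4) ^ ⌈1 / ε⌉₊) ^ m :=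
          mul_le_mul_of_nonneg_left (pow_le_pow_left₀ (pow_nonneg hρ0.le _) r6 m) (by positivity)
      _ ≤ 2 ^ M * (1 / 4) ^ M := by
          rw [← pow_mul]
          exact mul_le_mul_of_nonneg_left
            (pow_le_pow_of_le_one (by norm_num) (by norm_num) hL) (by positivity)
      _ = (1 / 2) ^ M := by rw [← mul_pow]; norm_num
  have t5 : 4 * M * Real.exp (2 * T - m) ≤ δ' := by
    refine le_trans (mul_le_mul_of_nonneg_left ?_ (by positivity)) m2
    rw [← Real.exp_nat_mul]
    have h1 : 2 * T - m ≤ M * -(ε / 2) := by linarith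
    exact Real.exp_le_exp.2 h1
  have t6 : ((M : ℝ) + 1) * (n * (2 * Real.exp (-(ε ^ 2 * M)))) ≤ δ' := by
    refine le_trans (mul_le_mul_of_nonneg_left (mul_le_mul_of_nonneg_right ?_
      (by positivity)) (by positivity)) m3
    refine le_trans ?_ hMn
    calc n = n * 1 := (mul_one n).symm
      _ ≤ n * n ^ 3 := mul_le_mul_of_nonneg_left (one_le_pow₀ (by linarith)) hn0.le
      _ = n ^ 4 := by ring
  have t7 : ((M : ℝ) + 1) * Real.exp (2 * M * (4 / η * (1 - η ^ 2 / 4) ^ r) - T) ≤ δ' := by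
    refine le_trans (mul_le_mul_of_nonneg_left ?_ (by positivity)) m4
    set y := δ₁ / 2 * (M / n ^ 2) with hy
    have hy0 : 0 < y := by positivity
    have h1 : 2 * M * (4 / η * (1 - η ^ 2 / 4) ^ r) - T ≤ -y := by
      have e1 : T = 2 * y := by rw [hT, hy]; ring
      have e2 : 2 * M * (4 / η * (1 - η ^ 2 / 4) ^ r) =
          8 / η * (M / n ^ 2) * (n ^ 2 * (1 - η ^ 2 / 4) ^ r) := by
        field_simp
        ring
      have e3 : 8 / η * (M / n ^ 2) * (n ^ 2 * (1 - η ^ 2 / 4) ^ r) ≤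
          8 / η * (M / n ^ 2) * (δ₁ * η / 16) := mul_le_mul_of_nonneg_left r4 (by positivity)
      have e4 : 8 / η * (M / n ^ 2) * (δ₁ * η / 16) = y := by
        rw [hy]; field_simp; ring
      linarith
    -- Since `y ≥ δ₁ √M / 2`, the fourth power already outweighs the prefactor `M + 1`.
    have h2 : Real.exp (-y) ≤ 24 / y ^ 4 := by
      have := Real.pow_div_factorial_le_exp y hy0.le 4
      rw [Real.exp_neg, inv_eq_one_div, div_le_div_iff₀ (Real.exp_pos _) (by positivity)]
      norm_num [Nat.factorial] at this
      linarith
    refine (Real.exp_le_exp.2 h1).trans (h2.trans (div_le_div_of_nonneg_left (by norm_num)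
      (by positivity) ?_))
    have h3 : (M : ℝ) ≤ (M / n ^ 2) ^ 2 := by
      rw [div_pow, le_div_iff₀ (by positivity), ← pow_mul, sq (M : ℝ)]
      exact mul_le_mul_of_nonneg_left hMn hMpos.le
    calc (δ₁ / 2) ^ 4 * (M : ℝ) ^ 2 ≤ (δ₁ / 2) ^ 4 * ((M / n ^ 2) ^ 2) ^ 2 := by gcongr
      _ = y ^ 4 := by rw [hy]; ring
  have e7 : δ = 7 * δ' := by rw [hδ']; ring
  rw [e7]
  linarith

/-- Uniform lower bound on the effect of one correct label on its source's posterior mean. -/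
theorem exists_meanAgr_sub_ge (π : Prior) {η : ℝ} (hη : 0 < η) (δ : ℝ) (hδ : 0 < δ) :
    ∃ M₀ : ℕ, ∀ M : ℕ, M₀ ≤ M → ∀ (N : ℕ) (p : Option (Fin N) → ℝ)
      (i : Fin N), (∀ k, η ≤ p k ∧ p k ≤ 1 - η) → (∀ k, k ≠ i → 1 / 2 + η ≤ p (some k)) →
      M ≤ 4 ^ N → ∀ j : Fin M, 1 - δ ≤ ∑ u, prob p u *
        (meanAgr (π.cc N) (π.ww N) (setAt u (some i) j true) (some i) -
          meanAgr (π.cc N) (π.ww N) (setAt u (some i) j false) (some i)) := by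
  -- For `η > 1/4` an informative accuracy would have to satisfy `1/2 + η ≤ p ≤ 1 - η`, which is
  -- impossible. `5 ≤ M ≤ 4 ^ N` supplies a second worker to contradict.
  rcases lt_or_ge (1 / 4) η with hη4 | hη4
  · refine ⟨5, fun M hM N p i hp hinf hMN j => ?_⟩
    have hN : 1 < N := by
      by_contra hN
      have : 4 ^ N ≤ 4 ^ 1 := Nat.pow_le_pow_right (by norm_num) (by omega)
      omega
    obtain ⟨k, hk⟩ : ∃ k : Fin N, k ≠ i := by
      have : Nontrivial (Fin N) := Fin.nontrivial_iff_two_le.2 hN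
      exact exists_ne i
    linarith [hinf k hk, (hp (some k)).2]
  set A := π.correct + π.wrong + π.neg + π.pos
  obtain ⟨M₁, R, hmain⟩ := exists_le_sum_prob_meanAgr_sub A hη hη4 hδ
  obtain ⟨M₂, hM₂⟩ := exists_nat_ge (A / (η ^ 3 / 32))
  -- `4 ^ (R + 1) ≤ M ≤ 4 ^ N` leaves at least `R` workers besides `i`.
  refine ⟨max (max M₁ M₂) (4 ^ (R + 1)), fun M hM N p i hp hinf hMN j => ?_⟩
  have hA : (A : ℝ) ≤ η ^ 3 / 32 * M := by
    rw [div_le_iff₀ (by positivity)] at hM₂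
    have : (M₂ : ℝ) ≤ M := by
      exact_mod_cast (le_max_right _ _).trans ((le_max_left _ _).trans hM)
    refine hM₂.trans ?_
    rw [mul_comm]
    exact mul_le_mul_of_nonneg_left this (by positivity)
  have hRN : R + 1 ≤ N :=
    (Nat.pow_le_pow_iff_right (by norm_num : 1 < 4)).1 (((le_max_right _ _).trans hM).trans hMN)
  set I : Finset (Option (Fin N)) := {none, some i}ᶜ
  have hI : #Iᶜ = 2 := by
    rw [compl_compl]
    exact card_pair (by simp)
  have hcr : Crowdlike (π.cc N) (π.ww N) A M p η I := by
    have hpos := π.wrong_pos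
    have hlt := π.wrong_lt_correct
    have hneg := π.neg_pos
    have hp' := π.pos_pos
    refine ⟨fun k => ⟨hη, hη4, ?_, ?_, ?_, ?_, (hp k).1, (hp k).2, hA⟩, fun k hk => ?_,
      fun k hk => ?_, hI⟩
    · cases k <;> simp only [Prior.cc, Option.elim] <;> omega
    · cases k <;> simp only [Prior.ww, Option.elim] <;> omega
    · cases k <;> simp only [Prior.cc, Option.elim, A] <;> omega
    · cases k <;> simp only [Prior.ww, Option.elim, A] <;> omega
    · cases k with
      | none => simp [I] at hk
      | some k => exact hlt
    · cases k with
      | none => simp [I] at hk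
      | some k => exact hinf k fun e => by simp [I, e] at hk
  have hcard : R ≤ #I := by
    have := card_add_card_compl I
    rw [hI, Fintype.card_option, Fintype.card_fin] at this
    omega
  exact hmain M ((le_max_left _ _).trans ((le_max_left _ _).trans hM)) _ _ p I hcr hcard (some i)
    (by simp [I]) j

end Incentive

end Crowd

theorem theorem2 (π : Crowd.Prior) (η : ℝ) (hη : 0 < η) :
    ∃ M₀ : ℕ, ∀ M : ℕ, M₀ ≤ M → ∀ N : ℕ, ∃ W' : ℕ, ∀ W₀ W : ℕ, W' ≤ W → W₀ < W →
      ∀ (τ : ℝ) (pH c : Fin N → ℝ) (a b : ℝ),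
        η ≤ τ → τ ≤ 1 - η →
        (∀ i, 1 / 2 + η ≤ pH i ∧ pH i ≤ 1 - η) →
        (∀ i, 0 < c i) →
        0 ≤ b →
        (M : ℝ) ≤ ∏ i, (2 * pH i) ^ 2 →
        (∀ i, (1 + η) * (c i / (pH i - 1 / 2)) ≤ a) →
        ∀ (i : Fin N) (r e : ℝ), r ∈ Set.Icc (0 : ℝ) 1 → e ∈ Set.Icc (0 : ℝ) 1 →
          (r, e) ≠ (1, 1) →
          Crowd.expectedUtility (M := M) π W₀ W τ pH c a b
              (Function.update (fun _ => 1) i r) (Function.update (fun _ => 1) i e) i <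
            Crowd.expectedUtility (M := M) π W₀ W τ pH c a b (fun _ => 1) (fun _ => 1) i :=
  Crowd.incentive_of_meanAgr π hη (Crowd.exists_meanAgr_sub_ge π hη)
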